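/- **Setting.** Let $\mathcal O,\mathcal A$ be finite sets and $H\ge 1$. A sequential decision-making problem is given by conditional probabilities $\mathbb P(o_{h+1}\mid o_1,a_1,\dots,o_h,a_h)$, $0\le h<H$. Write $\tau_h=(o_1,a_1,\dots,o_h,a_h)$ for histories, $\omega_h=(o_{h+1},a_{h+1},\dots,o_H,a_H)$ for futures, $\pi(\tau_h)$ (resp. $\pi(\omega_h|\tau_h)$) for the product of the action probabilities of a history-dependent randomized policy $\pi$ along $\tau_h$ (resp. along $\omega_h$ after $\tau_h$), and $\mathtt D_{\mathtt{TV}}(P,Q)=\sum_x|P(x)-Q(x)|$. For each $h\in\{0,\dots,H\}$ fix $d_h$ distinct core tests $\mathbf q_h^1,\dots,\mathbf q_h^{d_h}\in(\mathcal O\times\mathcal A)^{H-h}$ (at $h=H$ the empty test) and fix $\psi_0\in\mathbb R^{d_0}$. A PSR is $\theta=\{\phi_h,\mathbf M_h\}$ with $\mathbf M_h(o,a)\in\mathbb R^{d_h\times d_{h-1}}$, $\phi_h\in\mathbb R^{d_h}$; put $\psi(\tau_h)=\mathbf M_h(o_h,a_h)\cdots\mathbf M_1(o_1,a_1)\psi_0$,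 $\mathbf m(\omega_h)^\top=\phi_H^\top\mathbf M_H(o_H,a_H)\cdots\mathbf M_{h+1}(o_{h+1},a_{h+1})$. It is required that $\phi_h^\top\psi(\tau_h)=\mathbb P_\theta(o_1,\dots,o_h|a_1,\dots,a_h)$ for some sequential decision-making problem $\mathbb P_\theta$, that $\sum_{o}\phi_{h+1}^\top\mathbf M_{h+1}(o,a)=\phi_h^\top$, and that the $\ell$-th entry of $\psi(\tau_h)$ is the joint probability of $\tau_h$ and $\mathbf q^\ell_h$. Let $\mathbb P_\theta^\pi(\tau_h)=\phi_h^\top\psi(\tau_h)\,\pi(\tau_h)$, $V^\pi_{\theta,f}=\sum_{\tau_H}\mathbb P^\pi_\theta(\tau_H)f(\tau_H)$, $\bar\psi(\tau_h)=\psi(\tau_h)/\phi_h^\top\psi(\tau_h)$. The PSR has rank at most $r$ if for each $h$ the matrix $(\mathbb P_\theta(\tau_h,\omega_h))_{\tau_h,\omega_h}$ of the probabilities of the observations given the actions has rank at most $r$. It is $\gamma$-well-conditioned if $\sum_{\omega_h}\pi(\omega_h|\tau_h)|\mathbf m(\omega_h)^\top x|\le 1/\gamma$ for all $0\le h<H$,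 all $x$ with $\|x\|_1\le 1$, all $\pi$ and all $\tau_h$. Let $\mathcal Q_h^A$ be the set of action sequences of the core tests at level $h$, $Q_A=\max_h|\mathcal Q_h^A|$, $d=\max_h d_h$, and $\mathcal Q_h^{\exp}=(\mathcal A\times\mathcal Q_{h+1}^A)\cup\mathcal Q_h^A$. Let $\Theta$ be a set of PSRs (for these core tests and this $\psi_0$) that all have rank at most $r$ and are $\gamma$-well-conditioned, $\gamma>0$; let $\theta^*\in\Theta$ be the true model and $R:(\mathcal O\times\mathcal A)^H\to[0,1]$ a reward. An $\varepsilon$-optimistic net of $\Theta$ is a finite set of functions $f$ on $(\mathcal O\times\mathcal A)^H$ such that each $\theta\in\Theta$ has an $f$ in it with $f(\tau_H)\pi(\tau_H)\ge\mathbb P_\theta^\pi(\tau_H)$ for all $\pi,\tau_H$ and $\sum_{\tau_H}|f(\tau_H)\pi(\tau_H)-\mathbb P_\theta^\pi(\tau_H)|\le\varepsilon$ for all $\pi$; $|\bar\Theta_\varepsilon|$ is the smallest cardinality of such a net. **Algorithm PSR-UCB** (inputs $p_{\min},\beta,\lambda,\alpha$, accuracy $\epsilon_0$, at most $K$ iterations,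 arbitrary initial policy $\pi^0$). In iteration $k=1,\dots,K$, for each level $h=0,\dots,H-1$ one trajectory is collected by following $\pi^{k-1}$ for $h$ steps and then executing an action sequence drawn uniformly from $\mathcal Q_h^{\exp}$; the trajectory, with this collecting policy, is added to $\mathcal D_h$. Let $\Theta_{\min}^k$ be the set of $\theta\in\Theta$ with $\mathbb P_\theta^\pi(\tau_h)\ge p_{\min}$ for all $h$ and $(\tau_h,\pi)\in\mathcal D_h$; extract any $\hat\theta^k\in\Theta_{\min}^k$ whose log-likelihood of all the data is at least the supremum over $\Theta_{\min}^k$ minus $\beta$. With the features $\bar{\hat\psi}^k$ of $\hat\theta^k$ put $\hat U_h^k=\lambda I+\sum_{\tau_h\in\mathcal D_h}\bar{\hat\psi}^k(\tau_h)\bar{\hat\psi}^k(\tau_h)^\top$ and $\hat b^k(\tau_H)=\min\{\alpha(\sum_{h=0}^{H-1}\|\bar{\hat\psi}^k(\tau_h)\|^2_{(\hat U_h^k)^{-1}})^{1/2},1\}$, and let $\pi^k$ maximize $V^\pi_{\hat\theta^k,\hat b^k}$. If $V^{\pi^k}_{\hat\theta^k,\hat b^k}\le\epsilon_0/2$, stop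 and return $\theta^\epsilon=\hat\theta^k$ and any $\bar\pi$ maximizing $V^\pi_{\theta^\epsilon,R}$. **Theorem.** For every $\eta>0$ there are constants $c_1,c_2,c_3,c_4,C>0$ and $p\in\mathbb N$, depending only on $\eta$, such that in every setting as above (with $\mathcal A\neq\emptyset$), for all $0<\epsilon\le 2$ and $0<\delta<1$, the following holds. For $K\ge 2$ set $$p_{\min}=\frac{c_1\delta}{KH|\mathcal O|^H|\mathcal A|^H},\quad \varepsilon=\frac{c_2\,p_{\min}}{KH},\quad \beta=c_3\log\frac{K|\bar\Theta_\varepsilon|}{\delta},\quad \lambda=\frac{\gamma|\mathcal A|^2Q_A\beta\max\{\sqrt r,Q_A\sqrt H/\gamma\}}{\sqrt{dH}},$$ $$\alpha=c_4\Big(\frac{Q_A\sqrt{Hd}}{\gamma^2}\sqrt\lambda+\frac{|\mathcal A|Q_A\sqrt\beta}{\gamma}\Big),\qquad B_K=C\Big(r+\frac{Q_A^2H}{\gamma^2}\Big)\frac{r\,d\,H^3|\mathcal A|^2Q_A^4\,\beta}{\gamma^4\epsilon^2}\,\log^p\!\Big(3+\frac{K\,r\,d\,H\,|\mathcal A|\,Q_A}{\gamma\epsilon\delta}\Big).$$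 Then $B_K\le KH$ for all sufficiently large $K$; and for every $K\ge2$ with $B_K\le KH$, PSR-UCB run with these inputs and accuracy $\epsilon_0=\epsilon/(1+\eta)$ has the following property, whatever the choices left open in it (as functions of the data). With probability at least $1-\delta$ it stops within $K$ iterations, after collecting at most $B_K$ trajectories, and the returned $\theta^\epsilon$ and $\bar\pi$ satisfy $$\max_\pi V^\pi_{\theta^*,R}-V^{\bar\pi}_{\theta^*,R}\le\epsilon\qquad\text{and}\qquad \mathtt D_{\mathtt{TV}}\big(\mathbb P^\pi_{\theta^\epsilon}(\tau_H),\mathbb P^\pi_{\theta^*}(\tau_H)\big)\le\epsilon\ \text{ for every policy }\pi.$$ -/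

import Mathlib

noncomputable section

namespace PSRUCB

/-- The first `t` entries of a finite sequence. -/
def pre {α : Type} {n : ℕ} (x : Fin n → α) (t : ℕ) (ht : t ≤ n) : Fin t → α :=
  fun i => x (Fin.castLE ht i)

/-- The total variation distance, in the normalisation `∑ |P - Q|` (no factor `1/2`). -/
def tv {X : Type} [Fintype X] (P Q : X → ℝ) : ℝ := ∑ x, |P x - Q x|

/-- The dynamics of a sequential decision-making problem: `kernel t τ o` is the probability that
the next observation is `o` after the history `τ` of `t` observation-action pairs. -/
structure Dynamics (O A : Type) [Fintype O] where
  kernel : (t : ℕ) → (Fin t → O × A) → O → ℝ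
  nonneg : ∀ t τ o, 0 ≤ kernel t τ o
  sum_one : ∀ t τ, ∑ o, kernel t τ o = 1

/-- `ℙ(o₁, …, o_h | a₁, …, a_h)`. -/
def Dynamics.prob {O A : Type} [Fintype O] (P : Dynamics O A) {h : ℕ}
    (τ : Fin h → O × A) : ℝ :=
  ∏ t : Fin h, P.kernel t (pre τ t t.2.le) (τ t).1

/-- A (history-dependent, randomised) policy: `act t τ o a` is the probability of playing `a`
when the history is `τ` (of `t` pairs) and the current observation is `o`. -/
structure Policy (O A : Type) [Fintype A] where
  act : (t : ℕ) → (Fin t → O × A) → O → A → ℝ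
  nonneg : ∀ t τ o a, 0 ≤ act t τ o a
  sum_one : ∀ t τ o, ∑ a, act t τ o a = 1

/-- `π(τ_h)`, the probability of the actions of `τ_h` given its observations. -/
def Policy.weight {O A : Type} [Fintype A] (π : Policy O A) {h : ℕ}
    (τ : Fin h → O × A) : ℝ :=
  ∏ t : Fin h, π.act t (pre τ t t.2.le) (τ t).1 (τ t).2

/-- `π(ω_h | τ_h)`, for a future `ω` of the history `τ`. -/
def Policy.condWeight {O A : Type} [Fintype A] (π : Policy O A) {h n : ℕ}
    (τ : Fin h → O × A) (ω : Fin n → O × A) : ℝ :=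
  ∏ j : Fin n, π.act (h + j) (pre (Fin.append τ ω) (h + j) (by omega)) (ω j).1 (ω j).2

/-- What the agent knows: for every `h ≤ H` the `d h` distinct core tests at level `h`, each of
them a full future of length `H - h` (so the only possible test at level `H` is the empty
one), and the vector `ψ₀`.  Entries with `h > H` play no role. -/
structure CoreTests (O A : Type) (H : ℕ) where
  d : ℕ → ℕ
  test : (h : ℕ) → Fin (d h) → (Fin (H - h) → O × A)
  test_injective : ∀ h, Function.Injective (test h)
  ψ₀ : Fin (d 0) → ℝ

/-- The parameters `θ = {φ_h, M_h}`; `M h` maps level `h` to level `h + 1`.  Only `φ h` with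
`h ≤ H` and `M h` with `h < H` are ever used. -/
structure PSR {O A : Type} {H : ℕ} (S : CoreTests O A H) where
  φ : (h : ℕ) → Fin (S.d h) → ℝ
  M : (h : ℕ) → O → A → Matrix (Fin (S.d (h + 1))) (Fin (S.d h)) ℝ

section Model

variable {O A : Type} {H : ℕ} {S : CoreTests O A H}

/-- `ψ(τ_h) = M_h(o_h, a_h) ⋯ M_1(o_1, a_1) ψ₀`. -/
def PSR.ψ (θ : PSR S) : (h : ℕ) → (Fin h → O × A) → Fin (S.d h) → ℝ
  | 0, _ => S.ψ₀
  | h + 1, τ =>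
      (θ.M h (τ (Fin.last h)).1 (τ (Fin.last h)).2).mulVec (θ.ψ h (Fin.init τ))

/-- `m(ω)ᵀ = φ_{h+n}ᵀ M_{h+n}(o_{h+n}, a_{h+n}) ⋯ M_{h+1}(o_{h+1}, a_{h+1})` for a sequence `ω`
of `n` pairs that starts at level `h`. -/
def PSR.m (θ : PSR S) : (n h : ℕ) → (Fin n → O × A) → Fin (S.d h) → ℝ
  | 0, h, _ => θ.φ h
  | n + 1, h, ω =>
      Matrix.vecMul (θ.m n (h + 1) (Fin.tail ω)) (θ.M h (ω 0).1 (ω 0).2)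

/-- `ℙ_θ(o₁, …, o_h | a₁, …, a_h) = φ_hᵀ ψ(τ_h)`. -/
def PSR.prob (θ : PSR S) {h : ℕ} (τ : Fin h → O × A) : ℝ := θ.φ h ⬝ᵥ θ.ψ h τ

/-- The prediction feature `ψ(τ_h) / φ_hᵀ ψ(τ_h)`. -/
def PSR.ψbar (θ : PSR S) {h : ℕ} (τ : Fin h → O × A) : Fin (S.d h) → ℝ :=
  (θ.prob τ)⁻¹ • θ.ψ h τ

/-- The dynamic matrix at level `h` (used with `h + n = H`). -/
def PSR.dynMatrix (θ : PSR S) (h n : ℕ) : Matrix (Fin h → O × A) (Fin n → O × A) ℝ :=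
  Matrix.of fun τ ω => θ.prob (Fin.append τ ω)

/-- `θ` is a self-consistent predictive state representation, with respect to the given core
tests and `ψ₀`, of some sequential decision-making problem. -/
structure PSR.IsPSR [Fintype O] (θ : PSR S) : Prop where
  /-- the law given by `θ` is that of a sequential decision-making problem -/
  represents : ∃ P : Dynamics O A, ∀ h ≤ H, ∀ τ : Fin h → O × A, θ.prob τ = P.prob τ
  /-- `∑_o φ_{h+1}ᵀ M_{h+1}(o, a) = φ_hᵀ` -/
  consistent : ∀ h < H, ∀ a : A,
    ∑ o : O, Matrix.vecMul (θ.φ (h + 1)) (θ.M h o a) = θ.φ h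
  /-- the `ℓ`-th entry of `ψ(τ_h)` is the joint probability of `τ_h` and the `ℓ`-th core test -/
  core : ∀ h ≤ H, ∀ (τ : Fin h → O × A) (l : Fin (S.d h)),
    θ.ψ h τ l = θ.prob (Fin.append τ (S.test h l))

/-- All dynamic matrices have rank at most `r`. -/
def PSR.RankLE [Fintype O] [Fintype A] (θ : PSR S) (r : ℕ) : Prop :=
  ∀ h n, h + n = H → (θ.dynMatrix h n).rank ≤ r

/-- `γ`-well-conditioned: for all levels `h = 0, …, H - 1`. -/
def PSR.WellConditioned [Fintype O] [Fintype A] (θ : PSR S) (γ : ℝ) : Prop :=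
  ∀ h n, h + n = H → h < H → ∀ x : Fin (S.d h) → ℝ, ∑ i, |x i| ≤ 1 →
    ∀ (π : Policy O A) (τ : Fin h → O × A),
      ∑ ω : Fin n → O × A, π.condWeight τ ω * |θ.m n h ω ⬝ᵥ x| ≤ 1 / γ

/-- `ℙ_θ^π(τ_h)`. -/
def PSR.law [Fintype A] (θ : PSR S) (π : Policy O A) {h : ℕ} (τ : Fin h → O × A) : ℝ :=
  θ.prob τ * π.weight τ

/-- The value `V_{θ,f}^π`, the mean of `f` over full trajectories drawn from `ℙ_θ^π`. -/
def PSR.value [Fintype O] [Fintype A] (θ : PSR S) (f : (Fin H → O × A) → ℝ)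
    (π : Policy O A) : ℝ :=
  ∑ τ : Fin H → O × A, θ.law π τ * f τ

end Model

section Tests

variable {O A : Type} {H : ℕ}

/-- `d = max_h d_h`. -/
def CoreTests.dim (S : CoreTests O A H) : ℕ := (Finset.range (H + 1)).sup S.d

/-- The set of core action sequences at level `h`. -/
def CoreTests.coreActions [DecidableEq A] (S : CoreTests O A H) (h : ℕ) : Finset (List A) :=
  Finset.univ.image fun l : Fin (S.d h) => List.ofFn fun i => (S.test h l i).2

/-- `Q_A`, the largest number of core action sequences at a level. -/
def CoreTests.QA [DecidableEq A] (S : CoreTests O A H) : ℕ :=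
  (Finset.range (H + 1)).sup fun h => (S.coreActions h).card

/-- The exploration sequences `(A × coreActions (h + 1)) ∪ coreActions h` at level `h`. -/
def CoreTests.exploration [DecidableEq A] [Fintype A] (S : CoreTests O A H) (h : ℕ) :
    Finset (List A) :=
  ((Finset.univ ×ˢ S.coreActions (h + 1)).image fun p : A × List A => p.1 :: p.2) ∪
    S.coreActions h

end Tests

section Net

variable {O A : Type} {H : ℕ} {S : CoreTests O A H}

/-- `Q` is `ε`-optimistic over `P`. -/
def IsOptimistic {X : Type} [Fintype X] (ε : ℝ) (P Q : X → ℝ) : Prop :=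
  (∀ x, P x ≤ Q x) ∧ tv P Q ≤ ε

/-- The finite set `N` of functions on trajectories (each giving, for every policy `π`, the
function `τ ↦ f τ * π(τ)`) is an `ε`-optimistic net of `Θ`. -/
def IsOptimisticNet [Fintype O] [Fintype A] (Θ : Set (PSR S)) (ε : ℝ)
    (N : Finset ((Fin H → O × A) → ℝ)) : Prop :=
  ∀ θ ∈ Θ, ∃ f ∈ N, ∀ π : Policy O A,
    IsOptimistic ε (fun τ : Fin H → O × A => θ.law π τ) (fun τ => f τ * π.weight τ)

/-- The cardinality of a smallest `ε`-optimistic net of `Θ`. -/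
def netCard [Fintype O] [Fintype A] (Θ : Set (PSR S)) (ε : ℝ) : ℕ :=
  sInf {n | ∃ N : Finset ((Fin H → O × A) → ℝ), N.card = n ∧ IsOptimisticNet Θ ε N}

end Net

/-! ### The algorithm -/

/-- The trajectories collected in one iteration: one for every level `h = 0, …, H - 1`. -/
abbrev Batch (O A : Type) (H : ℕ) : Type := Fin H → Fin H → O × A

/-- The inputs `p_min, β, λ, α` of the algorithm. -/
structure Inputs where
  pmin : ℝ
  β : ℝ
  lam : ℝ
  α : ℝ

/-- The choices left open by the algorithm, as functions of the `n` batches collected so far: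
the extracted model, the greedy exploration policy (for `n = 0` this is the arbitrary
initial policy), and the policy returned if the algorithm stops now. -/
structure Oracle {O A : Type} {H : ℕ} (S : CoreTests O A H) [Fintype A] where
  est : (n : ℕ) → (Fin n → Batch O A H) → PSR S
  pol : (n : ℕ) → (Fin n → Batch O A H) → Policy O A
  out : (n : ℕ) → (Fin n → Batch O A H) → Policy O A

section Algorithm

variable {O A : Type} [Fintype O] [Fintype A] [DecidableEq A] {H : ℕ} {S : CoreTests O A H}

/-- The probability of the full trajectory `τ` under `θ` when `π` is played up to level `h` and
then an action sequence drawn uniformly from `S.exploration h` is executed. -/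
def exploreLaw (θ : PSR S) (π : Policy O A) (h : Fin H) (τ : Fin H → O × A) : ℝ :=
  θ.prob τ * (π.weight (pre τ h h.2.le) *
    (if (List.ofFn fun i => (τ i).2).drop h ∈ S.exploration h
      then ((S.exploration h).card : ℝ)⁻¹ else 0))

/-- The policy that generates the `t`-th batch (`t = 0, 1, …`) of the data `D`. -/
def Oracle.polAt (ora : Oracle S) {n : ℕ} (D : Fin n → Batch O A H) (t : Fin n) : Policy O A :=
  ora.pol t (pre D t t.2.le)

/-- The log-likelihood of the data, with values in `[-∞, ∞]`. -/
def logLik (ora : Oracle S) {n : ℕ} (D : Fin n → Batch O A H) (θ : PSR S) : EReal :=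
  ∑ t : Fin n, ∑ h : Fin H,
    ENNReal.log (ENNReal.ofReal (exploreLaw θ (ora.polAt D t) h (D t h)))

/-- The models of `Θ` that give probability at least `p_min` to every collected history. -/
def thetaMin (Θ : Set (PSR S)) (p : Inputs) (ora : Oracle S) {n : ℕ}
    (D : Fin n → Batch O A H) : Set (PSR S) :=
  {θ ∈ Θ | ∀ (t : Fin n) (h : Fin H), p.pmin ≤ θ.law (ora.polAt D t) (pre (D t h) h h.2.le)}

/-- The confidence set: log-likelihood within `β` of the largest one over `thetaMin`. -/
def confSet (Θ : Set (PSR S)) (p : Inputs) (ora : Oracle S) {n : ℕ}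
    (D : Fin n → Batch O A H) : Set (PSR S) :=
  {θ ∈ thetaMin Θ p ora D |
    (⨆ θ' ∈ thetaMin Θ p ora D, logLik ora D θ') - (p.β : EReal) ≤ logLik ora D θ}

/-- `λ I + ∑ ψbar(τ_h) ψbar(τ_h)ᵀ`, the sum being over the data of level `h`. -/
def gram (p : Inputs) (θ : PSR S) {n : ℕ} (D : Fin n → Batch O A H) (h : Fin H) :
    Matrix (Fin (S.d h)) (Fin (S.d h)) ℝ :=
  p.lam • (1 : Matrix (Fin (S.d h)) (Fin (S.d h)) ℝ) +
    ∑ t : Fin n, Matrix.vecMulVec (θ.ψbar (pre (D t h) h h.2.le))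
      (θ.ψbar (pre (D t h) h h.2.le))

/-- The bonus function. -/
def bonus (p : Inputs) (θ : PSR S) {n : ℕ} (D : Fin n → Batch O A H)
    (τ : Fin H → O × A) : ℝ :=
  min (p.α * √(∑ h : Fin H, θ.ψbar (pre τ h h.2.le) ⬝ᵥ
    (gram p θ D h)⁻¹.mulVec (θ.ψbar (pre τ h h.2.le)))) 1

/-- The oracle answers as the algorithm demands: it extracts a model from the confidence set
(whenever there is one), and its policies maximise the value of the bonus, respectively of the
reward `R`, under that model. -/
structure Oracle.Valid (ora : Oracle S) (Θ : Set (PSR S)) (p : Inputs)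
    (R : (Fin H → O × A) → ℝ) : Prop where
  est_mem : ∀ n, 1 ≤ n → ∀ D : Fin n → Batch O A H,
    (confSet Θ p ora D).Nonempty → ora.est n D ∈ confSet Θ p ora D
  pol_greedy : ∀ n, 1 ≤ n → ∀ (D : Fin n → Batch O A H) (π : Policy O A),
    (ora.est n D).value (bonus p (ora.est n D) D) π ≤
      (ora.est n D).value (bonus p (ora.est n D) D) (ora.pol n D)
  out_greedy : ∀ n, 1 ≤ n → ∀ (D : Fin n → Batch O A H) (π : Policy O A),
    (ora.est n D).value R π ≤ (ora.est n D).value R (ora.out n D)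

/-- The termination test with accuracy `ε`, after the batches `D`. -/
def StopTest (ora : Oracle S) (p : Inputs) (ε : ℝ) {n : ℕ} (D : Fin n → Batch O A H) : Prop :=
  (ora.est n D).value (bonus p (ora.est n D) D) (ora.pol n D) ≤ ε / 2

/-- On the data stream `D`, the algorithm stops at iteration `k`: all models up to then could be
extracted from the confidence sets, and the termination test succeeds for the first time. -/
def StopsAt (ora : Oracle S) (Θ : Set (PSR S)) (p : Inputs) (ε : ℝ) {K : ℕ}
    (D : Fin K → Batch O A H) (k : ℕ) (hk : k ≤ K) : Prop :=
  1 ≤ k ∧ StopTest ora p ε (pre D k hk) ∧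
    ∀ j, 1 ≤ j → ∀ hj : j ≤ k,
      ora.est j (pre D j (hj.trans hk)) ∈ confSet Θ p ora (pre D j (hj.trans hk)) ∧
      (j < k → ¬ StopTest ora p ε (pre D j (hj.trans hk)))

/-- The probability, under the environment `θ`, of the data stream `D` of `K` batches.  The
stream is continued after the termination of the algorithm; what the algorithm does up to its
termination at iteration `k` depends on the first `k` batches only. -/
def streamProb (ora : Oracle S) (θ : PSR S) {K : ℕ} (D : Fin K → Batch O A H) : ℝ :=
  ∏ t : Fin K, ∏ h : Fin H, exploreLaw θ (ora.polAt D t) h (D t h)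

open Classical in
/-- The probability of an event that concerns the data stream of `K` batches. -/
def streamPr (ora : Oracle S) (θ : PSR S) (K : ℕ) (E : (Fin K → Batch O A H) → Prop) : ℝ :=
  ∑ D : Fin K → Batch O A H, if E D then streamProb ora θ D else 0

end Algorithm

/-! ### The choice of the inputs and the sample complexity -/

/-- Absolute constants hidden in the `O(·)` and `Õ(·)` of the statement. -/
structure Consts where
  cp : ℝ
  cε : ℝ
  cβ : ℝ
  cα : ℝ
  C : ℝ
  deg : ℕ
  cp_pos : 0 < cp
  cε_pos : 0 < cε
  cβ_pos : 0 < cβ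
  cα_pos : 0 < cα
  C_pos : 0 < C

section Choice

variable {O A : Type} [Fintype O] [Fintype A] [DecidableEq A] {H : ℕ} {S : CoreTests O A H}

/-- `p_min = c δ / (K H |O|^H |A|^H)`. -/
def pminOf (c : Consts) (O A : Type) [Fintype O] [Fintype A] (H : ℕ) (δ : ℝ) (K : ℕ) : ℝ :=
  c.cp * δ / (K * H * (Fintype.card O : ℝ) ^ H * (Fintype.card A : ℝ) ^ H)

/-- `β = c log (K |Θ̄_ε'| / δ)` with `ε' = c p_min / (K H)`. -/
def betaOf (c : Consts) (Θ : Set (PSR S)) (δ : ℝ) (K : ℕ) : ℝ :=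
  c.cβ * Real.log (K * netCard Θ (c.cε * pminOf c O A H δ K / (K * H)) / δ)

/-- `λ = γ |A|² Q_A β max{√r, Q_A √H / γ} / √(d H)`. -/
def lamOf (c : Consts) (Θ : Set (PSR S)) (r : ℕ) (γ δ : ℝ) (K : ℕ) : ℝ :=
  γ * (Fintype.card A : ℝ) ^ 2 * S.QA * betaOf c Θ δ K *
    max (√(r : ℝ)) (S.QA * √(H : ℝ) / γ) / √((S.dim : ℝ) * H)

/-- `α = c (Q_A √(H d) √λ / γ² + |A| Q_A √β / γ)`. -/
def alphaOf (c : Consts) (Θ : Set (PSR S)) (r : ℕ) (γ δ : ℝ) (K : ℕ) : ℝ :=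
  c.cα * (S.QA * √((H : ℝ) * S.dim) / γ ^ 2 * √(lamOf c Θ r γ δ K) +
    Fintype.card A * S.QA * √(betaOf c Θ δ K) / γ)

/-- The inputs with which the algorithm is run when at most `K` iterations are allowed. -/
def inputsOf (c : Consts) (Θ : Set (PSR S)) (r : ℕ) (γ δ : ℝ) (K : ℕ) : Inputs where
  pmin := pminOf c O A H δ K
  β := betaOf c Θ δ K
  lam := lamOf c Θ r γ δ K
  α := alphaOf c Θ r γ δ K

/-- The sample complexity
`C (r + Q_A² H / γ²) r d H³ |A|² Q_A⁴ β / (γ⁴ ε²)`, times a power of a logarithm. -/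
def sampleBound (c : Consts) (Θ : Set (PSR S)) (r : ℕ) (γ ε δ : ℝ) (K : ℕ) : ℝ :=
  c.C * ((r + (S.QA : ℝ) ^ 2 * H / γ ^ 2) *
    (r * S.dim * (H : ℝ) ^ 3 * (Fintype.card A : ℝ) ^ 2 * (S.QA : ℝ) ^ 4 * betaOf c Θ δ K /
      (γ ^ 4 * ε ^ 2))) *
  Real.log (3 + K * r * S.dim * H * Fintype.card A * S.QA / (γ * ε * δ)) ^ c.deg

end Choice

end PSRUCB

end

open PSRUCB

/-! The proof combines a deterministic comparison of two models, a likelihood argument, and a count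
of iterations.

Comparison. State vectors are measured by the control norm `PSR.ctrl`, the largest value over
policies of the sum of π(ω)|m(ω)ᵀx|. By its dynamic programme it does not grow along the dynamics of
its own model, so replacing one model by another one step at a time bounds the distance of the laws
by a sum of one-step errors `PSR.err`. Each such error is a seminorm of the state. Hence its value
at any feature is at most its size on the collected features times the elliptical norm of that
feature (`IsSeminorm.sq_le_quadInv`), and on collected features it is bounded by the distance of the
conditional laws of the exploratory futures (`PSR.err_ψbar_le`). Trajectories are stopped once the
accumulated elliptical norm passes a threshold, which yields a bound by the truncated bonus itself
(`PSR.tv_le_value_min`): the distance of the laws is at most 2(1 + Y/α) times the value of the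
bonus, where Y measures the error on the data. As α is at least Y/η, a run that stops with accuracy
ε/(1+η) has distance at most ε, and the values of a reward in [0,1] then change by at most ε/2.

Likelihood. For an optimistic envelope f of a model, square roots of likelihood ratios times exp(1 -
affinity), multiplied along the stream, have mean at most exp(KHε/2) for a net of accuracy ε.
Markov's inequality and a union bound over the net and the run lengths show that the true model
stays in every confidence set (`mem_confSet`), and that every model in it has summed squared
conditional distances of order β from the truth on the data (`dataDist_le_of_mem_confSet`). The
threshold p_min makes the envelopes accurate after conditioning on a history.

Counting. The bonus is built from estimated features, which change from one iteration to the next,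
so it is first compared with the true features (`value_bonus_le`). The law of the trajectory is
changed by the comparison above. The difference of the features along a trajectory is handled by a
weak-type maximal inequality (`PSR.value_exists_featDist_le`), summed over dyadic levels at
logarithmic cost. The true features are fixed vectors spanning a space of dimension at most r, so
the elliptical potential, transferred to expectations by an exponential supermartingale
(`streamPr_expPotential_le`), grows like r times a logarithm. By Cauchy-Schwarz the bonuses over m
iterations sum to order √m, whereas without stopping they would exceed (m - 1)ε/(2(1+η)). This is
impossible for m = ⌊B_K/H⌋ (`sum_bonus_lt`, `exists_stopTest`). -/

set_option linter.unusedSectionVars false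

noncomputable section

namespace PSRUCB

open Finset

/-! ### Finite sequences -/

section Seq

variable {α : Type}

@[simp] lemma pre_self {n : ℕ} (x : Fin n → α) (h : n ≤ n) : pre x n h = x := rfl

lemma pre_pre {n t s : ℕ} (x : Fin n → α) (ht : t ≤ n) (hs : s ≤ t) :
    pre (pre x t ht) s hs = pre x s (hs.trans ht) := rfl

lemma pre_apply {n t : ℕ} (x : Fin n → α) (ht : t ≤ n) (i : Fin t) :
    pre x t ht i = x (Fin.castLE ht i) := rfl

lemma pre_snoc {n t : ℕ} (x : Fin n → α) (a : α) (ht : t ≤ n) :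
    pre (Fin.snoc (α := fun _ => α) x a) t (ht.trans n.le_succ) = pre x t ht := by
  funext i
  have : Fin.castLE (ht.trans n.le_succ) i = Fin.castSucc (Fin.castLE ht i) := by ext; simp
  rw [pre_apply, pre_apply, this]
  exact Fin.snoc_castSucc (α := fun _ => α) a x (Fin.castLE ht i)

lemma pre_snoc_self {n : ℕ} (x : Fin n → α) (a : α) (h : n ≤ n + 1) :
    pre (Fin.snoc (α := fun _ => α) x a) n h = x := pre_snoc x a le_rfl

lemma sum_snoc [Fintype α] {n : ℕ} (f : (Fin (n + 1) → α) → ℝ) :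
    ∑ τ, f τ = ∑ τ : Fin n → α, ∑ x, f (Fin.snoc (α := fun _ => α) τ x) := by
  rw [← (Fin.snocEquiv fun _ : Fin (n + 1) => α).sum_comp, Fintype.sum_prod_type, sum_comm]
  rfl

lemma sum_cons [Fintype α] {n : ℕ} (f : (Fin (n + 1) → α) → ℝ) :
    ∑ τ, f τ = ∑ x, ∑ τ : Fin n → α, f (Fin.cons (α := fun _ => α) x τ) := by
  rw [← (Fin.consEquiv fun _ : Fin (n + 1) => α).sum_comp, Fintype.sum_prod_type]
  rfl

lemma snoc_pre_last {n : ℕ} (x : Fin (n + 1) → α) :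
    Fin.snoc (α := fun _ => α) (pre x n n.le_succ) (x (Fin.last n)) = x :=
  Fin.snoc_init_self x

end Seq

/-- The real-valued indicator of a proposition. -/
def ind (p : Prop) : ℝ := open Classical in if p then 1 else 0

lemma ind_true {p : Prop} (h : p) : ind p = 1 := by simp [ind, h]

lemma ind_false {p : Prop} (h : ¬ p) : ind p = 0 := by simp [ind, h]

lemma ind_nonneg (p : Prop) : 0 ≤ ind p := by unfold ind; split_ifs <;> norm_num

lemma ind_le_one (p : Prop) : ind p ≤ 1 := by unfold ind; split_ifs <;> norm_num

lemma ind_and (p q : Prop) : ind (p ∧ q) = ind p * ind q := by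
  by_cases hp : p <;> by_cases hq : q <;> simp [ind, hp, hq]

lemma ind_add_not (p : Prop) : ind p + ind (¬ p) = 1 := by
  by_cases hp : p <;> simp [ind, hp]

lemma ind_mono {p q : Prop} (h : p → q) : ind p ≤ ind q := by
  by_cases hp : p
  · rw [ind_true hp, ind_true (h hp)]
  · rw [ind_false hp]; exact ind_nonneg q

lemma ind_or_le (p q : Prop) : ind (p ∨ q) ≤ ind p + ind q := by
  by_cases hp : p <;> by_cases hq : q <;> simp [ind, hp, hq]

/-! ### Laws of histories -/

section Laws

variable {O A : Type}

lemma Policy.weight_snoc [Fintype A] (π : Policy O A) {n : ℕ} (τ : Fin n → O × A) (x : O × A) :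
    π.weight (Fin.snoc (α := fun _ => O × A) τ x) = π.weight τ * π.act n τ x.1 x.2 := by
  unfold Policy.weight
  rw [Fin.prod_univ_castSucc]
  congr 1
  · refine prod_congr rfl fun t _ => ?_
    rw [Fin.snoc_castSucc (α := fun _ => O × A) x τ t]
    have := pre_snoc τ x t.2.le
    simp only [Fin.val_castSucc]
    rw [this]
  · rw [Fin.snoc_last (α := fun _ => O × A)]
    simp only [Fin.val_last]
    rw [pre_snoc_self]

lemma Policy.weight_nonneg [Fintype A] (π : Policy O A) {n : ℕ} (τ : Fin n → O × A) :
    0 ≤ π.weight τ := prod_nonneg fun _ _ => π.nonneg _ _ _ _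

lemma Policy.weight_zero [Fintype A] (π : Policy O A) (τ : Fin 0 → O × A) : π.weight τ = 1 := by
  simp [Policy.weight]

lemma Dynamics.prob_snoc [Fintype O] (P : Dynamics O A) {n : ℕ} (τ : Fin n → O × A) (x : O × A) :
    P.prob (Fin.snoc (α := fun _ => O × A) τ x) = P.prob τ * P.kernel n τ x.1 := by
  unfold Dynamics.prob
  rw [Fin.prod_univ_castSucc]
  congr 1
  · refine prod_congr rfl fun t _ => ?_
    rw [Fin.snoc_castSucc (α := fun _ => O × A) x τ t]
    have := pre_snoc τ x t.2.le
    simp only [Fin.val_castSucc]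
    rw [this]
  · rw [Fin.snoc_last (α := fun _ => O × A)]
    simp only [Fin.val_last]
    rw [pre_snoc_self]

lemma Dynamics.prob_nonneg [Fintype O] (P : Dynamics O A) {n : ℕ} (τ : Fin n → O × A) :
    0 ≤ P.prob τ := prod_nonneg fun _ _ => P.nonneg _ _ _

variable {H : ℕ} {S : CoreTests O A H} [Fintype O]

lemma PSR.ψ_snoc (θ : PSR S) {n : ℕ} (τ : Fin n → O × A) (x : O × A) :
    θ.ψ (n + 1) (Fin.snoc (α := fun _ => O × A) τ x) = (θ.M n x.1 x.2).mulVec (θ.ψ n τ) := by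
  simp [PSR.ψ]

namespace PSR.IsPSR

variable {θ : PSR S}

lemma prob_nonneg (hθ : θ.IsPSR) {n : ℕ} (hn : n ≤ H) (τ : Fin n → O × A) : 0 ≤ θ.prob τ := by
  obtain ⟨P, hP⟩ := hθ.represents
  rw [hP n hn]
  exact P.prob_nonneg τ

lemma prob_zero (hθ : θ.IsPSR) (τ : Fin 0 → O × A) : θ.prob τ = 1 := by
  obtain ⟨P, hP⟩ := hθ.represents
  rw [hP 0 H.zero_le]
  simp [Dynamics.prob]

lemma prob_snoc_congr (hθ : θ.IsPSR) {n : ℕ} (hn : n < H) (τ : Fin n → O × A) (o : O) (a a' : A) :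
    θ.prob (Fin.snoc (α := fun _ => O × A) τ (o, a)) =
      θ.prob (Fin.snoc (α := fun _ => O × A) τ (o, a')) := by
  obtain ⟨P, hP⟩ := hθ.represents
  rw [hP _ hn, hP _ hn, P.prob_snoc, P.prob_snoc]

lemma sum_prob_snoc (hθ : θ.IsPSR) {n : ℕ} (hn : n < H) (τ : Fin n → O × A) (a : A) :
    ∑ o, θ.prob (Fin.snoc (α := fun _ => O × A) τ (o, a)) = θ.prob τ := by
  obtain ⟨P, hP⟩ := hθ.represents
  rw [hP _ hn.le]
  simp_rw [hP _ (show n + 1 ≤ H from hn), P.prob_snoc]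
  rw [← mul_sum, P.sum_one, mul_one]

variable [Fintype A]

lemma law_nonneg (hθ : θ.IsPSR) (π : Policy O A) {n : ℕ} (hn : n ≤ H) (τ : Fin n → O × A) :
    0 ≤ θ.law π τ := mul_nonneg (hθ.prob_nonneg hn τ) (π.weight_nonneg τ)

lemma sum_law_snoc (hθ : θ.IsPSR) (π : Policy O A) {n : ℕ} (hn : n < H) (τ : Fin n → O × A) :
    ∑ x, θ.law π (Fin.snoc (α := fun _ => O × A) τ x) = θ.law π τ := by
  obtain ⟨P, hP⟩ := hθ.represents
  unfold PSR.law
  rw [hP _ hn.le]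
  simp_rw [hP _ (show n + 1 ≤ H from hn), P.prob_snoc, π.weight_snoc]
  rw [Fintype.sum_prod_type]
  have : ∀ o, ∑ a, P.prob τ * P.kernel n τ o * (π.weight τ * π.act n τ o a) =
      P.prob τ * π.weight τ * P.kernel n τ o := fun o => by
    rw [← mul_sum, ← mul_sum, π.sum_one]; ring
  simp_rw [this]
  rw [← mul_sum, P.sum_one, mul_one]

lemma sum_law_pre (hθ : θ.IsPSR) (π : Policy O A) {h n : ℕ} (hhn : h ≤ n) (hn : n ≤ H)
    (G : (Fin h → O × A) → ℝ) :
    ∑ τ : Fin n → O × A, θ.law π τ * G (pre τ h hhn) = ∑ τ, θ.law π τ * G τ := by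
  induction n, hhn using Nat.le_induction with
  | base => rfl
  | succ n hhn ih =>
    rw [sum_snoc, ← ih (by omega)]
    refine sum_congr rfl fun τ _ => ?_
    rw [← hθ.sum_law_snoc π hn τ, sum_mul]
    refine sum_congr rfl fun x _ => ?_
    rw [pre_snoc τ x hhn]

lemma sum_law (hθ : θ.IsPSR) (π : Policy O A) {n : ℕ} (hn : n ≤ H) :
    ∑ τ : Fin n → O × A, θ.law π τ = 1 := by
  have := hθ.sum_law_pre π n.zero_le hn fun _ => 1
  simp only [mul_one] at this
  rw [this]
  simp [PSR.law, hθ.prob_zero, Policy.weight_zero]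

lemma prob_le_pre (hθ : θ.IsPSR) {h n : ℕ} (hhn : h ≤ n) (hn : n ≤ H) (τ : Fin n → O × A) :
    θ.prob τ ≤ θ.prob (pre τ h hhn) := by
  induction n, hhn using Nat.le_induction with
  | base => rfl
  | succ n hhn ih =>
    have hs := hθ.sum_prob_snoc hn (pre τ n n.le_succ) (τ (Fin.last n)).2
    refine le_trans ?_ (ih (by omega) (pre τ n n.le_succ))
    rw [← hs]
    have := single_le_sum (f := fun o => θ.prob (Fin.snoc (α := fun _ => O × A)
      (pre τ n n.le_succ) (o, (τ (Fin.last n)).2))) (s := univ)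
      (fun o _ => hθ.prob_nonneg hn _) (mem_univ (τ (Fin.last n)).1)
    simpa [snoc_pre_last] using this

end PSR.IsPSR

end Laws

/-! ### Executing a fixed action sequence -/

section Switch

variable {O A : Type} [Fintype A] [DecidableEq A] [Nonempty A]

/-- Follow `π` for `h` steps, then execute the actions of the list `l`. -/
def Policy.switch (π : Policy O A) (h : ℕ) (l : List A) : Policy O A where
  act t τ o a := if t < h then π.act t τ o a else
    -- Beyond the end of the list an arbitrary action is played. The lists in use have length H - h,
    -- so this happens only after level H.
    if a = l.getD (t - h) (Classical.arbitrary A) then 1 else 0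
  nonneg t τ o a := by
    split_ifs
    exacts [π.nonneg _ _ _ _, zero_le_one, le_rfl]
  sum_one t τ o := by
    by_cases ht : t < h
    · simp [ht, π.sum_one]
    · simp [ht]

lemma Policy.switch_weight_of_le (π : Policy O A) {h n : ℕ} (hn : n ≤ h) (l : List A)
    (τ : Fin n → O × A) : (π.switch h l).weight τ = π.weight τ := by
  unfold Policy.weight
  refine prod_congr rfl fun t _ => ?_
  have : (t : ℕ) < h := t.2.trans_le hn
  simp [Policy.switch, this]

lemma Policy.switch_weight_aux (π : Policy O A) {h n : ℕ} (hn : h ≤ n) (l : List A)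
    (τ : Fin n → O × A) : (π.switch h l).weight τ = π.weight (pre τ h hn) *
      ind (∀ i : Fin n, h ≤ i → (τ i).2 = l.getD (i - h) (Classical.arbitrary A)) := by
  induction n, hn using Nat.le_induction with
  | base =>
    rw [π.switch_weight_of_le le_rfl, pre_self, ind_true, mul_one]
    intro i hi
    exact absurd i.2 (by omega)
  | succ n hn ih =>
    have key := Policy.weight_snoc (π.switch h l) (pre τ n n.le_succ) (τ (Fin.last n))
    rw [snoc_pre_last] at key
    rw [key, ih, pre_pre, mul_assoc]
    congr 1
    have : (π.switch h l).act n (pre τ n n.le_succ) (τ (Fin.last n)).1 (τ (Fin.last n)).2 =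
        ind ((τ (Fin.last n)).2 = l.getD (n - h) (Classical.arbitrary A)) := by
      simp only [Policy.switch, if_neg (not_lt.mpr hn), ind]
      split_ifs <;> rfl
    rw [this, ← ind_and]
    congr 1
    rw [Fin.forall_fin_succ', eq_iff_iff]
    refine and_congr Iff.rfl ⟨fun h' _ => h', fun h' => h' hn⟩

/-- The list of the actions of a sequence from index `h` on. -/
def actsFrom {n : ℕ} (h : ℕ) (τ : Fin n → O × A) : List A :=
  (List.ofFn fun i => (τ i).2).drop h

lemma Policy.switch_weight (π : Policy O A) {h n : ℕ} (hn : h ≤ n) (l : List A)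
    (hl : l.length = n - h) (τ : Fin n → O × A) :
    (π.switch h l).weight τ = π.weight (pre τ h hn) * ind (actsFrom h τ = l) := by
  rw [π.switch_weight_aux hn]
  congr 2
  rw [eq_iff_iff, actsFrom]
  constructor
  · intro hi
    refine List.ext_getElem (by simp [hl]) fun i h1 h2 => ?_
    have h3 : h + i < n := by omega
    have := hi ⟨h + i, h3⟩ (by simp)
    simp only [add_tsub_cancel_left] at this
    rw [List.getD_eq_getElem _ _ h2] at this
    simpa using this
  · intro hi i hhi
    have h2 : (i : ℕ) - h < l.length := by omega
    rw [List.getD_eq_getElem _ _ h2]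
    subst hi
    simp only [List.getElem_drop, List.getElem_ofFn]
    congr 2
    ext; simp; omega

variable {H : ℕ} (S : CoreTests O A H)

lemma CoreTests.length_of_mem_coreActions {h : ℕ} {l : List A} (hl : l ∈ S.coreActions h) :
    l.length = H - h := by
  simp only [CoreTests.coreActions, mem_image] at hl
  obtain ⟨i, -, rfl⟩ := hl
  simp

lemma CoreTests.length_of_mem_exploration {h : ℕ} (hh : h < H) {l : List A}
    (hl : l ∈ S.exploration h) : l.length = H - h := by
  simp only [CoreTests.exploration, mem_union, mem_image, mem_product] at hl
  rcases hl with ⟨p, ⟨-, hp⟩, rfl⟩ | hl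
  · rw [List.length_cons, S.length_of_mem_coreActions hp]; omega
  · exact S.length_of_mem_coreActions hl

variable [Fintype O] {S}

/-- At most one exploration sequence matches the actions of a given trajectory. The collecting law
is thus a uniform mixture of laws of policies, and statements quantified over policies apply to it.
-/
lemma exploreLaw_eq (θ : PSR S) (π : Policy O A) (h : Fin H) (τ : Fin H → O × A) :
    exploreLaw θ π h τ = ((S.exploration h).card : ℝ)⁻¹ *
      ∑ l ∈ S.exploration h, θ.law (π.switch h l) τ := by
  have : ∀ l ∈ S.exploration h, θ.law (π.switch h l) τ =
      θ.prob τ * π.weight (pre τ h h.2.le) * ind (actsFrom h τ = l) := fun l hl => by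
    rw [PSR.law, π.switch_weight h.2.le l (S.length_of_mem_exploration h.2 hl), mul_assoc]
  rw [sum_congr rfl this, ← mul_sum]
  have h2 : ∑ l ∈ S.exploration h, ind (actsFrom h τ = l) =
      if actsFrom h τ ∈ S.exploration h then 1 else 0 := by
    split_ifs with hm
    · rw [sum_eq_single_of_mem _ hm fun l _ hl => ind_false fun h' => hl h'.symm, ind_true rfl]
    · exact sum_eq_zero fun l hl => ind_false fun h' => hm (h' ▸ hl)
  rw [h2, exploreLaw]
  change _ * (_ * ite (actsFrom h τ ∈ S.exploration h) _ _) = _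
  split_ifs <;> ring

end Switch

end PSRUCB

end

noncomputable section

namespace PSRUCB

open Finset

/-! ### Seminorms on finite-dimensional coordinate spaces -/

/-- Subadditive and absolutely homogeneous functions on a real vector space. -/
structure IsSeminorm {E : Type*} [AddCommGroup E] [Module ℝ E] (p : E → ℝ) : Prop where
  add_le : ∀ x y, p (x + y) ≤ p x + p y
  smul : ∀ (c : ℝ) x, p (c • x) = |c| * p x

namespace IsSeminorm

variable {E F : Type*} [AddCommGroup E] [Module ℝ E] [AddCommGroup F] [Module ℝ F] {p q : E → ℝ}

lemma zero (hp : IsSeminorm p) : p 0 = 0 := by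
  have := hp.smul 0 0
  simpa using this

lemma neg (hp : IsSeminorm p) (x : E) : p (-x) = p x := by
  have := hp.smul (-1) x
  simpa using this

lemma nonneg (hp : IsSeminorm p) (x : E) : 0 ≤ p x := by
  have := hp.add_le x (-x)
  rw [add_neg_cancel, hp.zero, hp.neg] at this
  linarith

lemma sub_le (hp : IsSeminorm p) (x y : E) : p (x - y) ≤ p x + p y := by
  have := hp.add_le x (-y)
  rwa [hp.neg, ← sub_eq_add_neg] at this

lemma sum_le (hp : IsSeminorm p) {ι : Type*} (s : Finset ι) (f : ι → E) :
    p (∑ i ∈ s, f i) ≤ ∑ i ∈ s, p (f i) := by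
  classical
  induction s using Finset.induction_on with
  | empty => simp [hp.zero]
  | insert a s ha ih =>
    rw [sum_insert ha, sum_insert ha]
    exact (hp.add_le _ _).trans (by gcongr)

lemma add (hp : IsSeminorm p) (hq : IsSeminorm q) : IsSeminorm fun x => p x + q x where
  add_le x y := by linarith [hp.add_le x y, hq.add_le x y]
  smul c x := by rw [hp.smul, hq.smul]; ring

lemma const_mul (hp : IsSeminorm p) {c : ℝ} (hc : 0 ≤ c) : IsSeminorm fun x => c * p x where
  add_le x y := by rw [← mul_add]; exact mul_le_mul_of_nonneg_left (hp.add_le x y) hc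
  smul a x := by rw [hp.smul]; ring

lemma sum {ι : Type*} (s : Finset ι) {P : ι → E → ℝ} (hP : ∀ i ∈ s, IsSeminorm (P i)) :
    IsSeminorm fun x => ∑ i ∈ s, P i x where
  add_le x y := by
    rw [← sum_add_distrib]; exact sum_le_sum fun i hi => (hP i hi).add_le x y
  smul a x := by rw [mul_sum]; exact sum_congr rfl fun i hi => (hP i hi).smul a x

lemma sup' {ι : Type*} {s : Finset ι} (hs : s.Nonempty) {P : ι → E → ℝ}
    (hP : ∀ i ∈ s, IsSeminorm (P i)) : IsSeminorm fun x => s.sup' hs fun i => P i x where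
  add_le x y := sup'_le _ _ fun i hi => ((hP i hi).add_le x y).trans
    (add_le_add (le_sup' (fun i => P i x) hi) (le_sup' (fun i => P i y) hi))
  smul a x := by
    apply le_antisymm
    · refine sup'_le _ _ fun i hi => ?_
      rw [(hP i hi).smul]
      exact mul_le_mul_of_nonneg_left (le_sup' (fun i => P i x) hi) (abs_nonneg a)
    · obtain ⟨i, hi, h⟩ := exists_mem_eq_sup' hs fun i => P i x
      rw [h, ← (hP i hi).smul]
      exact le_sup' (fun i => P i (a • x)) hi

lemma comp {p : F → ℝ} (hp : IsSeminorm p) (f : E →ₗ[ℝ] F) : IsSeminorm fun x => p (f x) where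
  add_le x y := by rw [map_add]; exact hp.add_le _ _
  smul a x := by rw [map_smul]; exact hp.smul _ _

lemma abs_apply (f : E →ₗ[ℝ] ℝ) : IsSeminorm fun x => |f x| where
  add_le x y := by rw [map_add]; exact abs_add_le _ _
  smul a x := by rw [map_smul, smul_eq_mul, abs_mul]

lemma le_sum_single {ι : Type*} [Fintype ι] [DecidableEq ι] {p : (ι → ℝ) → ℝ} (hp : IsSeminorm p)
    (x : ι → ℝ) : p x ≤ ∑ i, |x i| * p (Pi.single i 1) := by
  have : x = ∑ i, x i • (Pi.single i 1 : ι → ℝ) := by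
    ext j; simp [Finset.sum_apply, Pi.single_apply]
  conv_lhs => rw [this]
  refine (hp.sum_le _ _).trans (sum_le_sum fun i _ => ?_)
  rw [hp.smul]

end IsSeminorm

/-- Left multiplication by a row vector, as a linear form. -/
def dotForm {ι : Type*} [Fintype ι] (v : ι → ℝ) : (ι → ℝ) →ₗ[ℝ] ℝ where
  toFun x := v ⬝ᵥ x
  map_add' := dotProduct_add v
  map_smul' c x := by simp [dotProduct_smul]

@[simp] lemma dotForm_apply {ι : Type*} [Fintype ι] (v x : ι → ℝ) : dotForm v x = v ⬝ᵥ x := rfl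

/-! ### Policies glued at a level -/

section Glue

variable {O A : Type} [Fintype A]

lemma Policy.act_congr (π : Policy O A) {t t' : ℕ} (e : t = t') (τ : Fin t → O × A)
    (τ' : Fin t' → O × A) (h : ∀ i, τ i = τ' (Fin.cast e i)) : π.act t τ = π.act t' τ' := by
  subst e
  congr 1
  funext i
  exact h i

lemma Policy.condWeight_cons (π : Policy O A) {h n : ℕ} (τ : Fin h → O × A) (x : O × A)
    (ω : Fin n → O × A) : π.condWeight τ (Fin.cons (α := fun _ => O × A) x ω) =
      π.act h τ x.1 x.2 * π.condWeight (Fin.snoc (α := fun _ => O × A) τ x) ω := by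
  unfold Policy.condWeight
  rw [Fin.prod_univ_succ]
  congr 1
  · rw [Fin.cons_zero (α := fun _ => O × A)]
    have := π.act_congr (t := h + ((0 : Fin (n + 1)) : ℕ)) (t' := h) (by simp)
      (pre (Fin.append τ (Fin.cons (α := fun _ => O × A) x ω)) (h + ((0 : Fin (n + 1)) : ℕ))
        (by simp)) τ (fun i => by
        rw [pre_apply]
        have : Fin.castLE (by simp : h + ((0 : Fin (n + 1)) : ℕ) ≤ h + (n + 1)) i =
          Fin.castAdd (n + 1) (Fin.cast (by simp) i : Fin h) := rfl
        rw [this, Fin.append_left])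
    rw [this]
  · refine prod_congr rfl fun j _ => ?_
    rw [Fin.cons_succ (α := fun _ => O × A)]
    have e : h + ((j.succ : Fin (n + 1)) : ℕ) = h + 1 + (j : ℕ) := by simp; omega
    have := π.act_congr e
      (pre (Fin.append τ (Fin.cons (α := fun _ => O × A) x ω)) (h + ((j.succ : Fin (n + 1)) : ℕ))
        (by omega))
      (pre (Fin.append (Fin.snoc (α := fun _ => O × A) τ x) ω) (h + 1 + (j : ℕ)) (by omega))
      (fun i => by
        rw [pre_apply, pre_apply, Fin.append_right_cons]
        rfl)
    rw [this]

variable [DecidableEq A]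

/-- Play `g o` at level `h`, and then follow `π' o`, where `o` is the observation at level `h`. -/
def Policy.branch (h : ℕ) (g : O → A) (π' : O → Policy O A) : Policy O A where
  act t τ o a := if ht : h < t then (π' (τ ⟨h, ht⟩).1).act t τ o a else if a = g o then 1 else 0
  nonneg t τ o a := by
    split_ifs
    exacts [(π' _).nonneg _ _ _ _, zero_le_one, le_rfl]
  sum_one t τ o := by
    by_cases ht : h < t
    · simp [ht, (π' _).sum_one]
    · simp [ht]

lemma Policy.branch_condWeight_of_lt {h k n : ℕ} (g : O → A) (π' : O → Policy O A) (hk : h < k)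
    (τ : Fin k → O × A) (ω : Fin n → O × A) :
    (Policy.branch h g π').condWeight τ ω = (π' (τ ⟨h, hk⟩).1).condWeight τ ω := by
  unfold Policy.condWeight
  refine prod_congr rfl fun j _ => ?_
  have h1 : h < k + (j : ℕ) := by omega
  simp only [Policy.branch, h1, dif_pos]
  have : pre (Fin.append τ ω) (k + (j : ℕ)) (by omega) ⟨h, h1⟩ = τ ⟨h, hk⟩ := by
    rw [pre_apply]
    have : Fin.castLE (by omega : k + (j : ℕ) ≤ k + n) ⟨h, h1⟩ = Fin.castAdd n ⟨h, hk⟩ := by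
      ext; simp
    rw [this, Fin.append_left]
  rw [this]

end Glue

/-! ### The control norm -/

section Control

variable {O A : Type} {H : ℕ} {S : CoreTests O A H} [Fintype O] [Fintype A] [Nonempty A]

/-- The largest value of `∑ π(ω) |m(ω)ᵀ x|` over policies `π`, for futures `ω` of length `n` that
start at level `h`, as a dynamic programme. -/
def PSR.ctrl (θ : PSR S) : (n h : ℕ) → (Fin (S.d h) → ℝ) → ℝ
  | 0, h, x => |θ.φ h ⬝ᵥ x|
  | n + 1, h, x => ∑ o : O, univ.sup' univ_nonempty fun a : A =>
      θ.ctrl n (h + 1) ((θ.M h o a).mulVec x)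

lemma PSR.ctrl_isSeminorm (θ : PSR S) (n h : ℕ) : IsSeminorm (θ.ctrl n h) := by
  induction n generalizing h with
  | zero => exact IsSeminorm.abs_apply (dotForm (θ.φ h))
  | succ n ih =>
    exact IsSeminorm.sum _ fun o _ => IsSeminorm.sup' _ fun a _ =>
      (ih (h + 1)).comp (Matrix.mulVecLin (θ.M h o a))

lemma PSR.ctrl_nonneg (θ : PSR S) (n h : ℕ) (x : Fin (S.d h) → ℝ) : 0 ≤ θ.ctrl n h x :=
  (θ.ctrl_isSeminorm n h).nonneg x

lemma sum_act_mul_le (p : A → ℝ) (hp : ∀ a, 0 ≤ p a) (h1 : ∑ a, p a = 1) (f : A → ℝ) :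
    ∑ a, p a * f a ≤ univ.sup' univ_nonempty f := by
  calc ∑ a, p a * f a ≤ ∑ a, p a * univ.sup' univ_nonempty f := by
        refine sum_le_sum fun a _ => mul_le_mul_of_nonneg_left (le_sup' f (mem_univ a)) (hp a)
    _ = _ := by rw [← sum_mul, h1, one_mul]

lemma sum_policy_mul_le (π : Policy O A) {t : ℕ} (τ : Fin t → O × A) (f : O → A → ℝ) :
    ∑ x : O × A, π.act t τ x.1 x.2 * f x.1 x.2 ≤ ∑ o, univ.sup' univ_nonempty (f o) := by
  rw [Fintype.sum_prod_type]
  exact sum_le_sum fun o _ => sum_act_mul_le _ (π.nonneg t τ o) (π.sum_one t τ o) _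

/-- Play a maximising action of the dynamic programme after each observation. The recursion sees
only the vector x, so one policy attains the norm at every history; this links `PSR.WellConditioned`
to the control norm. -/
lemma PSR.exists_policy_ctrl [DecidableEq A] (θ : PSR S) (n h : ℕ) (x : Fin (S.d h) → ℝ) :
    ∃ π : Policy O A, ∀ τ : Fin h → O × A,
      ∑ ω : Fin n → O × A, π.condWeight τ ω * |θ.m n h ω ⬝ᵥ x| = θ.ctrl n h x := by
  induction n generalizing h with
  | zero =>
    refine ⟨Policy.branch 0 (fun _ => Classical.arbitrary A) fun _ =>
      ⟨fun _ _ _ a => if a = Classical.arbitrary A then 1 else 0, fun _ _ _ _ => by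
        split_ifs <;> norm_num, fun _ _ _ => by simp⟩, fun τ => ?_⟩
    simp [Policy.condWeight, PSR.m, PSR.ctrl]
  | succ n ih =>
    have hg : ∀ o, ∃ a, univ.sup' univ_nonempty (fun a : A =>
        θ.ctrl n (h + 1) ((θ.M h o a).mulVec x)) = θ.ctrl n (h + 1) ((θ.M h o a).mulVec x) :=
      fun o => by
        obtain ⟨a, -, ha⟩ := exists_mem_eq_sup' (univ_nonempty (α := A)) fun a : A =>
          θ.ctrl n (h + 1) ((θ.M h o a).mulVec x)
        exact ⟨a, ha⟩
    choose g hg using hg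
    choose π' hπ' using fun o => ih (h + 1) ((θ.M h o (g o)).mulVec x)
    refine ⟨Policy.branch h g π', fun τ => ?_⟩
    rw [sum_cons, Fintype.sum_prod_type, PSR.ctrl]
    refine sum_congr rfl fun o _ => ?_
    rw [hg o, sum_eq_single (g o)]
    · rw [← hπ' o (Fin.snoc (α := fun _ => O × A) τ (o, g o))]
      refine sum_congr rfl fun ω _ => ?_
      rw [Policy.condWeight_cons, Policy.branch_condWeight_of_lt _ _ h.lt_succ_self]
      have : (Fin.snoc (α := fun _ => O × A) τ (o, g o)) ⟨h, h.lt_succ_self⟩ = (o, g o) :=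
        Fin.snoc_last (α := fun _ => O × A) (o, g o) τ
      rw [this]
      simp [Policy.branch, PSR.m, Matrix.dotProduct_mulVec]
    · intro a _ ha
      refine sum_eq_zero fun ω _ => ?_
      rw [Policy.condWeight_cons]
      simp [Policy.branch, ha]
    · simp

/-- Homogeneity extends the bound from the ℓ¹ unit ball. The history at which the hypothesis is
applied is irrelevant, by `PSR.exists_policy_ctrl`. -/
lemma PSR.WellConditioned.ctrl_le [DecidableEq A] [Nonempty O] {θ : PSR S} {γ : ℝ} (hγ : 0 < γ)
    (hθ : θ.WellConditioned γ) {n h : ℕ} (hn : h + n = H) (hh : h < H) (x : Fin (S.d h) → ℝ) :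
    θ.ctrl n h x ≤ (∑ i, |x i|) / γ := by
  have key : ∀ y : Fin (S.d h) → ℝ, ∑ i, |y i| ≤ 1 → θ.ctrl n h y ≤ 1 / γ := fun y hy => by
    obtain ⟨π, hπ⟩ := θ.exists_policy_ctrl n h y
    rw [← hπ fun _ => Classical.arbitrary _]
    exact hθ h n hn hh y hy π _
  set s := ∑ i, |x i| with hs
  have hs0 : 0 ≤ s := sum_nonneg fun i _ => abs_nonneg _
  rcases hs0.eq_or_lt with h0 | h0
  · have hx : x = 0 := by
      funext i
      have := (sum_eq_zero_iff_of_nonneg fun i _ => abs_nonneg (x i)).mp h0.symm i (mem_univ i)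
      simpa using this
    rw [hx, (θ.ctrl_isSeminorm n h).zero]
    positivity
  · have := key (s⁻¹ • x) (by
      simp only [Pi.smul_apply, smul_eq_mul, abs_mul, ← mul_sum]
      rw [← hs, abs_of_pos (inv_pos.mpr h0), inv_mul_cancel₀ h0.ne'])
    rw [(θ.ctrl_isSeminorm n h).smul, abs_of_pos (inv_pos.mpr h0)] at this
    rw [inv_mul_le_iff₀ h0] at this
    rw [div_eq_mul_one_div]
    exact this

/-- A fixed action sequence is one of the choices over which the dynamic programme maximises. -/
lemma PSR.sum_ind_m_le_ctrl (θ : PSR S) (n h : ℕ) (x : Fin (S.d h) → ℝ) (a : Fin n → A) :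
    ∑ ω : Fin n → O × A, ind (∀ i, (ω i).2 = a i) * |θ.m n h ω ⬝ᵥ x| ≤ θ.ctrl n h x := by
  induction n generalizing h with
  | zero => simp [PSR.ctrl, PSR.m, ind]
  | succ n ih =>
    rw [sum_cons, Fintype.sum_prod_type, PSR.ctrl]
    refine sum_le_sum fun o _ => ?_
    rw [sum_eq_single (a 0)]
    · refine le_trans ?_ (le_sup' (fun a : A => θ.ctrl n (h + 1) ((θ.M h o a).mulVec x))
        (mem_univ (a 0)))
      refine le_trans (le_of_eq ?_) (ih (h + 1) ((θ.M h o (a 0)).mulVec x) (Fin.tail a))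
      refine sum_congr rfl fun ω _ => ?_
      simp [PSR.m, Matrix.dotProduct_mulVec, Fin.forall_fin_succ, Fin.tail]
    · intro b _ hb
      refine sum_eq_zero fun ω _ => ?_
      rw [ind_false, zero_mul]
      intro h'
      exact hb (by simpa using h' 0)
    · simp

variable [DecidableEq A]

/-- The predictions of the core tests from a state vector. -/
def PSR.tests (θ : PSR S) (h : ℕ) : (Fin (S.d h) → ℝ) →ₗ[ℝ] (Fin (S.d h) → ℝ) where
  toFun x l := θ.m (H - h) h (S.test h l) ⬝ᵥ x
  map_add' x y := by ext; simp [dotProduct_add]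
  map_smul' c x := by ext; simp [dotProduct_smul]

lemma PSR.tests_apply (θ : PSR S) (h : ℕ) (x : Fin (S.d h) → ℝ) (l : Fin (S.d h)) :
    θ.tests h x l = θ.m (H - h) h (S.test h l) ⬝ᵥ x := rfl

/-- Group the tests by their actions. Tests in one group are distinct futures compatible with a
single action sequence, so each group costs one control norm. This is why Q_A enters here, and not
d. -/
lemma PSR.sum_abs_tests_le_card (θ : PSR S) (h : ℕ) (x : Fin (S.d h) → ℝ) :
    ∑ l, |θ.tests h x l| ≤ (S.coreActions h).card * θ.ctrl (H - h) h x := by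
  have hmap : ∀ l ∈ (univ : Finset (Fin (S.d h))),
      (List.ofFn fun i => (S.test h l i).2) ∈ S.coreActions h := fun l _ =>
    mem_image_of_mem _ (mem_univ l)
  rw [← sum_fiberwise_of_maps_to hmap, ← nsmul_eq_mul]
  refine sum_le_card_nsmul _ _ _ fun L hL => ?_
  obtain ⟨l₀, -, rfl⟩ := mem_image.mp hL
  refine le_trans ?_ (θ.sum_ind_m_le_ctrl (H - h) h x fun i => (S.test h l₀ i).2)
  calc _ = ∑ l ∈ univ.filter (fun l => (List.ofFn fun i => (S.test h l i).2) =
        List.ofFn fun i => (S.test h l₀ i).2),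
        ind (∀ i, (S.test h l i).2 = (S.test h l₀ i).2) *
          |θ.m (H - h) h (S.test h l) ⬝ᵥ x| := by
        refine sum_congr rfl fun l hl => ?_
        rw [ind_true, one_mul, PSR.tests_apply]
        exact congrFun (List.ofFn_injective (mem_filter.mp hl).2)
    _ ≤ ∑ l, ind (∀ i, (S.test h l i).2 = (S.test h l₀ i).2) *
          |θ.m (H - h) h (S.test h l) ⬝ᵥ x| :=
        sum_le_sum_of_subset_of_nonneg (subset_univ _) fun l _ _ =>
          mul_nonneg (ind_nonneg _) (abs_nonneg _)
    _ ≤ _ := by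
        classical
        rw [← sum_image (s := univ) (g := S.test h) (f := fun ω =>
          ind (∀ i, (ω i).2 = (S.test h l₀ i).2) * |θ.m (H - h) h ω ⬝ᵥ x|)
          (S.test_injective h).injOn]
        exact sum_le_sum_of_subset_of_nonneg (subset_univ _) fun l _ _ =>
          mul_nonneg (ind_nonneg _) (abs_nonneg _)

lemma CoreTests.card_coreActions_le (S : CoreTests O A H) {h : ℕ} (hh : h ≤ H) :
    (S.coreActions h).card ≤ S.QA :=
  le_sup (f := fun h => (S.coreActions h).card) (mem_range.mpr (Nat.lt_succ_of_le hh))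

lemma CoreTests.d_le_dim (S : CoreTests O A H) {h : ℕ} (hh : h ≤ H) : S.d h ≤ S.dim :=
  le_sup (f := S.d) (mem_range.mpr (Nat.lt_succ_of_le hh))

lemma CoreTests.card_coreActions_last (S : CoreTests O A H) : (S.coreActions H).card ≤ 1 := by
  refine card_le_one.mpr fun l hl l' hl' => ?_
  have h1 := S.length_of_mem_coreActions hl
  have h2 := S.length_of_mem_coreActions hl'
  rw [Nat.sub_self, List.length_eq_zero_iff] at h1 h2
  rw [h1, h2]

lemma PSR.sum_abs_tests_le (θ : PSR S) {h : ℕ} (hh : h ≤ H) (x : Fin (S.d h) → ℝ) :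
    ∑ l, |θ.tests h x l| ≤ S.QA * θ.ctrl (H - h) h x := by
  refine (θ.sum_abs_tests_le_card h x).trans ?_
  gcongr
  · exact θ.ctrl_nonneg _ _ _
  · exact S.card_coreActions_le hh

lemma PSR.prob_cast (θ : PSR S) {n n' : ℕ} (e : n = n') (τ : Fin n' → O × A) :
    θ.prob (τ ∘ Fin.cast e) = θ.prob τ := by
  subst e
  rfl

lemma PSR.prob_append (θ : PSR S) {h n : ℕ} (τ : Fin h → O × A) (ω : Fin n → O × A) :
    θ.prob (Fin.append τ ω) = θ.m n h ω ⬝ᵥ θ.ψ h τ := by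
  induction n generalizing h with
  | zero =>
    have : Fin.append τ ω = τ := by
      have := Fin.append_right_nil τ ω rfl
      rw [this]; rfl
    rw [this]; rfl
  | succ n ih =>
    rw [← Fin.cons_self_tail ω, Fin.append_right_cons, θ.prob_cast, ih, θ.ψ_snoc, PSR.m,
      Fin.cons_zero (α := fun _ => O × A), Matrix.dotProduct_mulVec,
      Fin.tail_cons (α := fun _ => O × A)]

namespace PSR.IsPSR

variable {θ : PSR S}

lemma nonempty_obs (hθ : θ.IsPSR) : Nonempty O := by
  obtain ⟨P, -⟩ := hθ.represents
  by_contra h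
  have : IsEmpty O := not_nonempty_iff.mp h
  have := P.sum_one 0 Fin.elim0
  simp at this

/-- Self-consistency: genuine states are fixed points of the test map. General vectors are not, and
that defect appears in `PSR.localErr`. -/
lemma tests_ψ (hθ : θ.IsPSR) {h : ℕ} (hh : h ≤ H) (τ : Fin h → O × A) :
    θ.tests h (θ.ψ h τ) = θ.ψ h τ := by
  ext l
  rw [hθ.core h hh τ l, θ.prob_append, PSR.tests_apply]

/-- The probability of the next observation does not depend on the action taken after it, so every
supremum in the dynamic programme is over a constant. -/
lemma ctrl_ψ (hθ : θ.IsPSR) {n h : ℕ} (hn : h + n = H) (τ : Fin h → O × A) :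
    θ.ctrl n h (θ.ψ h τ) = θ.prob τ := by
  induction n generalizing h with
  | zero => exact abs_of_nonneg (hθ.prob_nonneg (by omega) τ)
  | succ n ih =>
    rw [PSR.ctrl, ← hθ.sum_prob_snoc (by omega) τ (Classical.arbitrary A)]
    refine sum_congr rfl fun o _ => ?_
    have : ∀ a, θ.ctrl n (h + 1) ((θ.M h o a).mulVec (θ.ψ h τ)) =
        θ.prob (Fin.snoc (α := fun _ => O × A) τ (o, Classical.arbitrary A)) := fun a => by
      rw [← hθ.prob_snoc_congr (by omega) τ o a, ← ih (by omega), θ.ψ_snoc]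
    simp_rw [this]
    exact sup'_const _ _

lemma sum_ψ_le (hθ : θ.IsPSR) {h : ℕ} (hh : h ≤ H) (τ : Fin h → O × A) :
    ∑ l, |θ.ψ h τ l| ≤ S.QA * θ.prob τ := by
  have := θ.sum_abs_tests_le hh (θ.ψ h τ)
  rwa [hθ.ctrl_ψ (by omega), hθ.tests_ψ hh] at this

/-- By consistency φ_h is a sum over observations for one fixed action, which the maximum over
actions dominates. -/
lemma abs_φ_le_ctrl (hθ : θ.IsPSR) {n h : ℕ} (hn : h + n = H) (x : Fin (S.d h) → ℝ) :
    |θ.φ h ⬝ᵥ x| ≤ θ.ctrl n h x := by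
  induction n generalizing h with
  | zero => rfl
  | succ n ih =>
    rw [← hθ.consistent h (by omega) (Classical.arbitrary A), sum_dotProduct, PSR.ctrl]
    refine (abs_sum_le_sum_abs _ _).trans (sum_le_sum fun o _ => ?_)
    rw [← Matrix.dotProduct_mulVec]
    exact (ih (by omega) _).trans (le_sup' (fun a => θ.ctrl n (h + 1) ((θ.M h o a).mulVec x))
      (mem_univ _))

lemma exists_prob_pos (hθ : θ.IsPSR) {h : ℕ} (hh : h ≤ H) : ∃ τ : Fin h → O × A, 0 < θ.prob τ := by
  by_contra! hc
  have h0 := hθ.sum_law (Policy.branch 0 (fun _ => Classical.arbitrary A) fun _ =>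
      ⟨fun _ _ _ a => if a = Classical.arbitrary A then 1 else 0, fun _ _ _ _ => by
        split_ifs <;> norm_num, fun _ _ _ => by simp⟩) hh
  rw [sum_eq_zero] at h0
  · exact zero_ne_one h0
  · intro τ _
    rw [PSR.law, le_antisymm (hc τ) (hθ.prob_nonneg hh τ), zero_mul]

lemma d_pos (hθ : θ.IsPSR) {h : ℕ} (hh : h ≤ H) : 0 < S.d h := by
  obtain ⟨τ, hτ⟩ := hθ.exists_prob_pos hh
  by_contra h0
  have : IsEmpty (Fin (S.d h)) := by
    rw [Nat.eq_zero_of_not_pos h0]; infer_instance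
  simp [PSR.prob, dotProduct] at hτ

lemma QA_pos (hθ : θ.IsPSR) : 1 ≤ S.QA := by
  refine le_trans ?_ (S.card_coreActions_le H.zero_le)
  refine card_pos.mpr ⟨_, mem_image_of_mem _ (mem_univ ⟨0, hθ.d_pos H.zero_le⟩)⟩

lemma subsingleton_last (S : CoreTests O A H) : Subsingleton (Fin (S.d H)) := by
  refine ⟨fun l l' => S.test_injective H ?_⟩
  funext i
  exact absurd i.2 (by omega)

/-- At level H the only test is empty, so the single entry of ψ is the probability of the history
itself. Consequently all models share φ_H. -/
lemma φ_last (hθ : θ.IsPSR) (l : Fin (S.d H)) : θ.φ H l = 1 := by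
  obtain ⟨τ, hτ⟩ := hθ.exists_prob_pos le_rfl
  have := subsingleton_last S
  have h1 := hθ.core H le_rfl τ l
  have h2 : ∀ {k : ℕ} (_ : k = 0) (ω : Fin k → O × A), θ.prob (Fin.append τ ω) = θ.prob τ := by
    rintro _ rfl ω
    rw [θ.prob_append]; rfl
  rw [h2 (Nat.sub_self H)] at h1
  have h3 : θ.prob τ = θ.φ H l * θ.ψ H τ l := by
    rw [PSR.prob, dotProduct, Fintype.sum_subsingleton _ l]
  rw [h1] at h3
  exact (mul_right_cancel₀ hτ.ne' (by rw [one_mul]; exact h3)).symm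

lemma ctrl_last_le (hθ : θ.IsPSR) (x : Fin (S.d H) → ℝ) : θ.ctrl 0 H x = |∑ l, x l| := by
  rw [PSR.ctrl, dotProduct]
  simp [hθ.φ_last]

end PSR.IsPSR

/-- Evaluate well-conditioning at ψ₀: its control norm is 1 and its ℓ¹ norm is at most Q_A. The
ratio Q_A/γ ≥ 1 absorbs lower-order terms throughout. -/
lemma PSR.IsPSR.gamma_le {θ : PSR S} {γ : ℝ} (hγ : 0 < γ) (hH : 1 ≤ H) (hθ : θ.IsPSR)
    (hw : θ.WellConditioned γ) : γ ≤ S.QA := by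
  have := hθ.nonempty_obs
  have h1 := hw.ctrl_le hγ (n := H) (h := 0) (by omega) (by omega) (θ.ψ 0 Fin.elim0)
  rw [hθ.ctrl_ψ (by omega), hθ.prob_zero] at h1
  have h2 := hθ.sum_ψ_le H.zero_le Fin.elim0
  rw [hθ.prob_zero, mul_one] at h2
  rw [le_div_iff₀ hγ, one_mul] at h1
  linarith

/-- Reading a state of one model through its tests and feeding the result to another model costs
Q_A/γ. Level H needs its own argument because well-conditioning stops at H - 1: there the norm is
the absolute coordinate sum, and at most one core action sequence exists. -/
lemma PSR.ctrl_tests_le {θ₁ θ₂ : PSR S} {γ : ℝ} (hγ : 0 < γ) (hH : 1 ≤ H) (h₁ : θ₁.IsPSR)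
    (h₂ : θ₂.IsPSR) (hw : θ₂.WellConditioned γ) {n h : ℕ} (hn : h + n = H)
    (x : Fin (S.d h) → ℝ) :
    θ₂.ctrl n h (θ₁.tests h x) ≤ S.QA / γ * θ₁.ctrl n h x := by
  have hO := h₁.nonempty_obs
  obtain rfl : n = H - h := by omega
  rcases (show h ≤ H by omega).lt_or_eq with hh | rfl
  · refine (hw.ctrl_le hγ hn hh _).trans ?_
    rw [div_le_iff₀ hγ]
    refine (θ₁.sum_abs_tests_le hh.le x).trans (le_of_eq ?_)
    field_simp
  · have h0 : ∀ y : Fin (S.d h) → ℝ, θ₂.ctrl (h - h) h y = θ₂.ctrl 0 h y := by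
      rw [Nat.sub_self]; exact fun _ => rfl
    rw [h0, h₂.ctrl_last_le]
    refine (abs_sum_le_sum_abs _ _).trans ((θ₁.sum_abs_tests_le_card h x).trans ?_)
    gcongr
    · exact θ₁.ctrl_nonneg _ _ _
    · refine le_trans (Nat.cast_le.mpr S.card_coreActions_last) ?_
      rw [Nat.cast_one, le_div_iff₀ hγ, one_mul]
      exact h₂.gamma_le hγ hH hw

end Control

end PSRUCB

end

noncomputable section

namespace PSRUCB

open Finset

/-! ### Regularised Gram matrices -/

/-- Cauchy-Schwarz for two blocks, here the regularisation and the data part of a Gram form. -/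
lemma add_sq_le_of_sq_le {u v a b c d : ℝ} (ha : 0 ≤ a) (hb : 0 ≤ b) (hc : 0 ≤ c) (hd : 0 ≤ d)
    (hu : u ^ 2 ≤ a * c) (hv : v ^ 2 ≤ b * d) : (u + v) ^ 2 ≤ (a + b) * (c + d) := by
  have h1 : 2 * (u * v) ≤ a * d + b * c := by
    have h2 : (2 * (u * v)) ^ 2 ≤ (a * d + b * c) ^ 2 := by
      have : (u * v) ^ 2 ≤ (a * d) * (b * c) := by
        rw [mul_pow]
        calc u ^ 2 * v ^ 2 ≤ (a * c) * (b * d) :=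
              mul_le_mul hu hv (sq_nonneg v) (mul_nonneg ha hc)
          _ = _ := by ring
      nlinarith [sq_nonneg (a * d - b * c)]
    exact le_of_abs_le (abs_le_of_sq_le_sq h2 (by positivity))
  nlinarith

section Gram

variable {ι T : Type*} [Fintype ι] [DecidableEq ι] [Fintype T]

/-- The matrix `lam I + ∑ f(t) f(t)ᵀ`. -/
def gramMat (lam : ℝ) (f : T → ι → ℝ) : Matrix ι ι ℝ :=
  lam • (1 : Matrix ι ι ℝ) + ∑ t, Matrix.vecMulVec (f t) (f t)

/-- The squared norm of `x` with respect to the inverse of `gramMat lam f`. -/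
def quadInv (lam : ℝ) (f : T → ι → ℝ) (x : ι → ℝ) : ℝ :=
  x ⬝ᵥ (gramMat lam f)⁻¹.mulVec x

lemma gramMat_mulVec (lam : ℝ) (f : T → ι → ℝ) (y : ι → ℝ) :
    (gramMat lam f).mulVec y = lam • y + ∑ t, (f t ⬝ᵥ y) • f t := by
  rw [gramMat, Matrix.add_mulVec, Matrix.smul_mulVec, Matrix.one_mulVec, Matrix.sum_mulVec]
  congr 1
  refine sum_congr rfl fun t _ => ?_
  rw [Matrix.vecMulVec_mulVec]
  ext i; simp [mul_comm]

lemma dot_gramMat_mulVec (lam : ℝ) (f : T → ι → ℝ) (x y : ι → ℝ) :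
    x ⬝ᵥ (gramMat lam f).mulVec y = lam * (x ⬝ᵥ y) + ∑ t, (f t ⬝ᵥ x) * (f t ⬝ᵥ y) := by
  rw [gramMat_mulVec, dotProduct_add, dotProduct_smul, dotProduct_sum]
  congr 1
  refine sum_congr rfl fun t _ => ?_
  rw [dotProduct_smul, smul_eq_mul, dotProduct_comm x, mul_comm]

lemma sum_vecMulVec_eq (f : T → ι → ℝ) :
    ∑ t, Matrix.vecMulVec (f t) (f t) = (Matrix.of f).transpose * Matrix.of f := by
  ext i j
  simp [Matrix.mul_apply, Matrix.sum_apply, Matrix.vecMulVec_apply]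

/-- These are the eigenvalues of FᵀF, where F has rows f(t): their sum is the trace, the number of
nonzero ones is the rank, and lam shifts them all. -/
lemma exists_det_gramMat_eq (f : T → ι → ℝ) : ∃ e : ι → ℝ, (∀ i, 0 ≤ e i) ∧
    ∑ i, e i = ∑ t, f t ⬝ᵥ f t ∧ (univ.filter fun i => e i ≠ 0).card = (Matrix.of f).rank ∧
    ∀ lam : ℝ, (gramMat lam f).det = ∏ i, (lam + e i) := by
  set G := (Matrix.of f).transpose * Matrix.of f with hG
  have hpsd : G.PosSemidef := by
    have := Matrix.posSemidef_conjTranspose_mul_self (Matrix.of f)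
    rwa [Matrix.conjTranspose_eq_transpose_of_trivial] at this
  refine ⟨hpsd.1.eigenvalues, hpsd.eigenvalues_nonneg, ?_, ?_, fun lam => ?_⟩
  · have := hpsd.1.trace_eq_sum_eigenvalues
    simp only [RCLike.ofReal_real_eq_id, id_eq] at this
    rw [← this, hG, ← sum_vecMulVec_eq, Matrix.trace_sum]
    exact sum_congr rfl fun t _ => Matrix.trace_vecMulVec _ _
  · rw [← Matrix.rank_transpose_mul_self, ← hG, hpsd.1.rank_eq_card_non_zero_eigs,
      Fintype.card_subtype]
  · have h1 := congrArg (Polynomial.eval (-lam)) hpsd.1.charpoly_eq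
    rw [Matrix.eval_charpoly, Polynomial.eval_prod] at h1
    simp only [Polynomial.eval_sub, Polynomial.eval_X, Polynomial.eval_C,
      RCLike.ofReal_real_eq_id, id_eq] at h1
    have h2 : Matrix.scalar ι (-lam) - G = -(gramMat lam f) := by
      rw [gramMat, sum_vecMulVec_eq, ← hG, Matrix.scalar_apply, ← Matrix.smul_one_eq_diagonal,
        neg_smul]
      abel
    have h3 : ∀ i, -lam - hpsd.1.eigenvalues i = -1 * (lam + hpsd.1.eigenvalues i) := fun i => by
      ring
    rw [h2, Matrix.det_neg] at h1
    simp_rw [h3] at h1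
    rw [prod_mul_distrib, prod_const, card_univ] at h1
    exact mul_left_cancel₀ (pow_ne_zero _ (by norm_num)) h1

variable {lam : ℝ} (hlam : 0 < lam)

include hlam

lemma det_gramMat_pos (f : T → ι → ℝ) : 0 < (gramMat lam f).det := by
  obtain ⟨e, he, -, -, h⟩ := exists_det_gramMat_eq f
  rw [h]
  exact prod_pos fun i _ => by linarith [he i]

lemma gramMat_mulVec_inv (f : T → ι → ℝ) (x : ι → ℝ) :
    (gramMat lam f).mulVec ((gramMat lam f)⁻¹.mulVec x) = x := by
  rw [Matrix.mulVec_mulVec, Matrix.mul_nonsing_inv _ (det_gramMat_pos hlam f).ne'.isUnit,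
    Matrix.one_mulVec]

lemma quadInv_eq (f : T → ι → ℝ) (x : ι → ℝ) : quadInv lam f x =
    lam * ((gramMat lam f)⁻¹.mulVec x ⬝ᵥ (gramMat lam f)⁻¹.mulVec x) +
      ∑ t, (f t ⬝ᵥ (gramMat lam f)⁻¹.mulVec x) ^ 2 := by
  have := dot_gramMat_mulVec lam f ((gramMat lam f)⁻¹.mulVec x) ((gramMat lam f)⁻¹.mulVec x)
  rw [gramMat_mulVec_inv hlam, dotProduct_comm] at this
  rw [quadInv, this]
  simp_rw [sq]

lemma quadInv_nonneg (f : T → ι → ℝ) (x : ι → ℝ) : 0 ≤ quadInv lam f x := by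
  rw [quadInv_eq hlam]
  have : 0 ≤ (gramMat lam f)⁻¹.mulVec x ⬝ᵥ (gramMat lam f)⁻¹.mulVec x :=
    sum_nonneg fun i _ => mul_self_nonneg _
  positivity

omit hlam in
lemma dot_sq_le (x y : ι → ℝ) : (x ⬝ᵥ y) ^ 2 ≤ (x ⬝ᵥ x) * (y ⬝ᵥ y) := by
  have := sum_mul_sq_le_sq_mul_sq univ x y
  simpa [dotProduct, sq] using this

/-- Duality of the Gram form and its inverse: write x as the Gram matrix applied to z and use
Cauchy-Schwarz in the Gram inner product. -/
lemma dot_sq_le_quadInv (f : T → ι → ℝ) (x y : ι → ℝ) :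
    (x ⬝ᵥ y) ^ 2 ≤ quadInv lam f x * (lam * (y ⬝ᵥ y) + ∑ t, (f t ⬝ᵥ y) ^ 2) := by
  set z := (gramMat lam f)⁻¹.mulVec x with hz
  have h0 : ∀ w : ι → ℝ, 0 ≤ w ⬝ᵥ w := fun w => sum_nonneg fun i _ => mul_self_nonneg _
  have h1 : x ⬝ᵥ y = lam * (z ⬝ᵥ y) + ∑ t, (f t ⬝ᵥ z) * (f t ⬝ᵥ y) := by
    rw [← gramMat_mulVec_inv hlam f x, ← hz, dotProduct_comm, dot_gramMat_mulVec,
      dotProduct_comm y]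
    congr 1
    exact sum_congr rfl fun t _ => mul_comm _ _
  rw [h1, quadInv_eq hlam, ← hz]
  refine add_sq_le_of_sq_le (mul_nonneg hlam.le (h0 _)) (sum_nonneg fun t _ => sq_nonneg _)
    (mul_nonneg hlam.le (h0 _)) (sum_nonneg fun t _ => sq_nonneg _) ?_
    (sum_mul_sq_le_sq_mul_sq _ _ _)
  have := mul_le_mul_of_nonneg_left (dot_sq_le z y) (sq_nonneg lam)
  calc _ = lam ^ 2 * (z ⬝ᵥ y) ^ 2 := by ring
    _ ≤ _ := this
    _ = _ := by ring

/-- Inversion reverses the order of quadratic forms. Duality for g is tested at the image of x under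
the inverse Gram matrix of f, and one factor `quadInv lam f x` is cancelled. -/
lemma quadInv_le_of_le {T' : Type*} [Fintype T'] {lam' κ : ℝ} (hlam' : 0 < lam')
    (f : T → ι → ℝ) (g : T' → ι → ℝ)
    (h : ∀ y, lam' * (y ⬝ᵥ y) + ∑ t, (g t ⬝ᵥ y) ^ 2 ≤
      κ * (lam * (y ⬝ᵥ y) + ∑ t, (f t ⬝ᵥ y) ^ 2)) (x : ι → ℝ) :
    quadInv lam f x ≤ κ * quadInv lam' g x := by
  have h1 := dot_sq_le_quadInv hlam' g x ((gramMat lam f)⁻¹.mulVec x)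
  have h2 := mul_le_mul_of_nonneg_left (h ((gramMat lam f)⁻¹.mulVec x))
    (quadInv_nonneg hlam' g x)
  rw [← quadInv_eq hlam] at h2
  have h3 : quadInv lam f x ^ 2 ≤ κ * quadInv lam' g x * quadInv lam f x := by
    calc _ ≤ _ := h1
      _ ≤ _ := h2
      _ = _ := by ring
  rcases (quadInv_nonneg hlam f x).eq_or_lt with h0 | h0
  -- When the cancelled factor vanishes only the sign of κ is at stake; a negative κ contradicts `h`
  -- at x itself.
  · have h4 := h2
    rw [← h0]
    rcases (quadInv_nonneg hlam' g x).eq_or_lt with h5 | h5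
    · rw [← h5, mul_zero]
    · by_contra! hc
      have hκ : κ < 0 := by
        by_contra! hκ
        exact absurd (mul_nonneg hκ h5.le) (not_le.mpr hc)
      have h6 := h x
      have h7 : 0 ≤ x ⬝ᵥ x := sum_nonneg fun i _ => mul_self_nonneg _
      have h8 : 0 < x ⬝ᵥ x := by
        rcases h7.eq_or_lt with h9 | h9
        · have : x = 0 := dotProduct_self_eq_zero.mp h9.symm
          rw [this] at h5
          simp [quadInv] at h5
        · exact h9
      have h9 : 0 ≤ ∑ t, (g t ⬝ᵥ x) ^ 2 := sum_nonneg fun t _ => sq_nonneg _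
      have h10 : 0 ≤ ∑ t, (f t ⬝ᵥ x) ^ 2 := sum_nonneg fun t _ => sq_nonneg _
      have h11 : 0 < lam' * (x ⬝ᵥ x) := mul_pos hlam' h8
      have h12 : 0 < lam * (x ⬝ᵥ x) := mul_pos hlam h8
      nlinarith
  · rw [sq] at h3
    exact le_of_mul_le_mul_right h3 h0

lemma quadInv_le_dot (f : T → ι → ℝ) (x : ι → ℝ) : quadInv lam f x ≤ (x ⬝ᵥ x) / lam := by
  have h := dot_sq_le x ((gramMat lam f)⁻¹.mulVec x)
  have h1 := quadInv_eq hlam f x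
  have h2 : 0 ≤ ∑ t, (f t ⬝ᵥ (gramMat lam f)⁻¹.mulVec x) ^ 2 := sum_nonneg fun t _ => sq_nonneg _
  have h3 : 0 ≤ x ⬝ᵥ x := sum_nonneg fun i _ => mul_self_nonneg _
  have h4 : quadInv lam f x ^ 2 ≤ (x ⬝ᵥ x) *
      ((gramMat lam f)⁻¹.mulVec x ⬝ᵥ (gramMat lam f)⁻¹.mulVec x) := h
  rw [le_div_iff₀ hlam]
  rcases (quadInv_nonneg hlam f x).eq_or_lt with h0 | h0
  · rw [← h0]; simpa using h3
  · refine le_of_mul_le_mul_right ?_ h0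
    nlinarith

lemma quadInv_add_le (f : T → ι → ℝ) (x y : ι → ℝ) :
    quadInv lam f (x + y) ≤ 2 * quadInv lam f x + 2 * quadInv lam f y := by
  have h := quadInv_nonneg hlam f (x - y)
  have : quadInv lam f (x + y) + quadInv lam f (x - y) =
      2 * quadInv lam f x + 2 * quadInv lam f y := by
    simp only [quadInv, Matrix.mulVec_add, Matrix.mulVec_sub, dotProduct_add, add_dotProduct,
      dotProduct_sub, sub_dotProduct]
    ring
  linarith

/-- The transfer from data to new vectors. With y the inverse Gram matrix applied to x, x equals lam
y plus a combination of the data vectors with coefficients f(t)·y; apply p to this expansion and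
then Cauchy-Schwarz. The bound b on basis vectors pays for the regularisation part. -/
lemma IsSeminorm.sq_le_quadInv {p : (ι → ℝ) → ℝ} (hp : IsSeminorm p) (f : T → ι → ℝ) {b : ℝ}
    (hb : ∀ i, p (Pi.single i 1) ≤ b) (x : ι → ℝ) :
    p x ^ 2 ≤ (lam * Fintype.card ι * b ^ 2 + ∑ t, p (f t) ^ 2) * quadInv lam f x := by
  rcases isEmpty_or_nonempty ι with hι | ⟨⟨i₀⟩⟩
  · have : x = 0 := Subsingleton.elim _ _
    rw [this, hp.zero]
    simp [quadInv]
  have hb0 : 0 ≤ b := (hp.nonneg _).trans (hb i₀)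
  set y := (gramMat lam f)⁻¹.mulVec x with hy
  have h0 : 0 ≤ y ⬝ᵥ y := sum_nonneg fun i _ => mul_self_nonneg _
  have h1 : x = lam • y + ∑ t, (f t ⬝ᵥ y) • f t := by
    rw [← gramMat_mulVec, hy, gramMat_mulVec_inv hlam]
  have h2 : p x ≤ lam * (∑ i, |y i|) * b + ∑ t, |f t ⬝ᵥ y| * p (f t) := by
    conv_lhs => rw [h1]
    refine (hp.add_le _ _).trans (add_le_add ?_ ?_)
    · rw [hp.smul, abs_of_pos hlam, mul_assoc, sum_mul]
      refine mul_le_mul_of_nonneg_left ((hp.le_sum_single y).trans ?_) hlam.le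
      exact sum_le_sum fun i _ => mul_le_mul_of_nonneg_left (hb i) (abs_nonneg _)
    · refine (hp.sum_le _ _).trans (le_of_eq (sum_congr rfl fun t _ => hp.smul _ _))
  refine (pow_le_pow_left₀ (hp.nonneg x) h2 2).trans ?_
  rw [quadInv_eq hlam, ← hy]
  refine add_sq_le_of_sq_le (by positivity) (sum_nonneg fun t _ => sq_nonneg _)
    (by positivity) (sum_nonneg fun t _ => sq_nonneg _) ?_ ?_
  · have h3 : (∑ i, |y i|) ^ 2 ≤ Fintype.card ι * (y ⬝ᵥ y) := by
      have := sq_sum_le_card_mul_sum_sq (s := univ) (f := fun i => |y i|)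
      simpa [dotProduct, sq] using this
    calc _ = lam ^ 2 * b ^ 2 * (∑ i, |y i|) ^ 2 := by ring
      _ ≤ lam ^ 2 * b ^ 2 * (Fintype.card ι * (y ⬝ᵥ y)) := by gcongr
      _ = _ := by ring
  · have := sum_mul_sq_le_sq_mul_sq univ (fun t => |f t ⬝ᵥ y|) fun t => p (f t)
    simp only [sq_abs] at this
    linarith

lemma det_gramMat_snoc {n : ℕ} (f : Fin (n + 1) → ι → ℝ) :
    (gramMat lam f).det = (gramMat lam (fun t : Fin n => f t.castSucc)).det *
      (1 + quadInv lam (fun t : Fin n => f t.castSucc) (f (Fin.last n))) := by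
  have h1 : gramMat lam f = gramMat lam (fun t : Fin n => f t.castSucc) +
      Matrix.replicateCol Unit (f (Fin.last n)) * Matrix.replicateRow Unit (f (Fin.last n)) := by
    rw [gramMat, gramMat, Fin.sum_univ_castSucc, ← add_assoc, Matrix.vecMulVec_eq Unit]
  rw [h1, Matrix.det_add_replicateCol_mul_replicateRow
    (det_gramMat_pos hlam _).ne'.isUnit]
  congr 1
  rw [Matrix.det_unique, Matrix.add_apply, Matrix.one_apply_eq, quadInv,
    Matrix.dotProduct_mulVec]
  rfl

omit hlam in
lemma min_one_le_two_mul_log {x : ℝ} (hx : 0 ≤ x) : min 1 x ≤ 2 * Real.log (1 + x) := by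
  have h := Real.one_sub_inv_le_log_of_pos (show 0 < 1 + x by linarith)
  have h1 : 1 - (1 + x)⁻¹ = x / (1 + x) := by field_simp; ring
  rw [h1] at h
  refine le_trans ?_ (mul_le_mul_of_nonneg_left h zero_le_two)
  rcases le_total x 1 with h2 | h2
  · rw [min_eq_right h2, ← mul_div_assoc, le_div_iff₀ (by linarith)]
    nlinarith
  · rw [min_eq_left h2, ← mul_div_assoc, le_div_iff₀ (by linarith)]
    linarith

/-- Each new vector multiplies the determinant by one plus its squared elliptical norm, so the
logarithms telescope. -/
lemma sum_min_quadInv_le_log_det {n : ℕ} (f : Fin n → ι → ℝ) :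
    ∑ t : Fin n, min 1 (quadInv lam (fun s : Fin t => f (Fin.castLE t.2.le s)) (f t)) ≤
      2 * (Real.log (gramMat lam f).det - Fintype.card ι * Real.log lam) := by
  induction n with
  | zero =>
    have : (gramMat lam f).det = lam ^ Fintype.card ι := by
      simp [gramMat]
    rw [this, Real.log_pow]
    simp
  | succ n ih =>
    rw [Fin.sum_univ_castSucc, det_gramMat_snoc hlam, Real.log_mul
      (det_gramMat_pos hlam _).ne' (by
        have := quadInv_nonneg hlam (fun t : Fin n => f t.castSucc) (f (Fin.last n))
        positivity)]
    have h1 := ih fun t => f t.castSucc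
    have h2 := min_one_le_two_mul_log
      (quadInv_nonneg hlam (fun t : Fin n => f t.castSucc) (f (Fin.last n)))
    refine (add_le_add h1 h2).trans (le_of_eq ?_)
    ring

/-- The elliptical potential lemma for vectors that span a space of dimension at most `r`. -/
lemma sum_min_quadInv_le {n r : ℕ} (f : Fin n → ι → ℝ) (hr : (Matrix.of f).rank ≤ r) {B : ℝ}
    (hB : ∀ t, f t ⬝ᵥ f t ≤ B) :
    ∑ t : Fin n, min 1 (quadInv lam (fun s : Fin t => f (Fin.castLE t.2.le s)) (f t)) ≤
      2 * (r * Real.log (1 + n * B / lam)) := by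
  refine (sum_min_quadInv_le_log_det hlam f).trans (mul_le_mul_of_nonneg_left ?_ zero_le_two)
  obtain ⟨e, he, hs, hc, hdet⟩ := exists_det_gramMat_eq f
  have hsum : ∑ t, f t ⬝ᵥ f t ≤ n * B := by
    have := sum_le_card_nsmul univ (fun t => f t ⬝ᵥ f t) B fun t _ => hB t
    simpa using this
  have hei : ∀ i, e i ≤ n * B := fun i => by
    refine le_trans ?_ hsum
    rw [← hs]
    exact single_le_sum (fun j _ => he j) (mem_univ i)
  have hnB : 0 ≤ n * B := by
    refine le_trans ?_ hsum
    rw [← hs]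
    exact sum_nonneg fun i _ => he i
  rw [hdet, Real.log_prod fun i _ => by linarith [he i]]
  rw [← card_univ, ← nsmul_eq_mul, ← sum_const, ← sum_sub_distrib]
  have h1 : ∀ i, Real.log (lam + e i) - Real.log lam = Real.log (1 + e i / lam) := fun i => by
    rw [← Real.log_div (by linarith [he i]) hlam.ne']
    congr 1
    field_simp
  simp_rw [h1]
  have hlog : 0 ≤ Real.log (1 + n * B / lam) := Real.log_nonneg (by
    have : 0 ≤ n * B / lam := by positivity
    linarith)
  -- Zero eigenvalues contribute log 1 = 0, so the rank replaces the ambient dimension.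
  calc ∑ i, Real.log (1 + e i / lam)
      = ∑ i ∈ univ.filter (fun i => e i ≠ 0), Real.log (1 + e i / lam) := by
        rw [sum_filter_of_ne]
        intro i _ hi h0
        rw [h0] at hi
        simp at hi
    _ ≤ (univ.filter fun i => e i ≠ 0).card • Real.log (1 + n * B / lam) := by
        refine sum_le_card_nsmul _ _ _ fun i _ => ?_
        refine Real.log_le_log (by have := he i; positivity) ?_
        gcongr
        exact hei i
    _ ≤ r * Real.log (1 + n * B / lam) := by
        rw [nsmul_eq_mul, hc]
        gcongr

end Gram

end PSRUCB

end

noncomputable section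

namespace PSRUCB

open Finset

/-! ### Sums along a path up to a threshold -/

/-- All indices with `P` lie at or below the last such index, and the full partial sum up to that
one is at most c. -/
lemma sum_ind_mul_le {n : ℕ} (b : Fin n → ℝ) (hb : ∀ i, 0 ≤ b i) (P : Fin n → Prop) {c : ℝ}
    (hc : 0 ≤ c) (hP : ∀ j : Fin n, P j → ∑ i : Fin (j + 1), b (Fin.castLE j.2 i) ≤ c) :
    ∑ j, ind (P j) * b j ≤ c := by
  induction n with
  | zero => simpa using hc
  | succ n ih =>
    by_cases h : P (Fin.last n)
    · refine le_trans (sum_le_sum fun j _ => ?_) (hP _ h)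
      exact mul_le_of_le_one_left (hb j) (ind_le_one _)
    · rw [Fin.sum_univ_castSucc, ind_false h, zero_mul, add_zero]
      exact ih (fun j => b j.castSucc) (fun j => hb _) (fun j => P j.castSucc)
        fun j hj => hP j.castSucc hj

/-- Cauchy-Schwarz gives the first bound, and with the stopped sum `sum_ind_mul_le` the second.
Keeping both produces the truncation that the bonus has. -/
lemma sum_ind_mul_le_min {n : ℕ} (b B e : Fin n → ℝ) (hb : ∀ i, 0 ≤ b i) (hB : ∀ i, 0 ≤ B i)
    (he : ∀ i, e i ^ 2 ≤ B i * b i) (P : Fin n → Prop) {c Y : ℝ} (hc : 0 ≤ c) (hY : 0 ≤ Y)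
    (hBY : ∑ i, B i ≤ Y ^ 2)
    (hP : ∀ j : Fin n, P j → Y ^ 2 * ∑ i : Fin (j + 1), b (Fin.castLE j.2 i) ≤ c ^ 2) :
    ∑ j, ind (P j) * e j ≤ min (Y * √(∑ i, b i)) c := by
  have h1 : (∑ j, ind (P j) * e j) ^ 2 ≤ Y ^ 2 * ∑ j, ind (P j) * b j := by
    have h2 : ∑ j, ind (P j) * e j ≤ ∑ j, √(B j) * √(ind (P j) * b j) := by
      refine sum_le_sum fun j _ => ?_
      by_cases h : P j
      · rw [ind_true h, one_mul, one_mul, ← Real.sqrt_mul (hB j)]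
        exact Real.le_sqrt_of_sq_le (he j)
      · simp [ind_false h]
    have h3 : |∑ j, ind (P j) * e j| ≤ ∑ j, √(B j) * √(ind (P j) * b j) := by
      refine (abs_sum_le_sum_abs _ _).trans (sum_le_sum fun j _ => ?_)
      by_cases h : P j
      · rw [ind_true h, one_mul, one_mul, ← Real.sqrt_mul (hB j)]
        exact Real.abs_le_sqrt (he j)
      · simp [ind_false h]
    calc (∑ j, ind (P j) * e j) ^ 2 ≤ (∑ j, √(B j) * √(ind (P j) * b j)) ^ 2 := by
          rw [← sq_abs]; exact pow_le_pow_left₀ (abs_nonneg _) h3 2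
      _ ≤ (∑ j, √(B j) ^ 2) * ∑ j, √(ind (P j) * b j) ^ 2 := sum_mul_sq_le_sq_mul_sq _ _ _
      _ = (∑ j, B j) * ∑ j, ind (P j) * b j := by
          congr 1
          · exact sum_congr rfl fun j _ => Real.sq_sqrt (hB j)
          · exact sum_congr rfl fun j _ => Real.sq_sqrt (mul_nonneg (ind_nonneg _) (hb j))
      _ ≤ _ := mul_le_mul_of_nonneg_right hBY
          (sum_nonneg fun j _ => mul_nonneg (ind_nonneg _) (hb j))
  have h4 : Y ^ 2 * ∑ j, ind (P j) * b j ≤ c ^ 2 := by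
    have := sum_ind_mul_le (fun i => Y ^ 2 * b i) (fun i => mul_nonneg (sq_nonneg _) (hb i)) P
      (sq_nonneg c) fun j hj => by rw [← mul_sum]; exact hP j hj
    rw [mul_sum]
    refine le_trans (le_of_eq (sum_congr rfl fun j _ => by ring)) this
  refine le_min ?_ (le_of_abs_le (abs_le_of_sq_le_sq (h1.trans h4) hc))
  refine le_of_abs_le (abs_le_of_sq_le_sq ?_ (by positivity))
  rw [mul_pow, Real.sq_sqrt (sum_nonneg fun j _ => hb j)]
  refine h1.trans (mul_le_mul_of_nonneg_left (sum_le_sum fun j _ => ?_) (sq_nonneg _))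
  exact mul_le_of_le_one_left (hb j) (ind_le_one _)

section Compare

variable {O A : Type} {H : ℕ} {S : CoreTests O A H} [Fintype O] [Fintype A]

/-! ### Expectations over trajectories -/

lemma PSR.value_mono {θ : PSR S} (hθ : θ.IsPSR) (π : Policy O A) {f g : (Fin H → O × A) → ℝ}
    (h : ∀ τ, f τ ≤ g τ) : θ.value f π ≤ θ.value g π :=
  sum_le_sum fun τ _ => mul_le_mul_of_nonneg_left (h τ) (hθ.law_nonneg π le_rfl τ)

lemma PSR.value_add (θ : PSR S) (π : Policy O A) (f g : (Fin H → O × A) → ℝ) :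
    θ.value (fun τ => f τ + g τ) π = θ.value f π + θ.value g π := by
  simp [PSR.value, mul_add, sum_add_distrib]

lemma PSR.value_const_mul (θ : PSR S) (π : Policy O A) (c : ℝ) (f : (Fin H → O × A) → ℝ) :
    θ.value (fun τ => c * f τ) π = c * θ.value f π := by
  rw [PSR.value, PSR.value, mul_sum]
  exact sum_congr rfl fun τ _ => by ring

lemma PSR.value_sum (θ : PSR S) (π : Policy O A) {ι : Type*} (s : Finset ι)
    (f : ι → (Fin H → O × A) → ℝ) :
    θ.value (fun τ => ∑ i ∈ s, f i τ) π = ∑ i ∈ s, θ.value (f i) π := by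
  simp only [PSR.value, mul_sum]
  rw [sum_comm]

lemma PSR.value_const {θ : PSR S} (hθ : θ.IsPSR) (π : Policy O A) (c : ℝ) :
    θ.value (fun _ => c) π = c := by
  rw [PSR.value, ← sum_mul, hθ.sum_law π le_rfl, one_mul]

lemma PSR.value_nonneg {θ : PSR S} (hθ : θ.IsPSR) (π : Policy O A) {f : (Fin H → O × A) → ℝ}
    (h : ∀ τ, 0 ≤ f τ) : 0 ≤ θ.value f π :=
  sum_nonneg fun τ _ => mul_nonneg (hθ.law_nonneg π le_rfl τ) (h τ)

lemma PSR.value_pre {θ : PSR S} (hθ : θ.IsPSR) (π : Policy O A) {h : ℕ} (hh : h ≤ H)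
    (G : (Fin h → O × A) → ℝ) :
    θ.value (fun τ => G (pre τ h hh)) π = ∑ τ, θ.law π τ * G τ :=
  hθ.sum_law_pre π hh le_rfl G

/-- The total masses agree, so f may be replaced by f - 1/2, which is at most 1/2 in absolute value.
This halves the unnormalised distance. -/
lemma PSR.value_sub_le {θ₁ θ₂ : PSR S} (h₁ : θ₁.IsPSR) (h₂ : θ₂.IsPSR) (π : Policy O A)
    {f : (Fin H → O × A) → ℝ} (hf : ∀ τ, f τ ∈ Set.Icc (0 : ℝ) 1) :
    θ₁.value f π - θ₂.value f π ≤
      tv (fun τ : Fin H → O × A => θ₁.law π τ) (fun τ => θ₂.law π τ) / 2 := by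
  have h0 : ∑ τ : Fin H → O × A, (θ₁.law π τ - θ₂.law π τ) = 0 := by
    rw [sum_sub_distrib, h₁.sum_law π le_rfl, h₂.sum_law π le_rfl, sub_self]
  have h1 : θ₁.value f π - θ₂.value f π =
      ∑ τ : Fin H → O × A, (θ₁.law π τ - θ₂.law π τ) * (f τ - 1 / 2) := by
    simp only [mul_sub, sum_sub_distrib, sub_mul, PSR.value]
    rw [← sum_mul, ← sum_mul, h₁.sum_law π le_rfl, h₂.sum_law π le_rfl]
    ring
  rw [h1, tv, sum_div]
  refine sum_le_sum fun τ _ => (le_abs_self _).trans ?_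
  rw [abs_mul, div_eq_mul_one_div]
  refine mul_le_mul_of_nonneg_left ?_ (abs_nonneg _)
  rw [abs_le]
  obtain ⟨ha, hb⟩ := hf τ
  constructor <;> linarith

lemma tv_comm {X : Type} [Fintype X] (P Q : X → ℝ) : tv P Q = tv Q P :=
  sum_congr rfl fun _ _ => abs_sub_comm _ _

variable [Nonempty A] [DecidableEq A]

/-- A history of probability zero has `ψbar` equal to 0 by the convention for inverses; there ψ
vanishes as well, by `sum_ψ_le`. -/
lemma PSR.IsPSR.ψ_eq {θ : PSR S} (hθ : θ.IsPSR) {h : ℕ} (hh : h ≤ H) (τ : Fin h → O × A) :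
    θ.ψ h τ = θ.prob τ • θ.ψbar τ := by
  rw [PSR.ψbar, smul_smul]
  by_cases h0 : θ.prob τ = 0
  · have h1 := hθ.sum_ψ_le hh τ
    rw [h0, mul_zero] at h1
    rw [h0, zero_mul, zero_smul]
    funext l
    have h2 := (sum_eq_zero_iff_of_nonneg fun i _ => abs_nonneg (θ.ψ h τ i)).mp
      (le_antisymm h1 (sum_nonneg fun i _ => abs_nonneg _)) l (mem_univ l)
    simpa using h2
  · rw [mul_inv_cancel₀ h0, one_smul]

lemma PSR.IsPSR.sum_abs_ψbar_le {θ : PSR S} (hθ : θ.IsPSR) {h : ℕ} (hh : h ≤ H)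
    (τ : Fin h → O × A) : ∑ l, |θ.ψbar τ l| ≤ S.QA := by
  have h1 := hθ.sum_ψ_le hh τ
  have h2 := hθ.prob_nonneg hh τ
  simp only [PSR.ψbar, Pi.smul_apply, smul_eq_mul, abs_mul, ← mul_sum]
  rw [abs_of_nonneg (inv_nonneg.mpr h2)]
  rcases h2.eq_or_lt with h0 | h0
  · rw [← h0, inv_zero, zero_mul]; positivity
  · rw [inv_mul_le_iff₀ h0, mul_comm]; exact h1

/-! ### The one-step error -/

/-- The one-step discrepancy of `θ₁` and `θ₂`, measured in the control norm of `θ₂`. -/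
def PSR.err (θ₁ θ₂ : PSR S) (n h : ℕ) (x : Fin (S.d h) → ℝ) : ℝ :=
  ∑ o : O, univ.sup' univ_nonempty fun a : A =>
    θ₂.ctrl n (h + 1) (θ₁.tests (h + 1) ((θ₁.M h o a).mulVec x) - (θ₂.M h o a).mulVec x)

lemma PSR.err_isSeminorm (θ₁ θ₂ : PSR S) (n h : ℕ) : IsSeminorm (θ₁.err θ₂ n h) :=
  IsSeminorm.sum _ fun o _ => IsSeminorm.sup' _ fun a _ =>
    (θ₂.ctrl_isSeminorm n (h + 1)).comp
      ((θ₁.tests (h + 1)).comp (Matrix.mulVecLin (θ₁.M h o a)) - Matrix.mulVecLin (θ₂.M h o a))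

/-- All proper prefixes of `τ` satisfy `χ`. -/
def alive (χ : (h : ℕ) → (Fin h → O × A) → Prop) {h : ℕ} (τ : Fin h → O × A) : Prop :=
  ∀ j (hj : j < h), χ j (pre τ j hj.le)

lemma alive_snoc (χ : (h : ℕ) → (Fin h → O × A) → Prop) {h : ℕ} (τ : Fin h → O × A)
    (x : O × A) : alive χ (Fin.snoc (α := fun _ => O × A) τ x) ↔ alive χ τ ∧ χ h τ := by
  constructor
  · intro hx
    refine ⟨fun j hj => ?_, ?_⟩
    · have := hx j (hj.trans h.lt_succ_self)
      rwa [pre_snoc τ x hj.le] at this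
    · have := hx h h.lt_succ_self
      rwa [pre_snoc_self] at this
  · rintro ⟨h1, h2⟩ j hj
    rcases Nat.lt_succ_iff_lt_or_eq.mp hj with h3 | rfl
    · rw [pre_snoc τ x h3.le]; exact h1 j h3
    · rw [pre_snoc_self]; exact h2

/-- Split M₁ψ₁ - M₂ψ₂ as (M₁ - M₂)ψ₁ + M₂(ψ₁ - ψ₂). The first part is the one-step error, and the
second is absorbed by one step of the dynamic programme of θ₂. Since ψ₁ at the next level is a fixed
point of the tests of θ₁, inserting them costs nothing. -/
lemma PSR.sum_alive_step {θ₁ : PSR S} (h₁ : θ₁.IsPSR) (θ₂ : PSR S) (π : Policy O A)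
    (χ : (h : ℕ) → (Fin h → O × A) → Prop) {h n : ℕ} (hn : h + (n + 1) = H) :
    ∑ τ : Fin (h + 1) → O × A, ind (alive χ τ) *
        (π.weight τ * θ₂.ctrl n (h + 1) (θ₁.ψ (h + 1) τ - θ₂.ψ (h + 1) τ)) ≤
      ∑ τ : Fin h → O × A, ind (alive χ τ ∧ χ h τ) *
        (π.weight τ * (θ₂.ctrl (n + 1) h (θ₁.ψ h τ - θ₂.ψ h τ) + θ₁.err θ₂ n h (θ₁.ψ h τ))) := by
  rw [sum_snoc]
  refine sum_le_sum fun τ _ => ?_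
  simp_rw [alive_snoc, π.weight_snoc]
  rw [← mul_sum]
  refine mul_le_mul_of_nonneg_left ?_ (ind_nonneg _)
  simp_rw [mul_assoc]
  rw [← mul_sum]
  refine mul_le_mul_of_nonneg_left ?_ (π.weight_nonneg τ)
  set F : O → A → ℝ := fun o a => θ₂.ctrl n (h + 1) ((θ₂.M h o a).mulVec (θ₁.ψ h τ - θ₂.ψ h τ))
  set G : O → A → ℝ := fun o a => θ₂.ctrl n (h + 1)
    (θ₁.tests (h + 1) ((θ₁.M h o a).mulVec (θ₁.ψ h τ)) - (θ₂.M h o a).mulVec (θ₁.ψ h τ))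
  have hstep : ∀ x : O × A, θ₂.ctrl n (h + 1)
      (θ₁.ψ (h + 1) (Fin.snoc (α := fun _ => O × A) τ x) -
        θ₂.ψ (h + 1) (Fin.snoc (α := fun _ => O × A) τ x)) ≤ F x.1 x.2 + G x.1 x.2 := fun x => by
    refine le_trans (le_of_eq ?_) ((θ₂.ctrl_isSeminorm n (h + 1)).add_le _ _)
    congr 1
    rw [← θ₁.ψ_snoc, h₁.tests_ψ (by omega), θ₂.ψ_snoc, Matrix.mulVec_sub]
    abel
  calc ∑ x : O × A, π.act h τ x.1 x.2 * θ₂.ctrl n (h + 1)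
        (θ₁.ψ (h + 1) (Fin.snoc (α := fun _ => O × A) τ x) -
          θ₂.ψ (h + 1) (Fin.snoc (α := fun _ => O × A) τ x))
      ≤ ∑ x : O × A, (π.act h τ x.1 x.2 * F x.1 x.2 + π.act h τ x.1 x.2 * G x.1 x.2) := by
        refine sum_le_sum fun x _ => ?_
        rw [← mul_add]
        exact mul_le_mul_of_nonneg_left (hstep x) (π.nonneg _ _ _ _)
    _ ≤ _ := by
        rw [sum_add_distrib]
        exact add_le_add (sum_policy_mul_le π τ F) (sum_policy_mul_le π τ G)

/-- The error decomposition along alive histories, including the histories where `χ` fails first. -/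
lemma PSR.sum_alive_le {θ₁ : PSR S} (h₁ : θ₁.IsPSR) (θ₂ : PSR S) (π : Policy O A)
    (χ : (h : ℕ) → (Fin h → O × A) → Prop) {t : ℕ} (ht : t ≤ H) :
    ∑ τ : Fin t → O × A, ind (alive χ τ) *
        (π.weight τ * θ₂.ctrl (H - t) t (θ₁.ψ t τ - θ₂.ψ t τ)) +
      ∑ h : Fin t, ∑ τ : Fin h → O × A, ind (alive χ τ ∧ ¬ χ h τ) *
        (π.weight τ * θ₂.ctrl (H - h) h (θ₁.ψ h τ - θ₂.ψ h τ)) ≤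
      ∑ h : Fin t, ∑ τ : Fin h → O × A, ind (alive χ τ ∧ χ h τ) *
        (π.weight τ * θ₁.err θ₂ (H - (h + 1)) h (θ₁.ψ h τ)) := by
  induction t with
  | zero =>
    have : ∀ τ : Fin 0 → O × A, θ₁.ψ 0 τ - θ₂.ψ 0 τ = 0 := fun τ => sub_self _
    simp only [this, (θ₂.ctrl_isSeminorm _ _).zero]
    simp
  | succ t ih =>
    rw [Fin.sum_univ_castSucc, Fin.sum_univ_castSucc]
    have h1 := ih (by omega)
    obtain ⟨n, hn⟩ : ∃ n, H - t = n + 1 := ⟨H - t - 1, by omega⟩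
    have hn' : H - (t + 1) = n := by omega
    have h2 := PSR.sum_alive_step h₁ θ₂ π χ (h := t) (n := n) (by omega)
    -- Histories satisfying χ pass to the next level; those where χ fails for the first time stay as
    -- a nonnegative term on the left.
    have h3 : ∑ τ : Fin t → O × A, ind (alive χ τ) *
        (π.weight τ * θ₂.ctrl (n + 1) t (θ₁.ψ t τ - θ₂.ψ t τ)) =
        ∑ τ : Fin t → O × A, ind (alive χ τ ∧ χ t τ) *
          (π.weight τ * θ₂.ctrl (n + 1) t (θ₁.ψ t τ - θ₂.ψ t τ)) +
        ∑ τ : Fin t → O × A, ind (alive χ τ ∧ ¬ χ t τ) *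
          (π.weight τ * θ₂.ctrl (n + 1) t (θ₁.ψ t τ - θ₂.ψ t τ)) := by
      rw [← sum_add_distrib]
      refine sum_congr rfl fun τ _ => ?_
      rw [← add_mul, ind_and, ind_and, ← mul_add, ind_add_not, mul_one]
    simp only [mul_add, sum_add_distrib] at h2
    simp only [Fin.val_castSucc, Fin.val_last, hn, hn'] at *
    linarith

variable {θ₁ θ₂ : PSR S}

lemma PSR.sum_weight_mul_eq_value (h₁ : θ₁.IsPSR) (π : Policy O A) {h : ℕ} (hh : h ≤ H)
    {p : (Fin (S.d h) → ℝ) → ℝ} (hp : IsSeminorm p) (P : (Fin h → O × A) → Prop) :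
    ∑ τ : Fin h → O × A, ind (P τ) * (π.weight τ * p (θ₁.ψ h τ)) =
      θ₁.value (fun τ => ind (P (pre τ h hh)) * p (θ₁.ψbar (pre τ h hh))) π := by
  rw [PSR.value_pre h₁ π hh fun τ => ind (P τ) * p (θ₁.ψbar τ)]
  refine sum_congr rfl fun τ _ => ?_
  rw [h₁.ψ_eq hh, hp.smul, abs_of_nonneg (h₁.prob_nonneg hh τ), PSR.law]
  ring

/-- Comparison of the two laws by the truncated elliptical bonus. -/
theorem PSR.tv_le_value_min (h₁ : θ₁.IsPSR) (h₂ : θ₂.IsPSR) (π : Policy O A)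
    (g : (h : ℕ) → (Fin h → O × A) → ℝ) (hg : ∀ h τ, 0 ≤ g h τ) (B : Fin H → ℝ)
    (hB : ∀ h, 0 ≤ B h)
    (herr : ∀ (h : Fin H) (τ : Fin h → O × A),
      θ₁.err θ₂ (H - (h + 1)) h (θ₁.ψbar τ) ^ 2 ≤ B h * g h τ)
    {a Y : ℝ} (ha : 0 < a) (hY : 0 ≤ Y) (hBY : ∑ h, B h ≤ Y ^ 2) :
    tv (fun τ : Fin H → O × A => θ₁.law π τ) (fun τ => θ₂.law π τ) ≤
      2 * (1 + Y / a) * θ₁.value (fun τ => min (a * √(∑ h : Fin H, g h (pre τ h h.2.le))) 1) π := by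
  -- The budget includes the current level, so on histories still satisfying χ the next one-step
  -- error is already paid for.
  set χ : (h : ℕ) → (Fin h → O × A) → Prop := fun h τ =>
    a ^ 2 * (∑ j : Fin h, g j (pre τ j j.2.le) + g h τ) ≤ 1 with hχ
  set b : (Fin H → O × A) → ℝ := fun τ => min (a * √(∑ h : Fin H, g h (pre τ h h.2.le))) 1
    with hb
  have hb0 : ∀ τ, 0 ≤ b τ := fun τ => le_min (by positivity) zero_le_one
  have hcum : ∀ (τ : Fin H → O × A) (h : Fin H), χ h (pre τ h h.2.le) →
      a ^ 2 * ∑ i : Fin (h + 1), g i (pre τ i (i.2.le.trans h.2)) ≤ 1 := fun τ h hh => by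
    rw [Fin.sum_univ_castSucc]; exact hh
  -- the contribution of trajectories that stay alive
  have halive : ∑ τ : Fin H → O × A, ind (alive χ τ) * |θ₁.law π τ - θ₂.law π τ| ≤
      Y / a * θ₁.value b π := by
    have h3 := PSR.sum_alive_le h₁ θ₂ π χ le_rfl
    have h4 : 0 ≤ ∑ h : Fin H, ∑ τ : Fin h → O × A, ind (alive χ τ ∧ ¬ χ h τ) *
        (π.weight τ * θ₂.ctrl (H - h) h (θ₁.ψ h τ - θ₂.ψ h τ)) :=
      sum_nonneg fun h _ => sum_nonneg fun τ _ => mul_nonneg (ind_nonneg _)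
        (mul_nonneg (π.weight_nonneg τ) (θ₂.ctrl_nonneg _ _ _))
    have h5 : ∑ τ : Fin H → O × A, ind (alive χ τ) * |θ₁.law π τ - θ₂.law π τ| ≤
        ∑ τ : Fin H → O × A, ind (alive χ τ) *
        (π.weight τ * θ₂.ctrl (H - H) H (θ₁.ψ H τ - θ₂.ψ H τ)) := by
      refine sum_le_sum fun τ _ => mul_le_mul_of_nonneg_left ?_ (ind_nonneg _)
      rw [PSR.law, PSR.law, ← sub_mul, abs_mul, abs_of_nonneg (π.weight_nonneg τ), mul_comm]
      refine mul_le_mul_of_nonneg_left ?_ (π.weight_nonneg τ)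
      refine le_trans (le_of_eq ?_) (h₂.abs_φ_le_ctrl (by omega) _)
      rw [dotProduct_sub, PSR.prob, PSR.prob]
      have : θ₁.φ H = θ₂.φ H := by
        funext l; rw [h₁.φ_last, h₂.φ_last]
      rw [this]
    have h6 : ∑ h : Fin H, ∑ τ : Fin h → O × A, ind (alive χ τ ∧ χ h τ) *
        (π.weight τ * θ₁.err θ₂ (H - (h + 1)) h (θ₁.ψ h τ)) =
        θ₁.value (fun τ => ∑ h : Fin H, ind (alive χ (pre τ h h.2.le) ∧ χ h (pre τ h h.2.le)) *
          θ₁.err θ₂ (H - (h + 1)) h (θ₁.ψbar (pre τ h h.2.le))) π := by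
      rw [PSR.value_sum]
      exact sum_congr rfl fun h _ =>
        PSR.sum_weight_mul_eq_value h₁ π h.2.le (θ₁.err_isSeminorm θ₂ _ _) _
    have h7 : ∀ τ : Fin H → O × A, ∑ h : Fin H,
        ind (alive χ (pre τ h h.2.le) ∧ χ h (pre τ h h.2.le)) *
          θ₁.err θ₂ (H - (h + 1)) h (θ₁.ψbar (pre τ h h.2.le)) ≤ Y / a * b τ := fun τ => by
      have h8 := sum_ind_mul_le_min (fun h : Fin H => g h (pre τ h h.2.le)) B
        (fun h => θ₁.err θ₂ (H - (h + 1)) h (θ₁.ψbar (pre τ h h.2.le))) (fun h => hg _ _) hB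
        (fun h => herr h _) (fun h => alive χ (pre τ h h.2.le) ∧ χ h (pre τ h h.2.le))
        (c := Y / a) (by positivity) hY hBY (fun j hj => by
          have h9 := hcum τ j hj.2
          rw [div_pow, div_eq_mul_inv]
          refine mul_le_mul_of_nonneg_left ?_ (sq_nonneg _)
          rw [← one_div, le_div_iff₀ (by positivity), mul_comm]
          exact h9)
      refine h8.trans ?_
      rw [hb]
      simp only
      rw [mul_min_of_nonneg _ _ (by positivity : 0 ≤ Y / a), mul_one]
      refine min_le_min (le_of_eq ?_) le_rfl
      field_simp
    have h8 := PSR.value_mono h₁ π h7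
    rw [PSR.value_const_mul, ← h6] at h8
    linarith
  -- the contribution of the others
  have hdead : ∑ τ : Fin H → O × A, ind (¬ alive χ τ) * θ₁.law π τ ≤ θ₁.value b π := by
    refine sum_le_sum fun τ _ => ?_
    rw [mul_comm]
    refine mul_le_mul_of_nonneg_left ?_ (h₁.law_nonneg π le_rfl τ)
    by_cases h : alive χ τ
    · rw [ind_false (not_not.mpr h)]; exact hb0 τ
    · rw [ind_true h]
      refine le_min ?_ le_rfl
      rw [alive] at h
      push Not at h
      obtain ⟨j, hj, h⟩ := h
      rw [hχ] at h
      simp only [not_le] at h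
      have h9 : ∑ i : Fin j, g i (pre (pre τ j hj.le) i i.2.le) + g j (pre τ j hj.le) ≤
          ∑ h : Fin H, g h (pre τ h h.2.le) := by
        have h10 : ∑ i : Fin j, g i (pre (pre τ j hj.le) i i.2.le) + g j (pre τ j hj.le) =
            ∑ i : Fin (j + 1), g i (pre τ i (i.2.le.trans hj)) := by
          rw [Fin.sum_univ_castSucc]; rfl
        rw [h10]
        have h11 := sum_image (s := univ) (g := Fin.castLE (show j + 1 ≤ H from hj))
          (f := fun h : Fin H => g h (pre τ h h.2.le))
          ((Fin.castLE_injective hj).injOn)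
        refine le_trans (le_of_eq h11.symm) ?_
        exact sum_le_sum_of_subset_of_nonneg (subset_univ _) fun h _ _ => hg _ _
      rw [← Real.sqrt_sq ha.le, ← Real.sqrt_mul (sq_nonneg a)]
      refine Real.le_sqrt_of_sq_le ?_
      rw [one_pow]
      exact h.le.trans (mul_le_mul_of_nonneg_left h9 (sq_nonneg a))
  -- The subtracted difference has total mass zero. Including it lets stopped trajectories be
  -- charged to θ₁ alone, since p + q = 2p - (p - q); their mass under θ₂ is not controlled
  -- directly.
  have hsplit : ∀ τ : Fin H → O × A, |θ₁.law π τ - θ₂.law π τ| ≤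
      2 * (ind (alive χ τ) * |θ₁.law π τ - θ₂.law π τ|) +
      2 * (ind (¬ alive χ τ) * θ₁.law π τ) - (θ₁.law π τ - θ₂.law π τ) := fun τ => by
    have h1 := h₁.law_nonneg π le_rfl τ
    have h2 := h₂.law_nonneg π le_rfl τ
    by_cases h : alive χ τ
    · rw [ind_true h, ind_false (not_not.mpr h)]
      have := le_abs_self (θ₁.law π τ - θ₂.law π τ)
      linarith
    · rw [ind_false h, ind_true h]
      rw [abs_le]
      constructor <;> linarith
  calc _ ≤ ∑ τ : Fin H → O × A, (2 * (ind (alive χ τ) * |θ₁.law π τ - θ₂.law π τ|) +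
      2 * (ind (¬ alive χ τ) * θ₁.law π τ) - (θ₁.law π τ - θ₂.law π τ)) :=
        sum_le_sum fun τ _ => hsplit τ
    _ = 2 * (∑ τ : Fin H → O × A, ind (alive χ τ) * |θ₁.law π τ - θ₂.law π τ|) +
      2 * (∑ τ : Fin H → O × A, ind (¬ alive χ τ) * θ₁.law π τ) := by
        rw [sum_sub_distrib, sum_sub_distrib, sum_add_distrib, ← mul_sum, ← mul_sum,
          h₁.sum_law π le_rfl, h₂.sum_law π le_rfl]
        ring
    _ ≤ 2 * (Y / a * θ₁.value b π) + 2 * θ₁.value b π := by linarith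
    _ = _ := by ring

/-! ### A maximal inequality for the distance of the features -/

/-- The `ℓ¹`-distance of the two prediction features. -/
def PSR.featDist (θ₁ θ₂ : PSR S) {h : ℕ} (τ : Fin h → O × A) : ℝ :=
  ∑ l, |θ₁.ψbar τ l - θ₂.ψbar τ l|

lemma PSR.featDist_nonneg (θ₁ θ₂ : PSR S) {h : ℕ} (τ : Fin h → O × A) :
    0 ≤ θ₁.featDist θ₂ τ := sum_nonneg fun _ _ => abs_nonneg _

/-- The part of the discrepancy of the models that concerns level `h` only. -/
def PSR.localErr (θ₁ θ₂ : PSR S) (h : ℕ) (x : Fin (S.d h) → ℝ) : ℝ :=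
  ∑ l, |x l - θ₂.tests h x l| + S.QA * |(θ₁.φ h - θ₂.φ h) ⬝ᵥ x|

lemma PSR.localErr_isSeminorm (θ₁ θ₂ : PSR S) (h : ℕ) : IsSeminorm (θ₁.localErr θ₂ h) :=
  IsSeminorm.add
    (p := fun x : Fin (S.d h) → ℝ => ∑ l, |x l - θ₂.tests h x l|)
    (q := fun x : Fin (S.d h) → ℝ => S.QA * |(θ₁.φ h - θ₂.φ h) ⬝ᵥ x|)
    (IsSeminorm.sum univ fun l _ => IsSeminorm.abs_apply
      ((LinearMap.proj l : (Fin (S.d h) → ℝ) →ₗ[ℝ] ℝ) ∘ₗ (LinearMap.id - θ₂.tests h)))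
    ((IsSeminorm.abs_apply (dotForm (θ₁.φ h - θ₂.φ h))).const_mul (Nat.cast_nonneg S.QA))

/-- The seminorm that controls the distance of the features. -/
def PSR.gap (θ₁ θ₂ : PSR S) (n h : ℕ) (x : Fin (S.d h) → ℝ) : ℝ :=
  2 * S.QA * θ₁.err θ₂ n h x + θ₁.localErr θ₂ h x

lemma PSR.gap_isSeminorm (θ₁ θ₂ : PSR S) (n h : ℕ) : IsSeminorm (θ₁.gap θ₂ n h) :=
  ((θ₁.err_isSeminorm θ₂ n h).const_mul (by positivity)).add (θ₁.localErr_isSeminorm θ₂ h)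

/-- Multiplying by the probability makes the ratio of states linear, up to the difference of the two
probabilities. One factor Q_A times the control norm comes from the states, another from the
probabilities. The local part arises because ψ₁ is no fixed point of the tests of θ₂ and the two φ_h
differ. -/
lemma PSR.prob_mul_featDist_le (h₁ : θ₁.IsPSR) (h₂ : θ₂.IsPSR) {h : ℕ} (hh : h ≤ H)
    (τ : Fin h → O × A) : θ₁.prob τ * θ₁.featDist θ₂ τ ≤
      2 * S.QA * θ₂.ctrl (H - h) h (θ₁.ψ h τ - θ₂.ψ h τ) + θ₁.localErr θ₂ h (θ₁.ψ h τ) := by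
  have hP := h₁.prob_nonneg hh τ
  set c := θ₂.ctrl (H - h) h (θ₁.ψ h τ - θ₂.ψ h τ) with hc
  have h3 : θ₁.prob τ * θ₁.featDist θ₂ τ ≤
      ∑ l, |θ₁.ψ h τ l - θ₂.ψ h τ l| + |θ₁.prob τ - θ₂.prob τ| * ∑ l, |θ₂.ψbar τ l| := by
    rw [PSR.featDist, mul_sum, mul_sum, ← sum_add_distrib]
    refine sum_le_sum fun l _ => ?_
    rw [← abs_mul, ← abs_of_nonneg hP, ← abs_mul, abs_of_nonneg hP]
    refine le_trans (le_of_eq ?_) (abs_sub _ _)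
    have e1 := congrFun (h₁.ψ_eq hh τ) l
    have e2 := congrFun (h₂.ψ_eq hh τ) l
    simp only [Pi.smul_apply, smul_eq_mul] at e1 e2
    rw [e1, e2]
    congr 1
    ring
  have h4 : |θ₁.prob τ - θ₂.prob τ| ≤ |(θ₁.φ h - θ₂.φ h) ⬝ᵥ θ₁.ψ h τ| + c := by
    have : θ₁.prob τ - θ₂.prob τ =
        (θ₁.φ h - θ₂.φ h) ⬝ᵥ θ₁.ψ h τ + θ₂.φ h ⬝ᵥ (θ₁.ψ h τ - θ₂.ψ h τ) := by
      rw [sub_dotProduct, dotProduct_sub, PSR.prob, PSR.prob]; ring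
    rw [this]
    exact (abs_add_le _ _).trans (add_le_add le_rfl (h₂.abs_φ_le_ctrl (by omega) _))
  have h5 : ∑ l, |θ₁.ψ h τ l - θ₂.ψ h τ l| ≤
      ∑ l, |θ₁.ψ h τ l - θ₂.tests h (θ₁.ψ h τ) l| + S.QA * c := by
    refine le_trans ?_ (add_le_add le_rfl (θ₂.sum_abs_tests_le hh _))
    rw [← sum_add_distrib]
    refine sum_le_sum fun l _ => le_trans (le_of_eq ?_) (abs_add_le _ _)
    congr 1
    rw [map_sub, h₂.tests_ψ hh, Pi.sub_apply]
    ring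
  have h6 := h₂.sum_abs_ψbar_le hh τ
  have h7 : |θ₁.prob τ - θ₂.prob τ| * ∑ l, |θ₂.ψbar τ l| ≤
      (|(θ₁.φ h - θ₂.φ h) ⬝ᵥ θ₁.ψ h τ| + c) * S.QA :=
    mul_le_mul h4 h6 (sum_nonneg fun _ _ => abs_nonneg _)
      (add_nonneg (abs_nonneg _) (θ₂.ctrl_nonneg _ _ _))
  rw [PSR.localErr]
  linarith

/-- A weak-type maximal inequality for the distance of the features along a trajectory. -/
theorem PSR.value_exists_featDist_le (h₁ : θ₁.IsPSR) (h₂ : θ₂.IsPSR) (π : Policy O A)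
    (g : (h : ℕ) → (Fin h → O × A) → ℝ) (hg : ∀ h τ, 0 ≤ g h τ) (B : Fin H → ℝ)
    (hB : ∀ h, 0 ≤ B h)
    (hgap : ∀ (h : Fin H) (τ : Fin h → O × A),
      θ₁.gap θ₂ (H - (h + 1)) h (θ₁.ψbar τ) ^ 2 ≤ B h * g h τ)
    {s Y : ℝ} (hs : 0 < s) (hY : 0 ≤ Y) (hBY : ∑ h, B h ≤ Y ^ 2) :
    θ₁.value (fun τ => ind (∃ h : Fin H, s < θ₁.featDist θ₂ (pre τ h h.2.le))) π ≤
      2 * θ₁.value (fun τ => min (Y / s * √(∑ h : Fin H, g h (pre τ h h.2.le))) 1) π := by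
  -- Stopping occurs at the first level where the budget is exhausted or the features are further
  -- apart than s. `PSR.sum_alive_le` then controls the states exactly at the stopping level.
  set cum : (h : ℕ) → (Fin h → O × A) → Prop := fun h τ =>
    Y ^ 2 * (∑ j : Fin h, g j (pre τ j j.2.le) + g h τ) ≤ s ^ 2 with hcum
  set χ : (h : ℕ) → (Fin h → O × A) → Prop := fun h τ => θ₁.featDist θ₂ τ ≤ s ∧ cum h τ with hχ
  set b : (Fin H → O × A) → ℝ := fun τ => min (Y / s * √(∑ h : Fin H, g h (pre τ h h.2.le))) 1
    with hb
  have hb0 : ∀ τ, 0 ≤ b τ := fun τ => le_min (by positivity) zero_le_one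
  -- If the budget runs out somewhere the truncated norm is already 1. Otherwise the first level
  -- with distance above s is a stopping level, and its term divided by s exceeds 1.
  have hfirst : ∀ τ : Fin H → O × A,
      ind (∃ h : Fin H, s < θ₁.featDist θ₂ (pre τ h h.2.le)) ≤ b τ + s⁻¹ * ∑ h : Fin H,
        ind ((alive χ (pre τ h h.2.le) ∧ ¬ χ h (pre τ h h.2.le)) ∧ cum h (pre τ h h.2.le)) *
          θ₁.featDist θ₂ (pre τ h h.2.le) := fun τ => by
    have hsum0 : ∀ h : Fin H, 0 ≤
        ind ((alive χ (pre τ h h.2.le) ∧ ¬ χ h (pre τ h h.2.le)) ∧ cum h (pre τ h h.2.le)) *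
          θ₁.featDist θ₂ (pre τ h h.2.le) := fun h =>
      mul_nonneg (ind_nonneg _) (θ₁.featDist_nonneg θ₂ _)
    have hs0 := sum_nonneg (s := univ) fun h _ => hsum0 h
    by_cases hex : ∃ h : Fin H, s < θ₁.featDist θ₂ (pre τ h h.2.le)
    · rw [ind_true hex]
      by_cases hall : ∀ h : Fin H, cum h (pre τ h h.2.le)
      · classical
        obtain ⟨h, hh, hmin⟩ : ∃ h : Fin H, s < θ₁.featDist θ₂ (pre τ h h.2.le) ∧
            ∀ j : Fin H, j < h → ¬ s < θ₁.featDist θ₂ (pre τ j j.2.le) := by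
          obtain ⟨h, hm⟩ := (univ.filter fun h : Fin H =>
            s < θ₁.featDist θ₂ (pre τ h h.2.le)).exists_minimal (by
              obtain ⟨h, hh⟩ := hex; exact ⟨h, by simpa using hh⟩)
          have h1 := hm.1
          refine ⟨h, by simpa using h1, fun j hj hc => ?_⟩
          exact absurd (hm.2 (by simpa using hc : j ∈ _) hj.le) (not_le.mpr hj)
        have hP : (alive χ (pre τ h h.2.le) ∧ ¬ χ h (pre τ h h.2.le)) ∧
            cum h (pre τ h h.2.le) := by
          refine ⟨⟨fun j hj => ⟨?_, hall ⟨j, hj.trans h.2⟩⟩, fun hc => ?_⟩, hall h⟩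
          · exact not_lt.mp (hmin ⟨j, hj.trans h.2⟩ hj)
          · exact absurd hc.1 (not_le.mpr hh)
        have h1 := single_le_sum (fun j _ => hsum0 j) (mem_univ h)
        rw [ind_true hP, one_mul] at h1
        have h2 : 1 ≤ s⁻¹ * θ₁.featDist θ₂ (pre τ h h.2.le) := by
          rw [le_inv_mul_iff₀ hs, mul_one]; exact hh.le
        have h3 := mul_le_mul_of_nonneg_left h1 (inv_nonneg.mpr hs.le)
        linarith [hb0 τ]
      · push Not at hall
        obtain ⟨j, hj⟩ := hall
        have h1 : 1 ≤ b τ := by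
          refine le_min ?_ le_rfl
          rw [hcum] at hj
          simp only [not_le] at hj
          have h9 : ∑ i : Fin j, g i (pre (pre τ j j.2.le) i i.2.le) + g j (pre τ j j.2.le) ≤
              ∑ h : Fin H, g h (pre τ h h.2.le) := by
            have h10 : ∑ i : Fin j, g i (pre (pre τ j j.2.le) i i.2.le) + g j (pre τ j j.2.le) =
                ∑ i : Fin (j + 1), g i (pre τ i (i.2.le.trans j.2)) := by
              rw [Fin.sum_univ_castSucc]; rfl
            rw [h10]
            have h11 := sum_image (s := univ) (g := Fin.castLE (show (j : ℕ) + 1 ≤ H from j.2))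
              (f := fun h : Fin H => g h (pre τ h h.2.le))
              ((Fin.castLE_injective j.2).injOn)
            refine le_trans (le_of_eq h11.symm) ?_
            exact sum_le_sum_of_subset_of_nonneg (subset_univ _) fun h _ _ => hg _ _
          have h12 := hj.le.trans (mul_le_mul_of_nonneg_left h9 (sq_nonneg Y))
          rw [div_mul_eq_mul_div, le_div_iff₀ hs, one_mul, ← Real.sqrt_sq hY,
            ← Real.sqrt_mul (sq_nonneg Y)]
          exact Real.le_sqrt_of_sq_le h12
        have h2 := mul_nonneg (inv_nonneg.mpr hs.le) hs0
        linarith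
    · rw [ind_false hex]
      have h2 := mul_nonneg (inv_nonneg.mpr hs.le) hs0
      linarith [hb0 τ]
  -- At stopping levels the control norm is traded for one-step errors at earlier levels. All
  -- indicators that remain imply `cum`, so errors and local parts combine into `PSR.gap` under a
  -- single budget.
  have hsecond : θ₁.value (fun τ => ∑ h : Fin H,
        ind ((alive χ (pre τ h h.2.le) ∧ ¬ χ h (pre τ h h.2.le)) ∧ cum h (pre τ h h.2.le)) *
          θ₁.featDist θ₂ (pre τ h h.2.le)) π ≤ s * θ₁.value b π := by
    have h3 := PSR.sum_alive_le h₁ θ₂ π χ le_rfl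
    have h4 : 0 ≤ ∑ τ : Fin H → O × A, ind (alive χ τ) *
        (π.weight τ * θ₂.ctrl (H - H) H (θ₁.ψ H τ - θ₂.ψ H τ)) :=
      sum_nonneg fun τ _ => mul_nonneg (ind_nonneg _)
        (mul_nonneg (π.weight_nonneg τ) (θ₂.ctrl_nonneg _ _ _))
    have h5 : ∀ h : Fin H, ∑ τ : Fin h → O × A, θ₁.law π τ *
        (ind ((alive χ τ ∧ ¬ χ h τ) ∧ cum h τ) * θ₁.featDist θ₂ τ) ≤
        2 * S.QA * (∑ τ : Fin h → O × A, ind (alive χ τ ∧ ¬ χ h τ) *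
          (π.weight τ * θ₂.ctrl (H - h) h (θ₁.ψ h τ - θ₂.ψ h τ))) +
        ∑ τ : Fin h → O × A, ind ((alive χ τ ∧ ¬ χ h τ) ∧ cum h τ) *
          (π.weight τ * θ₁.localErr θ₂ h (θ₁.ψ h τ)) := fun h => by
      rw [mul_sum, ← sum_add_distrib]
      refine sum_le_sum fun τ _ => ?_
      have h6 := PSR.prob_mul_featDist_le h₁ h₂ h.2.le τ
      have h7 := mul_le_mul_of_nonneg_left h6 (π.weight_nonneg τ)
      have h8 := mul_le_mul_of_nonneg_left h7
        (ind_nonneg ((alive χ τ ∧ ¬ χ h τ) ∧ cum h τ))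
      have h9 : ind ((alive χ τ ∧ ¬ χ h τ) ∧ cum h τ) ≤ ind (alive χ τ ∧ ¬ χ h τ) :=
        ind_mono fun h' => h'.1
      have h10 : 0 ≤ 2 * S.QA * (π.weight τ * θ₂.ctrl (H - h) h (θ₁.ψ h τ - θ₂.ψ h τ)) :=
        mul_nonneg (by positivity) (mul_nonneg (π.weight_nonneg τ) (θ₂.ctrl_nonneg _ _ _))
      have h11 := mul_le_mul_of_nonneg_right h9 h10
      rw [PSR.law]
      linarith
    have h6 : θ₁.value (fun τ => ∑ h : Fin H,
        ind ((alive χ (pre τ h h.2.le) ∧ ¬ χ h (pre τ h h.2.le)) ∧ cum h (pre τ h h.2.le)) *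
          θ₁.featDist θ₂ (pre τ h h.2.le)) π = ∑ h : Fin H, ∑ τ : Fin h → O × A, θ₁.law π τ *
        (ind ((alive χ τ ∧ ¬ χ h τ) ∧ cum h τ) * θ₁.featDist θ₂ τ) := by
      rw [PSR.value_sum]
      exact sum_congr rfl fun h _ => PSR.value_pre h₁ π h.2.le fun τ =>
        ind ((alive χ τ ∧ ¬ χ h τ) ∧ cum h τ) * θ₁.featDist θ₂ τ
    have h7 : 2 * S.QA * (∑ h : Fin H, ∑ τ : Fin h → O × A, ind (alive χ τ ∧ χ h τ) *
        (π.weight τ * θ₁.err θ₂ (H - (h + 1)) h (θ₁.ψ h τ))) +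
        ∑ h : Fin H, ∑ τ : Fin h → O × A, ind ((alive χ τ ∧ ¬ χ h τ) ∧ cum h τ) *
          (π.weight τ * θ₁.localErr θ₂ h (θ₁.ψ h τ)) =
        θ₁.value (fun τ => ∑ h : Fin H, (2 * S.QA *
          (ind (alive χ (pre τ h h.2.le) ∧ χ h (pre τ h h.2.le)) *
            θ₁.err θ₂ (H - (h + 1)) h (θ₁.ψbar (pre τ h h.2.le))) +
          ind ((alive χ (pre τ h h.2.le) ∧ ¬ χ h (pre τ h h.2.le)) ∧ cum h (pre τ h h.2.le)) *
            θ₁.localErr θ₂ h (θ₁.ψbar (pre τ h h.2.le)))) π := by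
      rw [PSR.value_sum, mul_sum, ← sum_add_distrib]
      refine sum_congr rfl fun h _ => ?_
      rw [PSR.value_add, PSR.value_const_mul,
        PSR.sum_weight_mul_eq_value h₁ π h.2.le (θ₁.err_isSeminorm θ₂ _ _),
        PSR.sum_weight_mul_eq_value h₁ π h.2.le (θ₁.localErr_isSeminorm θ₂ _)]
    have h8 : ∀ τ : Fin H → O × A, ∑ h : Fin H, (2 * S.QA *
          (ind (alive χ (pre τ h h.2.le) ∧ χ h (pre τ h h.2.le)) *
            θ₁.err θ₂ (H - (h + 1)) h (θ₁.ψbar (pre τ h h.2.le))) +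
          ind ((alive χ (pre τ h h.2.le) ∧ ¬ χ h (pre τ h h.2.le)) ∧ cum h (pre τ h h.2.le)) *
            θ₁.localErr θ₂ h (θ₁.ψbar (pre τ h h.2.le))) ≤ s * b τ := fun τ => by
      have h9 := sum_ind_mul_le_min (fun h : Fin H => g h (pre τ h h.2.le)) B
        (fun h => θ₁.gap θ₂ (H - (h + 1)) h (θ₁.ψbar (pre τ h h.2.le))) (fun h => hg _ _) hB
        (fun h => hgap h _) (fun h => cum h (pre τ h h.2.le))
        (c := s) hs.le hY hBY (fun j hj => by
          rw [Fin.sum_univ_castSucc]; exact hj)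
      have h10 : s * b τ = min (Y * √(∑ h : Fin H, g h (pre τ h h.2.le))) s := by
        rw [hb]
        simp only
        rw [mul_min_of_nonneg _ _ hs.le, mul_one]
        congr 1
        field_simp
      rw [h10]
      refine le_trans (sum_le_sum fun h _ => ?_) h9
      have e1 : 0 ≤ 2 * S.QA * θ₁.err θ₂ (H - (h + 1)) h (θ₁.ψbar (pre τ h h.2.le)) :=
        mul_nonneg (by positivity) ((θ₁.err_isSeminorm θ₂ _ _).nonneg _)
      have e2 := (θ₁.localErr_isSeminorm θ₂ h).nonneg (θ₁.ψbar (pre τ h h.2.le))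
      have e3 := mul_le_mul_of_nonneg_right (ind_mono (p := alive χ (pre τ h h.2.le) ∧
        χ h (pre τ h h.2.le)) (q := cum h (pre τ h h.2.le)) fun h' => h'.2.2) e1
      have e4 := mul_le_mul_of_nonneg_right (ind_mono (p := (alive χ (pre τ h h.2.le) ∧
        ¬ χ h (pre τ h h.2.le)) ∧ cum h (pre τ h h.2.le)) (q := cum h (pre τ h h.2.le))
        fun h' => h'.2) e2
      rw [PSR.gap]
      linarith
    have h9 := PSR.value_mono h₁ π h8
    rw [PSR.value_const_mul, ← h7] at h9
    rw [h6]
    refine (sum_le_sum fun h _ => h5 h).trans ?_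
    rw [sum_add_distrib, ← mul_sum]
    have h10 : ∑ h : Fin H, ∑ τ : Fin h → O × A, ind (alive χ τ ∧ ¬ χ h τ) *
          (π.weight τ * θ₂.ctrl (H - h) h (θ₁.ψ h τ - θ₂.ψ h τ)) ≤
        ∑ h : Fin H, ∑ τ : Fin h → O × A, ind (alive χ τ ∧ χ h τ) *
        (π.weight τ * θ₁.err θ₂ (H - (h + 1)) h (θ₁.ψ h τ)) := by linarith
    have h11 := mul_le_mul_of_nonneg_left h10 (by positivity : (0 : ℝ) ≤ 2 * S.QA)
    linarith
  have h := PSR.value_mono h₁ π hfirst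
  rw [PSR.value_add, PSR.value_const_mul] at h
  have h' := mul_le_mul_of_nonneg_left hsecond (inv_nonneg.mpr hs.le)
  rw [inv_mul_cancel_left₀ hs.ne'] at h'
  linarith

/-- A layer decomposition cut off at 2⁻ᴺ; it turns weak-type bounds into a bound on the mean. -/
lemma min_one_le_dyadic (N : ℕ) (x : ℝ) : min x 1 ≤
    (1 / 2) ^ N + ∑ i ∈ range N, (1 / 2) ^ i * ind ((1 / 2) ^ (i + 1) < x) := by
  induction N with
  | zero => simp
  | succ N ih =>
    rw [sum_range_succ]
    by_cases h : (1 / 2) ^ (N + 1) < x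
    · rw [ind_true h]
      have : (0 : ℝ) < (1 / 2) ^ (N + 1) := by positivity
      linarith
    · have h1 : 0 ≤ ∑ i ∈ range N, (1 / 2 : ℝ) ^ i * ind ((1 / 2) ^ (i + 1) < x) :=
        sum_nonneg fun i _ => mul_nonneg (by positivity) (ind_nonneg _)
      rw [ind_false h]
      have := (min_le_left x 1).trans (not_lt.mp h)
      linarith

/-- The weak-type inequality contributes the same amount 4V on each of the N dyadic layers: the
weight of a layer compensates its threshold. The price of passing from weak to strong type is thus a
factor N, logarithmic in its later choice. -/
theorem PSR.value_min_featDist_le (h₁ : θ₁.IsPSR) (h₂ : θ₂.IsPSR) (π : Policy O A)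
    (hH : 1 ≤ H)
    (g : (h : ℕ) → (Fin h → O × A) → ℝ) (hg : ∀ h τ, 0 ≤ g h τ) (B : Fin H → ℝ)
    (hB : ∀ h, 0 ≤ B h)
    (hgap : ∀ (h : Fin H) (τ : Fin h → O × A),
      θ₁.gap θ₂ (H - (h + 1)) h (θ₁.ψbar τ) ^ 2 ≤ B h * g h τ)
    {a Y : ℝ} (ha : 0 < a) (hY : 0 ≤ Y) (hBY : ∑ h, B h ≤ Y ^ 2) (N : ℕ) :
    θ₁.value (fun τ => min (a * √(∑ h : Fin H, θ₁.featDist θ₂ (pre τ h h.2.le) ^ 2)) 1) π ≤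
      (1 / 2) ^ N + 4 * N * θ₁.value (fun τ =>
        min (a * √H * Y * √(∑ h : Fin H, g h (pre τ h h.2.le))) 1) π := by
  have hH0 : (0 : ℝ) < H := by exact_mod_cast hH
  set V := θ₁.value (fun τ => min (a * √H * Y * √(∑ h : Fin H, g h (pre τ h h.2.le))) 1) π
    with hV
  have h3 : ∀ i : ℕ, (1 / 2) ^ i * θ₁.value (fun τ => ind ((1 / 2) ^ (i + 1) <
      a * √(∑ h : Fin H, θ₁.featDist θ₂ (pre τ h h.2.le) ^ 2))) π ≤ 4 * V := fun i => by
    -- An ℓ² norm over H levels is at most √H times its largest entry, hence the division by √H.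
    set s : ℝ := (1 / 2) ^ (i + 1) / (a * √H) with hs
    have hs0 : 0 < s := by positivity
    have h4 : ∀ τ : Fin H → O × A, ind ((1 / 2) ^ (i + 1) <
        a * √(∑ h : Fin H, θ₁.featDist θ₂ (pre τ h h.2.le) ^ 2)) ≤
        ind (∃ h : Fin H, s < θ₁.featDist θ₂ (pre τ h h.2.le)) := fun τ => by
      refine ind_mono fun hlt => ?_
      by_contra! hc
      refine absurd hlt (not_lt.mpr ?_)
      have h5 : ∑ h : Fin H, θ₁.featDist θ₂ (pre τ h h.2.le) ^ 2 ≤ H * s ^ 2 := by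
        have := sum_le_card_nsmul univ (fun h : Fin H => θ₁.featDist θ₂ (pre τ h h.2.le) ^ 2)
          (s ^ 2) fun h _ => pow_le_pow_left₀ (θ₁.featDist_nonneg θ₂ _) (hc h) 2
        simpa using this
      calc a * √(∑ h : Fin H, θ₁.featDist θ₂ (pre τ h h.2.le) ^ 2)
          ≤ a * √(H * s ^ 2) := by gcongr
        _ = a * √H * s := by rw [Real.sqrt_mul hH0.le, Real.sqrt_sq hs0.le, mul_assoc]
        _ = _ := by rw [hs]; field_simp
    have h5 := (PSR.value_mono h₁ π h4).trans
      (PSR.value_exists_featDist_le h₁ h₂ π g hg B hB hgap hs0 hY hBY)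
    have h6 : ∀ τ : Fin H → O × A,
        (1 / 2) ^ i * min (Y / s * √(∑ h : Fin H, g h (pre τ h h.2.le))) 1 ≤
        2 * min (a * √H * Y * √(∑ h : Fin H, g h (pre τ h h.2.le))) 1 := fun τ => by
      have hp : (0 : ℝ) < (1 / 2) ^ i := by positivity
      have hp1 : (1 / 2 : ℝ) ^ i ≤ 1 := pow_le_one₀ (by norm_num) (by norm_num)
      rw [mul_min_of_nonneg _ _ hp.le, mul_min_of_nonneg _ _ zero_le_two]
      refine min_le_min (le_of_eq ?_) (by linarith)
      rw [hs, pow_succ]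
      field_simp
    have h7 := PSR.value_mono h₁ π h6
    rw [PSR.value_const_mul, PSR.value_const_mul] at h7
    have h8 := mul_le_mul_of_nonneg_left h5 (by positivity : (0 : ℝ) ≤ (1 / 2) ^ i)
    rw [hV]
    linarith
  have h4 := PSR.value_mono h₁ π fun τ => min_one_le_dyadic N
    (a * √(∑ h : Fin H, θ₁.featDist θ₂ (pre τ h h.2.le) ^ 2))
  rw [PSR.value_add, PSR.value_const h₁, PSR.value_sum] at h4
  refine h4.trans (add_le_add le_rfl ?_)
  simp only [PSR.value_const_mul]
  refine (sum_le_card_nsmul _ _ (4 * V) fun i _ => h3 i).trans (le_of_eq ?_)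
  rw [card_range, nsmul_eq_mul]
  ring

end Compare

end PSRUCB

end

noncomputable section

namespace PSRUCB

open Finset

/-! ### Joining a history and a future -/

section Join

variable {α : Type} {H : ℕ}

/-- The full sequence that consists of a history of length `h ≤ H` and a future. -/
def join {h : ℕ} (hh : h ≤ H) (s : Fin h → α) (ω : Fin (H - h) → α) : Fin H → α :=
  Fin.append s ω ∘ Fin.cast (Nat.add_sub_cancel' hh).symm

lemma pre_join {h : ℕ} (hh : h ≤ H) (s : Fin h → α) (ω : Fin (H - h) → α) :
    pre (join hh s ω) h hh = s := by
  funext i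
  exact Fin.append_left s ω i

lemma join_add {h : ℕ} (hh : h ≤ H) (s : Fin h → α) (ω : Fin (H - h) → α) (i : Fin (H - h)) :
    join hh s ω ⟨h + i, by omega⟩ = ω i :=
  Fin.append_right s ω i

lemma join_injective {h : ℕ} (hh : h ≤ H) {s s' : Fin h → α} {ω ω' : Fin (H - h) → α}
    (e : join hh s ω = join hh s' ω') : s = s' ∧ ω = ω' := by
  constructor
  · rw [← pre_join hh s ω, e, pre_join]
  · funext i
    rw [← join_add hh s ω i, e, join_add]

end Join

/-! ### Exploratory futures and the size of the errors on collected histories -/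

section Data

variable {O A : Type} {H : ℕ} {S : CoreTests O A H}

lemma actsFrom_eq_cons {h : ℕ} (hh : h < H) (τ : Fin H → O × A) :
    actsFrom h τ = (τ ⟨h, hh⟩).2 :: actsFrom (h + 1) τ := by
  have := List.drop_eq_getElem_cons (l := List.ofFn fun i => (τ i).2) (i := h) (by simpa using hh)
  rw [actsFrom, this]
  simp [actsFrom]

lemma actsFrom_join {h : ℕ} (hh : h ≤ H) (s : Fin h → O × A) (ω : Fin (H - h) → O × A) :
    actsFrom h (join hh s ω) = List.ofFn fun i => (ω i).2 := by
  refine List.ext_getElem (by simp [actsFrom]) fun i h1 h2 => ?_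
  have h3 : i < H - h := by simpa using h2
  have := join_add hh s ω ⟨i, h3⟩
  simp only [actsFrom, List.getElem_drop, List.getElem_ofFn]
  rw [this]

variable [Fintype O] [Fintype A] [Nonempty A] [DecidableEq A]

lemma PSR.prob_join (θ : PSR S) {h : ℕ} (hh : h ≤ H) (s : Fin h → O × A)
    (ω : Fin (H - h) → O × A) : θ.prob (join hh s ω) = θ.prob (Fin.append s ω) :=
  θ.prob_cast _ _

lemma CoreTests.card_exploration_le (S : CoreTests O A H) {h : ℕ} (hh : h < H) :
    (S.exploration h).card ≤ 2 * Fintype.card A * S.QA := by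
  have h1 : (S.exploration h).card ≤ Fintype.card A * (S.coreActions (h + 1)).card +
      (S.coreActions h).card := by
    refine (card_union_le _ _).trans (Nat.add_le_add_right (card_image_le.trans ?_) _)
    rw [card_product, card_univ]
  have h2 := S.card_coreActions_le (show h + 1 ≤ H from hh)
  have h3 := S.card_coreActions_le hh.le
  have h4 : 1 ≤ Fintype.card A := Fintype.card_pos
  nlinarith

lemma CoreTests.card_exploration_last (S : CoreTests O A H) {h : ℕ} (hh : h + 1 = H) :
    (S.exploration h).card ≤ Fintype.card A := by
  have : S.exploration h ⊆ univ.image fun a : A => [a] := fun l hl => by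
    have h1 := S.length_of_mem_exploration (by omega) hl
    have h2 : l.length = 1 := by omega
    obtain ⟨a, rfl⟩ := List.length_eq_one_iff.mp h2
    exact mem_image_of_mem _ (mem_univ a)
  exact (card_le_card this).trans (card_image_le.trans (by simp))

lemma PSR.IsPSR.exploration_nonempty {θ : PSR S} (hθ : θ.IsPSR) {h : ℕ} (hh : h ≤ H) :
    (S.exploration h).Nonempty := by
  refine ⟨List.ofFn fun i => (S.test h ⟨0, hθ.d_pos hh⟩ i).2, ?_⟩
  exact mem_union_right _ (mem_image_of_mem _ (mem_univ _))

/-- The distance of the conditional laws of the exploratory futures of `s`, summed over all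
exploration sequences. -/
def condDist (θ₁ θ₂ : PSR S) {h : ℕ} (hh : h ≤ H) (s : Fin h → O × A) : ℝ :=
  ∑ τ : Fin H → O × A, ind (pre τ h hh = s ∧ actsFrom h τ ∈ S.exploration h) *
    |θ₁.prob τ / θ₁.prob s - θ₂.prob τ / θ₂.prob s|

lemma condDist_nonneg (θ₁ θ₂ : PSR S) {h : ℕ} (hh : h ≤ H) (s : Fin h → O × A) :
    0 ≤ condDist θ₁ θ₂ hh s :=
  sum_nonneg fun _ _ => mul_nonneg (ind_nonneg _) (abs_nonneg _)

lemma condDist_comm (θ₁ θ₂ : PSR S) {h : ℕ} (hh : h ≤ H) (s : Fin h → O × A) :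
    condDist θ₁ θ₂ hh s = condDist θ₂ θ₁ hh s :=
  sum_congr rfl fun _ _ => by rw [abs_sub_comm]

lemma sum_le_condDist {ι : Type*} [Fintype ι] (θ₁ θ₂ : PSR S) {h : ℕ} (hh : h ≤ H)
    (s : Fin h → O × A) (e : ι → Fin H → O × A) (he : Function.Injective e)
    (hs : ∀ i, pre (e i) h hh = s) (ha : ∀ i, actsFrom h (e i) ∈ S.exploration h) :
    ∑ i, |θ₁.prob (e i) / θ₁.prob s - θ₂.prob (e i) / θ₂.prob s| ≤ condDist θ₁ θ₂ hh s := by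
  classical
  have h1 : ∀ i, |θ₁.prob (e i) / θ₁.prob s - θ₂.prob (e i) / θ₂.prob s| =
      ind (pre (e i) h hh = s ∧ actsFrom h (e i) ∈ S.exploration h) *
        |θ₁.prob (e i) / θ₁.prob s - θ₂.prob (e i) / θ₂.prob s| := fun i => by
    rw [ind_true ⟨hs i, ha i⟩, one_mul]
  rw [sum_congr rfl fun i _ => h1 i, ← sum_image (s := univ) (g := e) (f := fun τ =>
    ind (pre τ h hh = s ∧ actsFrom h τ ∈ S.exploration h) *
        |θ₁.prob τ / θ₁.prob s - θ₂.prob τ / θ₂.prob s|) he.injOn]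
  exact sum_le_sum_of_subset_of_nonneg (subset_univ _) fun _ _ _ =>
    mul_nonneg (ind_nonneg _) (abs_nonneg _)

variable {θ₁ θ₂ : PSR S}

lemma PSR.featDist_le_condDist (h₁ : θ₁.IsPSR) (h₂ : θ₂.IsPSR) {h : ℕ} (hh : h ≤ H)
    (s : Fin h → O × A) : θ₁.featDist θ₂ s ≤ condDist θ₁ θ₂ hh s := by
  refine le_trans (le_of_eq (sum_congr rfl fun l _ => ?_)) (sum_le_condDist θ₁ θ₂ hh s
    (fun l : Fin (S.d h) => join hh s (S.test h l))
    (fun l l' e => S.test_injective h (join_injective hh e).2) (fun l => pre_join hh _ _)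
    fun l => ?_)
  · rw [PSR.prob_join, PSR.prob_join, ← h₁.core h hh s l, ← h₂.core h hh s l]
    simp [PSR.ψbar, div_eq_inv_mul]
  · rw [actsFrom_join]
    exact mem_union_right _ (mem_image_of_mem _ (mem_univ l))

/-- One arbitrary step followed by a core test of the next level is an exploratory future; this is
why the sets of exploration sequences contain the action prefixes. -/
lemma PSR.sum_snoc_le_condDist (h₁ : θ₁.IsPSR) (h₂ : θ₂.IsPSR) {h : ℕ} (hh : h < H)
    (s : Fin h → O × A) : ∑ x : O × A, ∑ l, |((θ₁.M h x.1 x.2).mulVec (θ₁.ψbar s) -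
      (θ₂.M h x.1 x.2).mulVec (θ₂.ψbar s)) l| ≤ condDist θ₁ θ₂ hh.le s := by
  rw [← Fintype.sum_prod_type']
  refine le_trans (le_of_eq (sum_congr rfl fun y _ => ?_)) (sum_le_condDist θ₁ θ₂ hh.le s
    (fun y : (O × A) × Fin (S.d (h + 1)) =>
      join (show h + 1 ≤ H from hh) (Fin.snoc (α := fun _ => O × A) s y.1) (S.test (h + 1) y.2))
    (fun y y' e => ?_) (fun y => ?_) fun y => ?_)
  · rw [PSR.prob_join, PSR.prob_join, ← h₁.core (h + 1) hh _ y.2, ← h₂.core (h + 1) hh _ y.2,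
      θ₁.ψ_snoc, θ₂.ψ_snoc]
    simp [PSR.ψbar, div_eq_inv_mul, Matrix.mulVec_smul]
  · obtain ⟨e1, e2⟩ := join_injective (show h + 1 ≤ H from hh) e
    have e3 := congrFun e1 (Fin.last h)
    simp only [Fin.snoc_last (α := fun _ => O × A)] at e3
    exact Prod.ext e3 (S.test_injective _ e2)
  · rw [← pre_pre _ (show h + 1 ≤ H from hh) h.le_succ, pre_join, pre_snoc_self]
  · rw [actsFrom_eq_cons hh, actsFrom_join]
    have e1 : join (show h + 1 ≤ H from hh) (Fin.snoc (α := fun _ => O × A) s y.1)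
        (S.test (h + 1) y.2) ⟨h, hh⟩ = y.1 := by
      have := congrFun (pre_join (show h + 1 ≤ H from hh)
        (Fin.snoc (α := fun _ => O × A) s y.1) (S.test (h + 1) y.2)) (Fin.last h)
      rw [Fin.snoc_last (α := fun _ => O × A)] at this
      exact this
    rw [e1]
    refine mem_union_left _ (mem_image.mpr ⟨(y.1.2, _), ?_, rfl⟩)
    exact mem_product.mpr ⟨mem_univ _, mem_image_of_mem _ (mem_univ _)⟩

lemma sup'_le_sum {ι : Type*} [Fintype ι] [Nonempty ι] (f : ι → ℝ) (hf : ∀ i, 0 ≤ f i) :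
    univ.sup' univ_nonempty f ≤ ∑ i, f i :=
  sup'_le _ _ fun i _ => single_le_sum (fun j _ => hf j) (mem_univ i)

lemma PSR.IsPSR.tests_ψbar {θ : PSR S} (hθ : θ.IsPSR) {h : ℕ} (hh : h ≤ H) (s : Fin h → O × A) :
    θ.tests h (θ.ψbar s) = θ.ψbar s := by
  rw [PSR.ψbar, map_smul, hθ.tests_ψ hh]

lemma PSR.IsPSR.tests_mulVec_ψbar {θ : PSR S} (hθ : θ.IsPSR) {h : ℕ} (hh : h < H)
    (s : Fin h → O × A) (x : O × A) : θ.tests (h + 1) ((θ.M h x.1 x.2).mulVec (θ.ψbar s)) =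
      (θ.M h x.1 x.2).mulVec (θ.ψbar s) := by
  rw [PSR.ψbar, Matrix.mulVec_smul, map_smul, ← θ.ψ_snoc, hθ.tests_ψ hh]

lemma PSR.ctrl_featDist_le [Nonempty O] {γ : ℝ} (hγ : 0 < γ) (hw : θ₂.WellConditioned γ)
    {h n : ℕ} (hn : h + n = H) (hh : h < H) (s : Fin h → O × A) :
    θ₂.ctrl n h (θ₂.ψbar s - θ₁.ψbar s) ≤ θ₁.featDist θ₂ s / γ := by
  refine (hw.ctrl_le hγ hn hh _).trans (le_of_eq ?_)
  rw [PSR.featDist]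
  congr 1
  exact sum_congr rfl fun l _ => by rw [Pi.sub_apply, abs_sub_comm]

/-- The bound holds on vectors that are not states, and there the test map inside `PSR.err` matters:
`PSR.ctrl_tests_le` bounds the image of an arbitrary vector by the control norm of its own model.
The two terms become equal to Q_A/γ² after using γ ≤ Q_A. -/
lemma PSR.err_single_le {γ : ℝ} (hγ : 0 < γ) (hH : 1 ≤ H) (h₁ : θ₁.IsPSR) (h₂ : θ₂.IsPSR)
    (hw₁ : θ₁.WellConditioned γ) (hw₂ : θ₂.WellConditioned γ) {h : ℕ} (hh : h < H)
    (i : Fin (S.d h)) : θ₁.err θ₂ (H - (h + 1)) h (Pi.single i 1) ≤ 2 * S.QA / γ ^ 2 := by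
  have hO := h₁.nonempty_obs
  obtain ⟨n, hn⟩ : ∃ n, H = h + (n + 1) := ⟨H - h - 1, by omega⟩
  have hn' : H - (h + 1) = n := by omega
  rw [hn']
  set x : Fin (S.d h) → ℝ := Pi.single i 1 with hx
  have hx1 : ∑ j, |x j| = 1 := by
    rw [sum_eq_single i]
    · simp [hx]
    · intro j _ hj; simp [hx, hj]
    · simp
  have h3 : θ₁.err θ₂ n h x ≤ S.QA / γ * θ₁.ctrl (n + 1) h x + θ₂.ctrl (n + 1) h x := by
    rw [PSR.err, PSR.ctrl, PSR.ctrl, mul_sum, ← sum_add_distrib]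
    refine sum_le_sum fun o _ => sup'_le _ _ fun a _ => ?_
    refine ((θ₂.ctrl_isSeminorm n (h + 1)).sub_le _ _).trans (add_le_add ?_ ?_)
    · refine (PSR.ctrl_tests_le hγ hH h₁ h₂ hw₂ (by omega) _).trans ?_
      exact mul_le_mul_of_nonneg_left (le_sup' (fun a => θ₁.ctrl n (h + 1)
        ((θ₁.M h o a).mulVec x)) (mem_univ a)) (by positivity)
    · exact le_sup' (fun a => θ₂.ctrl n (h + 1) ((θ₂.M h o a).mulVec x)) (mem_univ a)
  have h4 := hw₁.ctrl_le hγ (by omega : h + (n + 1) = H) hh x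
  have h5 := hw₂.ctrl_le hγ (by omega : h + (n + 1) = H) hh x
  rw [hx1] at h4 h5
  have h6 := h₁.gamma_le hγ hH hw₁
  have h7 : 1 / γ ≤ S.QA / γ ^ 2 := by
    rw [div_le_div_iff₀ hγ (by positivity)]
    nlinarith
  calc _ ≤ S.QA / γ * (1 / γ) + 1 / γ := h3.trans (by gcongr)
    _ ≤ S.QA / γ ^ 2 + S.QA / γ ^ 2 := add_le_add (le_of_eq (by field_simp)) h7
    _ = _ := by ring

/-- The normalised distance of the conditional laws of the exploratory futures of `s`. -/
def condTV (θ₁ θ₂ : PSR S) {h : ℕ} (hh : h ≤ H) (s : Fin h → O × A) : ℝ :=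
  condDist θ₁ θ₂ hh s / (S.exploration h).card

lemma condTV_nonneg (θ₁ θ₂ : PSR S) {h : ℕ} (hh : h ≤ H) (s : Fin h → O × A) :
    0 ≤ condTV θ₁ θ₂ hh s := div_nonneg (condDist_nonneg _ _ _ _) (Nat.cast_nonneg _)

lemma condTV_comm (θ₁ θ₂ : PSR S) {h : ℕ} (hh : h ≤ H) (s : Fin h → O × A) :
    condTV θ₁ θ₂ hh s = condTV θ₂ θ₁ hh s := by rw [condTV, condDist_comm, condTV]

lemma condDist_le (h₁ : θ₁.IsPSR) {h : ℕ} (hh : h < H) (s : Fin h → O × A) :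
    condDist θ₁ θ₂ hh.le s ≤ 2 * Fintype.card A * S.QA * condTV θ₁ θ₂ hh.le s := by
  have h3 : (0 : ℝ) < (S.exploration h).card := by
    exact_mod_cast card_pos.mpr (h₁.exploration_nonempty hh.le)
  have h4 : ((S.exploration h).card : ℝ) ≤ 2 * Fintype.card A * S.QA := by
    exact_mod_cast S.card_exploration_le hh
  have h5 : condDist θ₁ θ₂ hh.le s = (S.exploration h).card * condTV θ₁ θ₂ hh.le s := by
    rw [condTV]; field_simp
  rw [h5]
  exact mul_le_mul_of_nonneg_right h4 (condTV_nonneg _ _ _ _)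

/-- On features the test map is the identity, so the error splits into the difference of the
one-step-ahead predictions and the propagated difference of the current features. Both are parts of
the conditional distance of exploratory futures. -/
lemma PSR.err_ψbar_le {γ : ℝ} (hγ : 0 < γ) (hH : 1 ≤ H) (h₁ : θ₁.IsPSR) (h₂ : θ₂.IsPSR)
    (hw₂ : θ₂.WellConditioned γ) {h : ℕ} (hh : h < H) (s : Fin h → O × A) :
    θ₁.err θ₂ (H - (h + 1)) h (θ₁.ψbar s) ≤
      4 * Fintype.card A * S.QA / γ * condTV θ₁ θ₂ hh.le s := by
  have hO := h₁.nonempty_obs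
  obtain ⟨n, hn⟩ : ∃ n, H = h + (n + 1) := ⟨H - h - 1, by omega⟩
  have hn' : H - (h + 1) = n := by omega
  rw [hn']
  set c := condDist θ₁ θ₂ hh.le s with hc
  have hc0 : 0 ≤ c := condDist_nonneg _ _ _ _
  have hcT := condDist_le (θ₂ := θ₂) h₁ hh s
  rw [← hc] at hcT
  set T := condTV θ₁ θ₂ hh.le s with hT
  have hT0 : 0 ≤ T := condTV_nonneg _ _ _ _
  set D : O → A → Fin (S.d (h + 1)) → ℝ := fun o a =>
    (θ₁.M h o a).mulVec (θ₁.ψbar s) - (θ₂.M h o a).mulVec (θ₂.ψbar s) with hD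
  have hA : (1 : ℝ) ≤ Fintype.card A := by exact_mod_cast Fintype.card_pos
  have hQγ := h₂.gamma_le hγ hH hw₂
  have hu : 1 ≤ (S.QA : ℝ) / γ := by rw [le_div_iff₀ hγ, one_mul]; exact hQγ
  have h3 : θ₁.err θ₂ n h (θ₁.ψbar s) ≤
      ∑ o, univ.sup' univ_nonempty (fun a => θ₂.ctrl n (h + 1) (D o a)) +
        θ₂.ctrl (n + 1) h (θ₂.ψbar s - θ₁.ψbar s) := by
    rw [PSR.err, PSR.ctrl, ← sum_add_distrib]
    refine sum_le_sum fun o _ => sup'_le _ _ fun a _ => ?_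
    have e : θ₁.tests (h + 1) ((θ₁.M h o a).mulVec (θ₁.ψbar s)) -
        (θ₂.M h o a).mulVec (θ₁.ψbar s) =
        D o a + (θ₂.M h o a).mulVec (θ₂.ψbar s - θ₁.ψbar s) := by
      rw [h₁.tests_mulVec_ψbar hh s (o, a), hD, Matrix.mulVec_sub]
      simp only
      abel
    rw [e]
    refine ((θ₂.ctrl_isSeminorm n (h + 1)).add_le _ _).trans (add_le_add ?_ ?_)
    · exact le_sup' (fun a => θ₂.ctrl n (h + 1) (D o a)) (mem_univ a)
    · exact le_sup' (fun a => θ₂.ctrl n (h + 1) ((θ₂.M h o a).mulVec (θ₂.ψbar s - θ₁.ψbar s)))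
        (mem_univ a)
  have h4 : θ₂.ctrl (n + 1) h (θ₂.ψbar s - θ₁.ψbar s) ≤ c / γ :=
    (PSR.ctrl_featDist_le hγ hw₂ (by omega) hh s).trans
      (div_le_div_of_nonneg_right (PSR.featDist_le_condDist h₁ h₂ hh.le s) hγ.le)
  have h5 : c / γ ≤ 2 * (Fintype.card A * S.QA / γ * T) := by
    rw [div_le_iff₀ hγ]
    calc c ≤ _ := hcT
      _ = _ := by field_simp
  have h6 : ∑ o, univ.sup' univ_nonempty (fun a => θ₂.ctrl n (h + 1) (D o a)) ≤
      2 * (Fintype.card A * S.QA / γ * T) := by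
    have hsum := PSR.sum_snoc_le_condDist h₁ h₂ hh s
    rw [Fintype.sum_prod_type] at hsum
    -- At the last step no well-conditioning is available for the next level, and γ may exceed 1.
    -- There the norm is an absolute coordinate sum that does not depend on the last action, so the
    -- supremum equals the average over actions; this gains the factor |A| carried by the
    -- exploration sequences.
    rcases Nat.eq_zero_or_pos n with rfl | hn0
    · have hlast : ∀ o a, θ₂.ctrl 0 (h + 1) (D o a) = |∑ l, D o a l| := fun o a => by
        rw [PSR.ctrl, dotProduct]
        congr 1
        refine sum_congr rfl fun l _ => ?_
        have e2 : θ₂.φ (h + 1) l = 1 := by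
          have : ∀ {m : ℕ} (_ : m = H) (l : Fin (S.d m)), θ₂.φ m l = 1 := by
            rintro _ rfl l; exact h₂.φ_last l
          exact this (by omega) l
        rw [e2, one_mul]
      have hprob : ∀ (θ : PSR S), θ.IsPSR → ∀ o a, ∑ l, (θ.M h o a).mulVec (θ.ψbar s) l =
          (θ.prob s)⁻¹ * θ.prob (Fin.snoc (α := fun _ => O × A) s (o, a)) := fun θ hθ o a => by
        have e1 : θ.prob (Fin.snoc (α := fun _ => O × A) s (o, a)) =
            ∑ l, θ.ψ (h + 1) (Fin.snoc (α := fun _ => O × A) s (o, a)) l := by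
          rw [PSR.prob, dotProduct]
          refine sum_congr rfl fun l _ => ?_
          have e2 : θ.φ (h + 1) l = 1 := by
            have : ∀ {m : ℕ} (_ : m = H) (l : Fin (S.d m)), θ.φ m l = 1 := by
              rintro _ rfl l; exact hθ.φ_last l
            exact this (by omega) l
          rw [e2, one_mul]
        rw [e1, mul_sum, PSR.ψbar, Matrix.mulVec_smul, ← θ.ψ_snoc s (o, a)]
        rfl
      have hconst : ∀ o a a', |∑ l, D o a l| = |∑ l, D o a' l| := fun o a a' => by
        simp only [hD, Pi.sub_apply, sum_sub_distrib]
        rw [hprob θ₁ h₁, hprob θ₂ h₂, hprob θ₁ h₁, hprob θ₂ h₂,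
          h₁.prob_snoc_congr hh s o a a', h₂.prob_snoc_congr hh s o a a']
      have h7 : Fintype.card A * ∑ o, univ.sup' univ_nonempty
          (fun a => θ₂.ctrl 0 (h + 1) (D o a)) ≤ c := by
        refine le_trans ?_ hsum
        rw [mul_sum]
        refine sum_le_sum fun o _ => ?_
        have e3 : ∀ a, θ₂.ctrl 0 (h + 1) (D o a) = |∑ l, D o (Classical.arbitrary A) l| :=
          fun a => by rw [hlast, hconst o a]
        simp_rw [e3]
        rw [sup'_const, ← card_univ, ← nsmul_eq_mul, ← sum_const]
        refine sum_le_sum fun a _ => ?_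
        rw [hconst o _ a]
        exact abs_sum_le_sum_abs _ _
      have h8 : c ≤ Fintype.card A * T := by
        have e1 : (0 : ℝ) < (S.exploration h).card := by
          exact_mod_cast card_pos.mpr (h₁.exploration_nonempty hh.le)
        have e2 : ((S.exploration h).card : ℝ) ≤ Fintype.card A := by
          exact_mod_cast S.card_exploration_last (by omega)
        have e3 : c = (S.exploration h).card * T := by rw [hT, condTV, hc]; field_simp
        rw [e3]
        exact mul_le_mul_of_nonneg_right e2 hT0
      have h9 : ∑ o, univ.sup' univ_nonempty (fun a => θ₂.ctrl 0 (h + 1) (D o a)) ≤ T :=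
        le_of_mul_le_mul_left (h7.trans h8) (by linarith)
      refine h9.trans ?_
      have : (1 : ℝ) ≤ Fintype.card A * (S.QA / γ) := one_le_mul_of_one_le_of_one_le hA hu
      rw [mul_div_assoc]
      nlinarith
    · have h7 : ∑ o, univ.sup' univ_nonempty (fun a => θ₂.ctrl n (h + 1) (D o a)) ≤ c / γ := by
        rw [le_div_iff₀ hγ, sum_mul]
        refine le_trans (sum_le_sum fun o _ => ?_) hsum
        rw [← le_div_iff₀ hγ, sum_div]
        refine (sup'_le_sum _ fun a => θ₂.ctrl_nonneg _ _ _).trans (sum_le_sum fun a _ => ?_)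
        exact hw₂.ctrl_le hγ (by omega) (by omega) _
      exact h7.trans h5
  calc _ ≤ _ := h3
    _ ≤ 2 * (Fintype.card A * S.QA / γ * T) + 2 * (Fintype.card A * S.QA / γ * T) :=
        add_le_add h6 (h4.trans h5)
    _ = _ := by ring

lemma PSR.gap_single_le {γ : ℝ} (hγ : 0 < γ) (hH : 1 ≤ H) (h₁ : θ₁.IsPSR) (h₂ : θ₂.IsPSR)
    (hw₁ : θ₁.WellConditioned γ) (hw₂ : θ₂.WellConditioned γ) {h : ℕ} (hh : h < H)
    (i : Fin (S.d h)) : θ₁.gap θ₂ (H - (h + 1)) h (Pi.single i 1) ≤ 8 * (S.QA / γ) ^ 2 := by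
  have hO := h₁.nonempty_obs
  have h3 := PSR.err_single_le hγ hH h₁ h₂ hw₁ hw₂ hh i
  set x : Fin (S.d h) → ℝ := Pi.single i 1 with hx
  have hx1 : ∑ j, |x j| = 1 := by
    rw [sum_eq_single i]
    · simp [hx]
    · intro j _ hj; simp [hx, hj]
    · simp
  have h4 := hw₁.ctrl_le hγ (by omega : h + (H - h) = H) hh x
  have h5 := hw₂.ctrl_le hγ (by omega : h + (H - h) = H) hh x
  rw [hx1] at h4 h5
  have hQγ := h₂.gamma_le hγ hH hw₂
  set u := (S.QA : ℝ) / γ with hu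
  have hu1 : 1 ≤ u := by rw [hu, le_div_iff₀ hγ, one_mul]; exact hQγ
  have h6 : ∑ l, |x l - θ₂.tests h x l| ≤ 1 + u := by
    calc _ ≤ ∑ l, (|x l| + |θ₂.tests h x l|) := sum_le_sum fun l _ => abs_sub _ _
      _ ≤ 1 + S.QA * (1 / γ) := by
        rw [sum_add_distrib, hx1]
        refine add_le_add le_rfl ((θ₂.sum_abs_tests_le hh.le x).trans ?_)
        gcongr
      _ = _ := by rw [hu]; ring
  have h7 : S.QA * |(θ₁.φ h - θ₂.φ h) ⬝ᵥ x| ≤ 2 * u := by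
    have e1 := (h₁.abs_φ_le_ctrl (by omega : h + (H - h) = H) x).trans h4
    have e2 := (h₂.abs_φ_le_ctrl (by omega : h + (H - h) = H) x).trans h5
    have e3 : |(θ₁.φ h - θ₂.φ h) ⬝ᵥ x| ≤ 2 * (1 / γ) := by
      rw [sub_dotProduct]
      exact (abs_sub _ _).trans (by linarith)
    calc _ ≤ S.QA * (2 * (1 / γ)) := by gcongr
      _ = _ := by rw [hu]; ring
  have h8 : 2 * S.QA * θ₁.err θ₂ (H - (h + 1)) h x ≤ 4 * u ^ 2 := by
    calc _ ≤ 2 * S.QA * (2 * S.QA / γ ^ 2) := by gcongr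
      _ = _ := by rw [hu]; field_simp; ring
  rw [PSR.gap, PSR.localErr]
  nlinarith

/-- The constant 14 is 8 from the one-step error plus 3 · 2 from the local part. -/
lemma PSR.gap_ψbar_le {γ : ℝ} (hγ : 0 < γ) (hH : 1 ≤ H) (h₁ : θ₁.IsPSR) (h₂ : θ₂.IsPSR)
    (hw₂ : θ₂.WellConditioned γ) {h : ℕ} (hh : h < H) (s : Fin h → O × A)
    (hs₁ : 0 < θ₁.prob s) (hs₂ : 0 < θ₂.prob s) :
    θ₁.gap θ₂ (H - (h + 1)) h (θ₁.ψbar s) ≤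
      14 * (S.QA / γ * (Fintype.card A * S.QA)) * condTV θ₁ θ₂ hh.le s := by
  have hO := h₁.nonempty_obs
  have h3 := PSR.err_ψbar_le hγ hH h₁ h₂ hw₂ hh s
  have hcT := condDist_le (θ₂ := θ₂) h₁ hh s
  have hc0 : 0 ≤ condDist θ₁ θ₂ hh.le s := condDist_nonneg _ _ _ _
  have hfc := PSR.featDist_le_condDist h₁ h₂ hh.le s
  have hf := PSR.ctrl_featDist_le (θ₁ := θ₁) hγ hw₂ (by omega : h + (H - h) = H) hh s
  set c := condDist θ₁ θ₂ hh.le s with hc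
  set T := condTV θ₁ θ₂ hh.le s with hT
  have hT0 : 0 ≤ T := condTV_nonneg _ _ _ _
  have hQγ := h₂.gamma_le hγ hH hw₂
  set u := (S.QA : ℝ) / γ with hu
  have hu1 : 1 ≤ u := by rw [hu, le_div_iff₀ hγ, one_mul]; exact hQγ
  have hct : θ₂.ctrl (H - h) h (θ₂.ψbar s - θ₁.ψbar s) ≤ c / γ :=
    hf.trans (div_le_div_of_nonneg_right hfc hγ.le)
  have hQc : S.QA * (c / γ) = u * c := by rw [hu]; ring
  have h6 : ∑ l, |θ₁.ψbar s l - θ₂.tests h (θ₁.ψbar s) l| ≤ c + u * c := by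
    have e : ∀ l, θ₁.ψbar s l - θ₂.tests h (θ₁.ψbar s) l = (θ₁.ψbar s l - θ₂.ψbar s l) +
        θ₂.tests h (θ₂.ψbar s - θ₁.ψbar s) l := fun l => by
      rw [map_sub, h₂.tests_ψbar hh.le, Pi.sub_apply]; ring
    calc _ ≤ ∑ l, (|θ₁.ψbar s l - θ₂.ψbar s l| +
          |θ₂.tests h (θ₂.ψbar s - θ₁.ψbar s) l|) := sum_le_sum fun l _ => by
            rw [e l]; exact abs_add_le _ _
      _ ≤ c + S.QA * (c / γ) := by
        rw [sum_add_distrib]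
        refine add_le_add hfc ((θ₂.sum_abs_tests_le hh.le _).trans ?_)
        gcongr
      _ = _ := by rw [hQc]
  -- Both features are normalised because the history has positive probability under both models;
  -- the difference of the φ_h thus becomes a functional of the difference of the features.
  have h7 : S.QA * |(θ₁.φ h - θ₂.φ h) ⬝ᵥ θ₁.ψbar s| ≤ u * c := by
    have e1 : ∀ θ : PSR S, 0 < θ.prob s → θ.φ h ⬝ᵥ θ.ψbar s = 1 := fun θ hθ => by
      rw [PSR.ψbar, dotProduct_smul, smul_eq_mul]
      exact inv_mul_cancel₀ hθ.ne'
    have e2 : (θ₁.φ h - θ₂.φ h) ⬝ᵥ θ₁.ψbar s = θ₂.φ h ⬝ᵥ (θ₂.ψbar s - θ₁.ψbar s) := by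
      rw [sub_dotProduct, dotProduct_sub, e1 θ₁ hs₁, e1 θ₂ hs₂]
    rw [e2, ← hQc]
    gcongr
    exact (h₂.abs_φ_le_ctrl (by omega) _).trans hct
  have h8 : θ₁.localErr θ₂ h (θ₁.ψbar s) ≤ 3 * u * c := by
    rw [PSR.localErr]
    have : c ≤ u * c := le_mul_of_one_le_left hc0 hu1
    linarith
  have h9 : 3 * u * c ≤ 3 * u * (2 * Fintype.card A * S.QA * T) := by gcongr
  have h10 : 2 * S.QA * θ₁.err θ₂ (H - (h + 1)) h (θ₁.ψbar s) ≤
      2 * S.QA * (4 * Fintype.card A * S.QA / γ * T) := by gcongr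
  have h11 : 2 * S.QA * (4 * Fintype.card A * S.QA / γ * T) =
      8 * (u * (Fintype.card A * S.QA)) * T := by rw [hu]; ring
  rw [PSR.gap]
  linarith

end Data

end PSRUCB

end

noncomputable section

namespace PSRUCB

open Finset

lemma min_mul_sqrt_add_le {x y a : ℝ} (hx : 0 ≤ x) (hy : 0 ≤ y) (ha : 0 ≤ a) :
    min (a * √(x + y)) 1 ≤ min (a * √x) 1 + min (a * √y) 1 := by
  have h1 : √(x + y) ≤ √x + √y := by
    rw [Real.sqrt_le_left (by positivity)]
    nlinarith [Real.sq_sqrt hx, Real.sq_sqrt hy, Real.sqrt_nonneg x, Real.sqrt_nonneg y]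
  have h2 := mul_le_mul_of_nonneg_left h1 ha
  have h3 : 0 ≤ a * √x := by positivity
  have h4 : 0 ≤ a * √y := by positivity
  rcases le_total (a * √x) 1 with h5 | h5 <;> rcases le_total (a * √y) 1 with h6 | h6
  · rw [min_eq_left h5, min_eq_left h6]; exact (min_le_left _ _).trans (by linarith)
  · rw [min_eq_right h6]; exact (min_le_right _ _).trans (by linarith [le_min h3 zero_le_one])
  · rw [min_eq_right h5]; exact (min_le_right _ _).trans (by linarith [le_min h4 zero_le_one])
  · rw [min_eq_right h5]; exact (min_le_right _ _).trans (by linarith [le_min h4 zero_le_one])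

/-! ### The bonus controls the estimation error, and is itself controlled by the true features -/

section Bonus

variable {O A : Type} {H : ℕ} {S : CoreTests O A H} [Fintype O] [Fintype A] [Nonempty A]
  [DecidableEq A] {n : ℕ}

/-- The squared elliptical norm of the feature of `τ`, with respect to the data of level `h`. -/
def featQuad (lam : ℝ) (θ : PSR S) (D : Fin n → Batch O A H) (h : ℕ) (τ : Fin h → O × A) : ℝ :=
  -- Data exist only for levels below H; the value 0 elsewhere merely makes the family total.
  if hh : h < H then
    quadInv lam (fun t => θ.ψbar (pre (D t ⟨h, hh⟩) h hh.le)) (θ.ψbar τ) else 0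

lemma featQuad_fin (lam : ℝ) (θ : PSR S) (D : Fin n → Batch O A H) (h : Fin H)
    (τ : Fin h → O × A) : featQuad lam θ D h τ =
      quadInv lam (fun t => θ.ψbar (pre (D t h) h h.2.le)) (θ.ψbar τ) := by
  rw [featQuad, dif_pos h.2]

lemma featQuad_nonneg {lam : ℝ} (hlam : 0 < lam) (θ : PSR S) (D : Fin n → Batch O A H) (h : ℕ)
    (τ : Fin h → O × A) : 0 ≤ featQuad lam θ D h τ := by
  unfold featQuad
  split_ifs
  · exact quadInv_nonneg hlam _ _
  · exact le_rfl

lemma bonus_eq (p : Inputs) (θ : PSR S) (D : Fin n → Batch O A H) (τ : Fin H → O × A) :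
    bonus p θ D τ = min (p.α * √(∑ h : Fin H, featQuad p.lam θ D h (pre τ h h.2.le))) 1 := by
  simp_rw [featQuad_fin]
  rfl

lemma bonus_mem (p : Inputs) (hα : 0 ≤ p.α) (θ : PSR S) (D : Fin n → Batch O A H)
    (τ : Fin H → O × A) : bonus p θ D τ ∈ Set.Icc (0 : ℝ) 1 :=
  ⟨le_min (by positivity) zero_le_one, min_le_right _ _⟩

/-- The sum over the data of the squared conditional distances of two models. -/
def dataDist (θ₁ θ₂ : PSR S) (D : Fin n → Batch O A H) : ℝ :=
  ∑ h : Fin H, ∑ t, condTV θ₁ θ₂ h.2.le (pre (D t h) h h.2.le) ^ 2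

variable {θ₁ θ₂ : PSR S} {γ : ℝ} (hγ : 0 < γ) (hH : 1 ≤ H) (h₁ : θ₁.IsPSR) (h₂ : θ₂.IsPSR)
  (hw₁ : θ₁.WellConditioned γ) (hw₂ : θ₂.WellConditioned γ) (D : Fin n → Batch O A H)

include hγ hH h₁ h₂ hw₁ hw₂

/-- The errors on the data are at most a multiple of `condTV`, and those on basis vectors at most
2Q_A/γ²; the two summands of `hbY` are these contributions, summed over the levels. -/
theorem tv_le_value_featQuad {lam a b Y : ℝ} (hlam : 0 < lam) (ha : 0 < a)
    (hb : dataDist θ₁ θ₂ D ≤ b) (hY : 0 ≤ Y)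
    (hbY : H * (lam * S.dim * (2 * S.QA / γ ^ 2) ^ 2) +
      (4 * Fintype.card A * S.QA / γ) ^ 2 * b ≤ Y ^ 2) (π : Policy O A) :
    tv (fun τ : Fin H → O × A => θ₁.law π τ) (fun τ => θ₂.law π τ) ≤
      2 * (1 + Y / a) * θ₁.value (fun τ => min (a * √(∑ h : Fin H,
        featQuad lam θ₁ D h (pre τ h h.2.le))) 1) π := by
  refine PSR.tv_le_value_min h₁ h₂ π (fun h τ => featQuad lam θ₁ D h τ)
    (fun h τ => featQuad_nonneg hlam θ₁ D h τ)
    (fun h => lam * S.d h * (2 * S.QA / γ ^ 2) ^ 2 +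
      ∑ t, θ₁.err θ₂ (H - (h + 1)) h (θ₁.ψbar (pre (D t h) h h.2.le)) ^ 2)
    (fun h => by positivity) (fun h τ => ?_) ha hY (le_trans ?_ hbY)
  · rw [featQuad_fin]
    have := (θ₁.err_isSeminorm θ₂ (H - (h + 1)) h).sq_le_quadInv hlam
      (fun t => θ₁.ψbar (pre (D t h) h h.2.le))
      (PSR.err_single_le hγ hH h₁ h₂ hw₁ hw₂ h.2) (θ₁.ψbar τ)
    rwa [Fintype.card_fin] at this
  · rw [sum_add_distrib]
    refine add_le_add ?_ ?_
    · have := sum_le_card_nsmul univ (fun h : Fin H => lam * S.d h * (2 * S.QA / γ ^ 2) ^ 2)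
        (lam * S.dim * (2 * S.QA / γ ^ 2) ^ 2) fun h _ => by
          have := S.d_le_dim h.2.le
          gcongr
      simpa using this
    · refine le_trans ?_ (mul_le_mul_of_nonneg_left hb (sq_nonneg _))
      rw [dataDist, mul_sum]
      refine sum_le_sum fun h _ => ?_
      rw [mul_sum]
      refine sum_le_sum fun t _ => ?_
      rw [← mul_pow]
      exact pow_le_pow_left₀ ((θ₁.err_isSeminorm θ₂ _ _).nonneg _)
        (PSR.err_ψbar_le hγ hH h₁ h₂ hw₂ h.2 _) 2

theorem tv_le_bonus (p : Inputs) (hlam : 0 < p.lam) (hα : 0 < p.α) {b Y : ℝ}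
    (hb : dataDist θ₁ θ₂ D ≤ b) (hY : 0 ≤ Y)
    (hbY : H * (p.lam * S.dim * (2 * S.QA / γ ^ 2) ^ 2) +
      (4 * Fintype.card A * S.QA / γ) ^ 2 * b ≤ Y ^ 2) (π : Policy O A) :
    tv (fun τ : Fin H → O × A => θ₁.law π τ) (fun τ => θ₂.law π τ) ≤
      2 * (1 + Y / p.α) * θ₁.value (bonus p θ₁ D) π := by
  have e : bonus p θ₁ D = fun τ => min (p.α * √(∑ h : Fin H,
      featQuad p.lam θ₁ D h (pre τ h h.2.le))) 1 := funext fun τ => bonus_eq p θ₁ D τ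
  rw [e]
  exact tv_le_value_featQuad hγ hH h₁ h₂ hw₁ hw₂ D hlam hα hb hY hbY π

omit hγ hH h₁ h₂ hw₁ hw₂ in
lemma dataDist_comm : dataDist θ₁ θ₂ D = dataDist θ₂ θ₁ D :=
  sum_congr rfl fun h _ => sum_congr rfl fun t _ => by rw [condTV_comm]

omit hγ hH hw₁ hw₂ in
-- The model changes in two places. In the vector the difference of the features is paid for crudely
-- by 1/lam; in the Gram matrix it is absorbed into the regularisation, since the squared
-- differences over the data sum to at most (2|A|Q_A)²b.
lemma featQuad_le_featQuad {lam b : ℝ} (hlam : 0 < lam) (hb : dataDist θ₁ θ₂ D ≤ b) (h : Fin H)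
    (τ : Fin h → O × A) : featQuad lam θ₁ D h τ ≤ 2 / lam * θ₁.featDist θ₂ τ ^ 2 +
      2 * (2 + 2 * (2 * Fintype.card A * S.QA) ^ 2 * b / lam) * featQuad lam θ₂ D h τ := by
  rw [featQuad_fin, featQuad_fin]
  set f₁ := fun t => θ₁.ψbar (pre (D t h) h h.2.le) with hf₁
  set f₂ := fun t => θ₂.ψbar (pre (D t h) h h.2.le) with hf₂
  have hl2 : ∀ s : Fin h → O × A, (θ₁.ψbar s - θ₂.ψbar s) ⬝ᵥ (θ₁.ψbar s - θ₂.ψbar s) ≤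
      θ₁.featDist θ₂ s ^ 2 := fun s => by
    have := sum_sq_le_sq_sum_of_nonneg (s := univ) (f := fun l => |θ₁.ψbar s l - θ₂.ψbar s l|)
      fun i _ => abs_nonneg _
    simp only [sq_abs] at this
    refine le_trans (le_of_eq ?_) this
    exact sum_congr rfl fun l _ => by rw [Pi.sub_apply, sq]
  have hdata : ∑ t, θ₁.featDist θ₂ (pre (D t h) h h.2.le) ^ 2 ≤
      (2 * Fintype.card A * S.QA) ^ 2 * b := by
    have e1 : ∑ t, condTV θ₁ θ₂ h.2.le (pre (D t h) h h.2.le) ^ 2 ≤ b := by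
      refine le_trans ?_ hb
      exact single_le_sum (f := fun h : Fin H => ∑ t, condTV θ₁ θ₂ h.2.le
        (pre (D t h) h h.2.le) ^ 2) (fun j _ => sum_nonneg fun t _ => sq_nonneg _) (mem_univ h)
    refine le_trans ?_ (mul_le_mul_of_nonneg_left e1 (sq_nonneg _))
    rw [mul_sum]
    refine sum_le_sum fun t _ => ?_
    rw [← mul_pow]
    exact pow_le_pow_left₀ (θ₁.featDist_nonneg θ₂ _)
      ((PSR.featDist_le_condDist h₁ h₂ h.2.le _).trans (condDist_le h₁ h.2 _)) 2
  have hcmp : ∀ y : Fin (S.d h) → ℝ, lam * (y ⬝ᵥ y) + ∑ t, (f₂ t ⬝ᵥ y) ^ 2 ≤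
      (2 + 2 * (2 * Fintype.card A * S.QA) ^ 2 * b / lam) *
        (lam * (y ⬝ᵥ y) + ∑ t, (f₁ t ⬝ᵥ y) ^ 2) := fun y => by
    have hy : 0 ≤ y ⬝ᵥ y := sum_nonneg fun i _ => mul_self_nonneg _
    have hb0 : 0 ≤ (2 * Fintype.card A * S.QA : ℝ) ^ 2 * b :=
      (sum_nonneg fun t _ => sq_nonneg _).trans hdata
    have hF : 0 ≤ ∑ t, (f₁ t ⬝ᵥ y) ^ 2 := sum_nonneg fun t _ => sq_nonneg _
    have e1 : ∀ t, (f₂ t ⬝ᵥ y) ^ 2 ≤ 2 * (f₁ t ⬝ᵥ y) ^ 2 +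
        2 * (θ₁.featDist θ₂ (pre (D t h) h h.2.le) ^ 2 * (y ⬝ᵥ y)) := fun t => by
      have e2 := dot_sq_le (f₁ t - f₂ t) y
      have e3 := mul_le_mul_of_nonneg_right (hl2 (pre (D t h) h h.2.le)) hy
      have e4 : f₂ t ⬝ᵥ y = f₁ t ⬝ᵥ y - (f₁ t - f₂ t) ⬝ᵥ y := by rw [sub_dotProduct]; ring
      rw [e4]
      nlinarith [sq_nonneg (f₁ t ⬝ᵥ y + (f₁ t - f₂ t) ⬝ᵥ y)]
    have e2 : ∑ t, (f₂ t ⬝ᵥ y) ^ 2 ≤ 2 * ∑ t, (f₁ t ⬝ᵥ y) ^ 2 +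
        2 * ((2 * Fintype.card A * S.QA) ^ 2 * b * (y ⬝ᵥ y)) := by
      refine (sum_le_sum fun t _ => e1 t).trans ?_
      rw [sum_add_distrib, ← mul_sum, ← mul_sum, ← sum_mul]
      gcongr
    have e3 : 0 ≤ 2 * (2 * Fintype.card A * S.QA : ℝ) ^ 2 * b / lam * ∑ t, (f₁ t ⬝ᵥ y) ^ 2 :=
      mul_nonneg (div_nonneg (by linarith) hlam.le) hF
    have e4 : 2 * (2 * Fintype.card A * S.QA : ℝ) ^ 2 * b / lam * (lam * (y ⬝ᵥ y)) =
        2 * ((2 * Fintype.card A * S.QA) ^ 2 * b * (y ⬝ᵥ y)) := by field_simp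
    have e5 : 0 ≤ lam * (y ⬝ᵥ y) := mul_nonneg hlam.le hy
    nlinarith
  have e1 := quadInv_le_of_le hlam hlam f₁ f₂ hcmp (θ₂.ψbar τ)
  have e2 := quadInv_add_le hlam f₁ (θ₁.ψbar τ - θ₂.ψbar τ) (θ₂.ψbar τ)
  rw [sub_add_cancel] at e2
  have e3 := (quadInv_le_dot hlam f₁ (θ₁.ψbar τ - θ₂.ψbar τ)).trans
    (div_le_div_of_nonneg_right (hl2 τ) hlam.le)
  calc _ ≤ _ := e2
    _ ≤ 2 * (θ₁.featDist θ₂ τ ^ 2 / lam) + 2 * ((2 + 2 * (2 * Fintype.card A * S.QA) ^ 2 * b / lam)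
        * quadInv lam f₂ (θ₂.ψbar τ)) := by linarith
    _ = _ := by ring

/-- The value of the bonus, in terms of the features of the second model (the true one). -/
theorem value_bonus_le (p : Inputs) (hlam : 0 < p.lam) (hα : 0 < p.α) {b Y Y₀ lam' : ℝ}
    (hlam' : 0 < lam') (hpos₁ : ∀ t (h : Fin H), 0 < θ₁.prob (pre (D t h) h h.2.le))
    (hpos₂ : ∀ t (h : Fin H), 0 < θ₂.prob (pre (D t h) h h.2.le))
    (hb : dataDist θ₁ θ₂ D ≤ b) (hY : 0 ≤ Y)
    (hbY : H * (lam' * S.dim * (8 * (S.QA / γ) ^ 2) ^ 2) +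
      (14 * (S.QA / γ * (Fintype.card A * S.QA))) ^ 2 * b ≤ Y ^ 2)
    (hY₀ : 0 < Y₀) (hbY₀ : H * (lam' * S.dim * (2 * S.QA / γ ^ 2) ^ 2) +
      (4 * Fintype.card A * S.QA / γ) ^ 2 * b ≤ Y₀ ^ 2)
    (hYY : Y₀ ≤ p.α * √(2 / p.lam) * √H * Y) (N : ℕ) (π : Policy O A) :
    θ₁.value (bonus p θ₁ D) π ≤ (1 / 2) ^ N +
      (4 * N + 2) * θ₂.value (fun τ => min (p.α * √(2 / p.lam) * √H * Y *
        √(∑ h : Fin H, featQuad lam' θ₂ D h (pre τ h h.2.le))) 1) π +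
      θ₂.value (fun τ => min (p.α *
        √(2 * (2 + 2 * (2 * Fintype.card A * S.QA) ^ 2 * b / p.lam)) *
        √(∑ h : Fin H, featQuad p.lam θ₂ D h (pre τ h h.2.le))) 1) π := by
  set Z := p.α * √(2 / p.lam) * √H * Y with hZ
  set κ := 2 + 2 * (2 * Fintype.card A * S.QA : ℝ) ^ 2 * b / p.lam with hκ
  have hb0 : 0 ≤ b := (sum_nonneg fun h _ => sum_nonneg fun t _ => sq_nonneg _ :
    0 ≤ dataDist θ₁ θ₂ D).trans hb
  have hκ0 : 0 ≤ κ := by positivity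
  -- hypotheses of the comparison theorems, with the true model in the first place
  have hg : ∀ h (τ : Fin h → O × A), 0 ≤ featQuad lam' θ₂ D h τ :=
    fun h τ => featQuad_nonneg hlam' θ₂ D h τ
  set B : Fin H → ℝ := fun h => lam' * S.d h * (8 * (S.QA / γ) ^ 2) ^ 2 +
      ∑ t, θ₂.gap θ₁ (H - (h + 1)) h (θ₂.ψbar (pre (D t h) h h.2.le)) ^ 2 with hB
  have hB0 : ∀ h, 0 ≤ B h := fun h => by positivity
  have hgap : ∀ (h : Fin H) (τ : Fin h → O × A),
      θ₂.gap θ₁ (H - (h + 1)) h (θ₂.ψbar τ) ^ 2 ≤ B h * featQuad lam' θ₂ D h τ := fun h τ => by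
    rw [featQuad_fin]
    have := (θ₂.gap_isSeminorm θ₁ (H - (h + 1)) h).sq_le_quadInv hlam'
      (fun t => θ₂.ψbar (pre (D t h) h h.2.le))
      (PSR.gap_single_le hγ hH h₂ h₁ hw₂ hw₁ h.2) (θ₂.ψbar τ)
    rwa [Fintype.card_fin] at this
  have hBY : ∑ h, B h ≤ Y ^ 2 := by
    refine le_trans ?_ hbY
    rw [hB, sum_add_distrib]
    refine add_le_add ?_ ?_
    · have := sum_le_card_nsmul univ
        (fun h : Fin H => lam' * S.d h * (8 * ((S.QA : ℝ) / γ) ^ 2) ^ 2)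
        (lam' * S.dim * (8 * (S.QA / γ) ^ 2) ^ 2) fun h _ => by
          have := S.d_le_dim h.2.le
          gcongr
      simpa using this
    · refine le_trans ?_ (mul_le_mul_of_nonneg_left hb (sq_nonneg _))
      rw [dataDist, mul_sum]
      refine sum_le_sum fun h _ => ?_
      rw [mul_sum]
      refine sum_le_sum fun t _ => ?_
      rw [← mul_pow]
      refine pow_le_pow_left₀ ((θ₂.gap_isSeminorm θ₁ _ _).nonneg _) ?_ 2
      rw [condTV_comm]
      exact PSR.gap_ψbar_le hγ hH h₂ h₁ hw₁ h.2 _ (hpos₂ t h) (hpos₁ t h)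
  -- change of measure
  have s1 := PSR.value_sub_le h₁ h₂ π (bonus_mem p hα.le θ₁ D)
  have s2 := tv_le_value_featQuad hγ hH h₂ h₁ hw₂ hw₁ D hlam' hY₀
    ((dataDist_comm D).trans_le hb) hY₀.le hbY₀ π
  -- With threshold parameter Y₀ the comparison factor is 4, which `PSR.value_sub_le` halves; this
  -- is the 2 in 4N + 2.
  rw [div_self hY₀.ne', tv_comm] at s2
  have s3 : θ₂.value (fun τ => min (Y₀ *
      √(∑ h : Fin H, featQuad lam' θ₂ D h (pre τ h h.2.le))) 1) π ≤
      θ₂.value (fun τ => min (Z *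
      √(∑ h : Fin H, featQuad lam' θ₂ D h (pre τ h h.2.le))) 1) π := by
    refine PSR.value_mono h₂ π fun τ => min_le_min ?_ le_rfl
    exact mul_le_mul_of_nonneg_right hYY (Real.sqrt_nonneg _)
  -- the bonus under the true model
  have s4 : ∀ τ, bonus p θ₁ D τ ≤ min (p.α * √(2 / p.lam) *
      √(∑ h : Fin H, θ₂.featDist θ₁ (pre τ h h.2.le) ^ 2)) 1 +
      min (p.α * √(2 * κ) * √(∑ h : Fin H, featQuad p.lam θ₂ D h (pre τ h h.2.le))) 1 :=
    fun τ => by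
    have hQ0 : 0 ≤ ∑ h : Fin H, featQuad p.lam θ₂ D h (pre τ h h.2.le) :=
      sum_nonneg fun h _ => featQuad_nonneg hlam θ₂ D h _
    have hD0 : 0 ≤ ∑ h : Fin H, θ₂.featDist θ₁ (pre τ h h.2.le) ^ 2 :=
      sum_nonneg fun h _ => sq_nonneg _
    have e1 : ∑ h : Fin H, featQuad p.lam θ₁ D h (pre τ h h.2.le) ≤
        2 / p.lam * ∑ h : Fin H, θ₂.featDist θ₁ (pre τ h h.2.le) ^ 2 +
        2 * κ * ∑ h : Fin H, featQuad p.lam θ₂ D h (pre τ h h.2.le) := by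
      rw [mul_sum, mul_sum, ← sum_add_distrib]
      refine sum_le_sum fun h _ => ?_
      have e2 : θ₂.featDist θ₁ (pre τ h h.2.le) = θ₁.featDist θ₂ (pre τ h h.2.le) :=
        sum_congr rfl fun l _ => abs_sub_comm _ _
      rw [e2]
      exact featQuad_le_featQuad h₁ h₂ D hlam hb h _
    rw [bonus_eq]
    calc _ ≤ min (p.α * √(2 / p.lam * ∑ h : Fin H, θ₂.featDist θ₁ (pre τ h h.2.le) ^ 2 +
        2 * κ * ∑ h : Fin H, featQuad p.lam θ₂ D h (pre τ h h.2.le))) 1 := by gcongr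
      _ ≤ _ := min_mul_sqrt_add_le (by positivity) (by positivity) hα.le
      _ = _ := by
        rw [Real.sqrt_mul (show 0 ≤ 2 / p.lam by positivity),
          Real.sqrt_mul (show 0 ≤ 2 * κ by positivity), mul_assoc, mul_assoc]
  have s5 := PSR.value_mono h₂ π s4
  rw [PSR.value_add] at s5
  have s6 := PSR.value_min_featDist_le h₂ h₁ π hH _ hg B hB0 hgap
    (a := p.α * √(2 / p.lam)) (by positivity) hY hBY N
  rw [← hZ] at s6
  linarith

end Bonus

end PSRUCB

end

noncomputable section

namespace PSRUCB

open Finset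

/-! ### The law of the data stream -/

section Stream

variable {O A : Type} {H : ℕ} {S : CoreTests O A H} [Fintype O] [Fintype A] [Nonempty A]
  [DecidableEq A]

lemma exploreLaw_nonneg {θ : PSR S} (hθ : θ.IsPSR) (π : Policy O A) (h : Fin H)
    (τ : Fin H → O × A) : 0 ≤ exploreLaw θ π h τ := by
  rw [exploreLaw_eq]
  exact mul_nonneg (inv_nonneg.mpr (Nat.cast_nonneg _))
    (sum_nonneg fun l _ => hθ.law_nonneg _ le_rfl τ)

/-- Switching changes nothing before level h, so the collected history of level h has exactly the
law of the current policy. -/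
lemma sum_exploreLaw_mul_pre {θ : PSR S} (hθ : θ.IsPSR) (π : Policy O A) (h : Fin H)
    (G : (Fin h → O × A) → ℝ) :
    ∑ τ, exploreLaw θ π h τ * G (pre τ h h.2.le) = ∑ s : Fin h → O × A, θ.law π s * G s := by
  have h0 : ((S.exploration h).card : ℝ) ≠ 0 := by
    exact_mod_cast (card_pos.mpr (hθ.exploration_nonempty h.2.le)).ne'
  simp_rw [exploreLaw_eq, mul_assoc, sum_mul]
  rw [← mul_sum, sum_comm]
  have : ∀ l ∈ S.exploration h, ∑ τ : Fin H → O × A, θ.law (π.switch h l) τ *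
      G (pre τ h h.2.le) = ∑ s : Fin h → O × A, θ.law π s * G s := fun l _ => by
    rw [hθ.sum_law_pre (π.switch h l) h.2.le le_rfl G]
    refine sum_congr rfl fun s _ => ?_
    rw [PSR.law, PSR.law, π.switch_weight_of_le le_rfl]
  rw [sum_congr rfl this, sum_const, nsmul_eq_mul, inv_mul_cancel_left₀ h0]

lemma sum_exploreLaw {θ : PSR S} (hθ : θ.IsPSR) (π : Policy O A) (h : Fin H) :
    ∑ τ, exploreLaw θ π h τ = 1 := by
  have := sum_exploreLaw_mul_pre hθ π h fun _ => 1
  simp only [mul_one] at this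
  rw [this, hθ.sum_law π h.2.le]

lemma streamProb_nonneg {θ : PSR S} (hθ : θ.IsPSR) (ora : Oracle S) {K : ℕ}
    (D : Fin K → Batch O A H) : 0 ≤ streamProb ora θ D :=
  prod_nonneg fun _ _ => prod_nonneg fun _ _ => exploreLaw_nonneg hθ _ _ _

lemma streamProb_snoc (ora : Oracle S) (θ : PSR S) {K : ℕ} (D : Fin K → Batch O A H)
    (x : Batch O A H) : streamProb ora θ (Fin.snoc (α := fun _ => Batch O A H) D x) =
      streamProb ora θ D * ∏ h : Fin H, exploreLaw θ (ora.pol K D) h (x h) := by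
  unfold streamProb
  rw [Fin.prod_univ_castSucc]
  congr 1
  · refine prod_congr rfl fun t _ => ?_
    rw [Fin.snoc_castSucc (α := fun _ => Batch O A H) x D t]
    unfold Oracle.polAt
    have := pre_snoc D x t.2.le
    simp only [Fin.val_castSucc]
    rw [this]
  · rw [Fin.snoc_last (α := fun _ => Batch O A H)]
    unfold Oracle.polAt
    simp only [Fin.val_last]
    rw [pre_snoc_self]

/-- A family of functions of the past data, a level and the next trajectory of that level. -/
abbrev StreamFun (O A : Type) (H : ℕ) : Type :=
  (t : ℕ) → (Fin t → Batch O A H) → Fin H → (Fin H → O × A) → ℝ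

lemma stream_sum_succ (ora : Oracle S) (θ : PSR S) (F : StreamFun O A H) (K : ℕ) :
    ∑ D : Fin (K + 1) → Batch O A H, streamProb ora θ D *
        ∏ t : Fin (K + 1), ∏ h, F t (pre D t t.2.le) h (D t h) =
      ∑ D : Fin K → Batch O A H, (streamProb ora θ D *
        ∏ t : Fin K, ∏ h, F t (pre D t t.2.le) h (D t h)) *
        ∏ h, ∑ τ, exploreLaw θ (ora.pol K D) h τ * F K D h τ := by
  rw [sum_snoc]
  refine sum_congr rfl fun D _ => ?_
  rw [prod_univ_sum, Fintype.piFinset_univ, mul_sum]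
  refine sum_congr rfl fun x _ => ?_
  rw [streamProb_snoc, Fin.prod_univ_castSucc]
  have h1 : ∀ t : Fin K, ∏ h, F (t.castSucc : Fin (K + 1))
      (pre (Fin.snoc (α := fun _ => Batch O A H) D x) (t.castSucc : Fin (K + 1))
        t.castSucc.2.le) h ((Fin.snoc (α := fun _ => Batch O A H) D x) t.castSucc h) =
      ∏ h, F t (pre D t t.2.le) h (D t h) := fun t => by
    rw [Fin.snoc_castSucc (α := fun _ => Batch O A H) x D t]
    have := pre_snoc D x t.2.le
    simp only [Fin.val_castSucc]
    rw [this]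
  have h2 : ∏ h, F (Fin.last K : Fin (K + 1))
      (pre (Fin.snoc (α := fun _ => Batch O A H) D x) (Fin.last K : Fin (K + 1))
        (Fin.last K).2.le) h ((Fin.snoc (α := fun _ => Batch O A H) D x) (Fin.last K) h) =
      ∏ h, F K D h (x h) := by
    rw [Fin.snoc_last (α := fun _ => Batch O A H)]
    simp only [Fin.val_last]
    rw [pre_snoc_self]
  rw [h2, prod_congr rfl fun t _ => h1 t, prod_mul_distrib]
  ring

/-- Given the past, the trajectories of a batch are independent, so conditional means bounded by c
multiply along the stream. -/
lemma stream_sum_le {θ : PSR S} (hθ : θ.IsPSR) (ora : Oracle S) (F : StreamFun O A H)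
    (hF : ∀ t D h τ, 0 ≤ F t D h τ) (c : ℕ → Fin H → ℝ)
    (hc : ∀ t D h, ∑ τ, exploreLaw θ (ora.pol t D) h τ * F t D h τ ≤ c t h) (K : ℕ) :
    ∑ D : Fin K → Batch O A H, streamProb ora θ D *
        ∏ t : Fin K, ∏ h, F t (pre D t t.2.le) h (D t h) ≤ ∏ t : Fin K, ∏ h, c t h := by
  have hc0 : ∀ t h, 0 ≤ c t h := fun t h => by
    by_cases hb : Nonempty (Fin t → Batch O A H)
    · obtain ⟨D⟩ := hb
      exact (sum_nonneg fun τ _ => mul_nonneg (exploreLaw_nonneg hθ _ _ _) (hF _ _ _ _)).trans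
        (hc t D h)
    · have hO := hθ.nonempty_obs
      exact absurd (inferInstance : Nonempty (Fin t → Batch O A H)) hb
  induction K with
  | zero => simp [streamProb]
  | succ K ih =>
    rw [stream_sum_succ, Fin.prod_univ_castSucc]
    calc _ ≤ ∑ D : Fin K → Batch O A H, (streamProb ora θ D *
        ∏ t : Fin K, ∏ h, F t (pre D t t.2.le) h (D t h)) * ∏ h, c K h := by
          refine sum_le_sum fun D _ => mul_le_mul_of_nonneg_left ?_ ?_
          · exact prod_le_prod (fun h _ => sum_nonneg fun τ _ =>
              mul_nonneg (exploreLaw_nonneg hθ _ _ _) (hF _ _ _ _)) fun h _ => hc K D h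
          · exact mul_nonneg (streamProb_nonneg hθ ora D)
              (prod_nonneg fun t _ => prod_nonneg fun h _ => hF _ _ _ _)
      _ ≤ _ := by
          rw [← sum_mul]
          exact mul_le_mul_of_nonneg_right ih (prod_nonneg fun h _ => hc0 _ _)

lemma sum_streamProb {θ : PSR S} (hθ : θ.IsPSR) (ora : Oracle S) (K : ℕ) :
    ∑ D : Fin K → Batch O A H, streamProb ora θ D = 1 := by
  induction K with
  | zero => simp [streamProb]
  | succ K ih =>
    have := stream_sum_succ ora θ (fun _ _ _ _ => 1) K
    simp only [prod_const_one, mul_one, sum_exploreLaw hθ] at this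
    rw [this, ih]

lemma streamPr_eq (ora : Oracle S) (θ : PSR S) (K : ℕ) (E : (Fin K → Batch O A H) → Prop) :
    streamPr ora θ K E = ∑ D, streamProb ora θ D * ind (E D) := by
  unfold streamPr
  refine sum_congr rfl fun D _ => ?_
  by_cases h : E D
  · rw [if_pos h, ind_true h, mul_one]
  · rw [if_neg h, ind_false h, mul_zero]

lemma streamPr_mono {θ : PSR S} (hθ : θ.IsPSR) (ora : Oracle S) {K : ℕ}
    {E F : (Fin K → Batch O A H) → Prop}
    (h : ∀ D, 0 < streamProb ora θ D → E D → F D) : streamPr ora θ K E ≤ streamPr ora θ K F := by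
  rw [streamPr_eq, streamPr_eq]
  refine sum_le_sum fun D _ => ?_
  rcases (streamProb_nonneg hθ ora D).eq_or_lt with h0 | h0
  · rw [← h0, zero_mul, zero_mul]
  · exact mul_le_mul_of_nonneg_left (ind_mono (h D h0)) h0.le

lemma streamPr_or_le {θ : PSR S} (hθ : θ.IsPSR) (ora : Oracle S) {K : ℕ}
    (E F : (Fin K → Batch O A H) → Prop) :
    streamPr ora θ K (fun D => E D ∨ F D) ≤ streamPr ora θ K E + streamPr ora θ K F := by
  rw [streamPr_eq, streamPr_eq, streamPr_eq, ← sum_add_distrib]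
  refine sum_le_sum fun D _ => ?_
  rw [← mul_add]
  exact mul_le_mul_of_nonneg_left (ind_or_le _ _) (streamProb_nonneg hθ ora D)

lemma streamPr_exists_le {θ : PSR S} (hθ : θ.IsPSR) (ora : Oracle S) {K : ℕ} {ι : Type*}
    (s : Finset ι) (E : ι → (Fin K → Batch O A H) → Prop) :
    streamPr ora θ K (fun D => ∃ i ∈ s, E i D) ≤ ∑ i ∈ s, streamPr ora θ K (E i) := by
  simp_rw [streamPr_eq]
  rw [sum_comm]
  refine sum_le_sum fun D _ => ?_
  rw [← mul_sum]
  refine mul_le_mul_of_nonneg_left ?_ (streamProb_nonneg hθ ora D)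
  by_cases h : ∃ i ∈ s, E i D
  · rw [ind_true h]
    obtain ⟨i, hi, h⟩ := h
    refine le_trans (le_of_eq (ind_true h).symm) ?_
    exact single_le_sum (f := fun i => ind (E i D)) (fun j _ => ind_nonneg _) hi
  · rw [ind_false h]
    exact sum_nonneg fun i _ => ind_nonneg _

lemma one_sub_streamPr_not {θ : PSR S} (hθ : θ.IsPSR) (ora : Oracle S) {K : ℕ}
    (E : (Fin K → Batch O A H) → Prop) :
    1 - streamPr ora θ K (fun D => ¬ E D) = streamPr ora θ K E := by
  rw [streamPr_eq, streamPr_eq, ← sum_streamProb hθ ora K, ← sum_sub_distrib]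
  refine sum_congr rfl fun D _ => ?_
  have := ind_add_not (E D)
  rw [← mul_one_sub]
  congr 1
  linarith

/-- Markov's inequality for products along the stream. -/
lemma streamPr_le_of_prod {θ : PSR S} (hθ : θ.IsPSR) (ora : Oracle S) (F : StreamFun O A H)
    (hF : ∀ t D h τ, 0 ≤ F t D h τ) (c : ℕ → Fin H → ℝ)
    (hc : ∀ t D h, ∑ τ, exploreLaw θ (ora.pol t D) h τ * F t D h τ ≤ c t h) {K : ℕ}
    {a b : ℝ} (ha : 0 < a) (hb : ∏ t : Fin K, ∏ h, c t h ≤ a * b) :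
    streamPr ora θ K (fun D => a ≤ ∏ t : Fin K, ∏ h, F t (pre D t t.2.le) h (D t h)) ≤ b := by
  refine le_of_mul_le_mul_left (le_trans ?_ ((stream_sum_le hθ ora F hF c hc K).trans hb)) ha
  rw [streamPr_eq, mul_sum]
  refine sum_le_sum fun D _ => ?_
  rw [mul_left_comm]
  refine mul_le_mul_of_nonneg_left ?_ (streamProb_nonneg hθ ora D)
  by_cases h : a ≤ ∏ t : Fin K, ∏ h, F t (pre D t t.2.le) h (D t h)
  · rw [ind_true h, mul_one]; exact h
  · rw [ind_false h, mul_zero]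
    exact prod_nonneg fun t _ => prod_nonneg fun h _ => hF _ _ _ _

/-- All collected histories have at least probability `q` at collection, with high probability. -/
lemma streamPr_exists_law_lt {θ : PSR S} (hθ : θ.IsPSR) (ora : Oracle S) {K : ℕ} {q : ℝ}
    (hq : 0 ≤ q) :
    streamPr ora θ K (fun D => ∃ (t : Fin K) (h : Fin H),
      θ.law (ora.polAt D t) (pre (D t h) h h.2.le) < q) ≤
      K * H * ((Fintype.card O : ℝ) ^ H * (Fintype.card A : ℝ) ^ H * q) := by
  have hO := hθ.nonempty_obs
  have hcard : ∀ h : Fin H, ((Fintype.card (Fin h → O × A) : ℕ) : ℝ) ≤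
      (Fintype.card O : ℝ) ^ H * (Fintype.card A : ℝ) ^ H := fun h => by
    rw [Fintype.card_fun, Fintype.card_fin, Fintype.card_prod, ← mul_pow]
    push_cast
    refine pow_le_pow_right₀ ?_ h.2.le
    have h1 : (1 : ℝ) ≤ Fintype.card O := by exact_mod_cast Fintype.card_pos
    have h2 : (1 : ℝ) ≤ Fintype.card A := by exact_mod_cast Fintype.card_pos
    exact one_le_mul_of_one_le_of_one_le h1 h2
  set B : ℝ := (Fintype.card O : ℝ) ^ H * (Fintype.card A : ℝ) ^ H * q with hB
  have hB0 : 0 ≤ B := by positivity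
  have key : ∀ (i : Fin K × Fin H), streamPr ora θ K (fun D =>
      θ.law (ora.polAt D i.1) (pre (D i.1 i.2) i.2 i.2.2.le) < q) ≤ B := fun i => by
    classical
    -- The indicator of one iteration and level, and 1 elsewhere. Each history of probability below
    -- q contributes at most q, and there are at most |O|^H|A|^H of them.
    set F : StreamFun O A H := fun t D h τ => if t = i.1 ∧ h = i.2 then
      ind (θ.law (ora.pol t D) (pre τ h h.2.le) < q) else 1 with hF
    have h1 := streamPr_le_of_prod hθ ora F (fun t D h τ => by
        rw [hF]; simp only; split_ifs; exacts [ind_nonneg _, zero_le_one])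
      (fun t h => if t = i.1 ∧ h = i.2 then B else 1) (fun t D h => by
        simp only [hF]
        split_ifs with hi
        · rw [sum_exploreLaw_mul_pre hθ _ h fun s => ind (θ.law (ora.pol t D) s < q)]
          have h2 := sum_le_card_nsmul univ (fun s : Fin h → O × A => θ.law (ora.pol t D) s *
            ind (θ.law (ora.pol t D) s < q)) q fun s _ => by
              by_cases hs : θ.law (ora.pol t D) s < q
              · rw [ind_true hs, mul_one]; exact hs.le
              · rw [ind_false hs, mul_zero]; exact hq
          refine h2.trans ?_
          rw [nsmul_eq_mul, card_univ, hB]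
          exact mul_le_mul_of_nonneg_right (hcard h) hq
        · simp only [mul_one]
          exact (sum_exploreLaw hθ _ h).le) (K := K) (a := 1) (b := B) one_pos (by
        rw [one_mul, prod_eq_single i.1, prod_eq_single i.2]
        · simp
        · intro h _ hh; simp [hh]
        · simp
        · intro t _ ht
          exact prod_eq_one fun h _ => if_neg fun hc => ht (Fin.ext hc.1)
        · simp)
    refine le_trans (streamPr_mono hθ ora fun D _ hD => ?_) h1
    refine le_of_eq (prod_eq_one fun t _ => prod_eq_one fun h _ => ?_).symm
    simp only [hF]
    split_ifs with hi
    · obtain ⟨hi1, rfl⟩ := hi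
      obtain rfl := Fin.ext hi1
      exact ind_true hD
    · rfl
  refine le_trans (streamPr_mono hθ ora (F := fun D => ∃ i ∈ (univ : Finset (Fin K × Fin H)),
    θ.law (ora.polAt D i.1) (pre (D i.1 i.2) i.2 i.2.2.le) < q) fun D _ hD => ?_) ?_
  · obtain ⟨t, h, hD⟩ := hD
    exact ⟨(t, h), mem_univ _, hD⟩
  · refine (streamPr_exists_le hθ ora univ _).trans ?_
    have := sum_le_card_nsmul univ _ B fun i _ => key i
    refine this.trans (le_of_eq ?_)
    rw [nsmul_eq_mul, card_univ, Fintype.card_prod, Fintype.card_fin, Fintype.card_fin]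
    push_cast
    ring

/-! ### The elliptical potential of the stream -/

lemma exp_neg_le_one_sub_half {x : ℝ} (h0 : 0 ≤ x) (h1 : x ≤ 1) :
    Real.exp (-x) ≤ 1 - x / 2 := by
  rw [Real.exp_neg, inv_le_comm₀ (Real.exp_pos x) (by linarith)]
  refine le_trans ?_ (Real.add_one_le_exp x)
  rw [inv_le_comm₀ (by linarith) (by linarith), inv_le_iff_one_le_mul₀ (by linarith)]
  nlinarith

/-- The expected truncated elliptical norms of the next trajectory. -/
def expPotential (lam : ℝ) (θ : PSR S) (π : Policy O A) {n : ℕ} (D : Fin n → Batch O A H) : ℝ :=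
  θ.value (fun τ => ∑ h : Fin H, min 1 (featQuad lam θ D h (pre τ h h.2.le))) π

/-- Features are rescaled rows of the dynamic matrix, restricted to the columns of the core tests.
-/
lemma rank_ψbar_le (θ : PSR S) (hθ : θ.IsPSR) {r : ℕ} (hr : θ.RankLE r) {h : ℕ} (hh : h ≤ H)
    {T : Type*} [Fintype T] (s : T → Fin h → O × A) :
    (Matrix.of fun t => θ.ψbar (s t)).rank ≤ r := by
  classical
  set C : Matrix T (Fin h → O × A) ℝ := Matrix.of fun t s' => if s' = s t then
    (θ.prob (s t))⁻¹ else 0 with hC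
  set E : Matrix (Fin (H - h) → O × A) (Fin (S.d h)) ℝ := Matrix.of fun ω l =>
    if ω = S.test h l then 1 else 0 with hE
  have h1 : (Matrix.of fun t => θ.ψbar (s t)) = C * θ.dynMatrix h (H - h) * E := by
    ext t l
    rw [Matrix.mul_assoc, Matrix.mul_apply, sum_eq_single (s t)]
    · rw [Matrix.mul_apply, sum_eq_single (S.test h l)]
      · simp [hC, hE, PSR.dynMatrix, PSR.ψbar, hθ.core h hh (s t) l]
      · intro ω _ hω; simp [hE, hω]
      · simp
    · intro s' _ hs; simp [hC, hs]
    · simp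
  rw [h1]
  exact (Matrix.rank_mul_le_left _ _).trans ((Matrix.rank_mul_le_right _ _).trans
    (hr h (H - h) (by omega)))

/-- For X in [0,1] with conditional mean μ, exp(μ/2 - X) has conditional mean at most exp(μ/2)(1 -
μ/2) ≤ 1. Markov's inequality bounds the expected sum by twice the realised one plus 2 log(1/q). The
realised sum obeys the elliptical potential lemma on each level for every stream, as the Euclidean
norm of a feature is at most Q_A. -/
theorem streamPr_expPotential_le {θ : PSR S} (hθ : θ.IsPSR) {r : ℕ} (hr : θ.RankLE r)
    (ora : Oracle S) {lam : ℝ} (hlam : 0 < lam) {K n : ℕ} (hn : n ≤ K) {q : ℝ} (hq : 0 < q) :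
    streamPr ora θ K (fun D => 4 * H * (r * Real.log (1 + n * (S.QA : ℝ) ^ 2 / lam)) +
      2 * Real.log (1 / q) < ∑ t : Fin n, expPotential lam θ (ora.pol t (pre D t (t.2.le.trans hn)))
        (pre D t (t.2.le.trans hn))) ≤ q := by
  classical
  set m : (t : ℕ) → (Fin t → Batch O A H) → Fin H → ℝ := fun t D h =>
    ∑ s : Fin h → O × A, θ.law (ora.pol t D) s * min 1 (featQuad lam θ D h s) with hm
  set F : StreamFun O A H := fun t D h τ => if t < n then
    Real.exp (m t D h / 2 - min 1 (featQuad lam θ D h (pre τ h h.2.le))) else 1 with hF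
  have hmark := streamPr_le_of_prod hθ ora F (fun t D h τ => by
      rw [hF]; simp only; split_ifs; exacts [(Real.exp_pos _).le, zero_le_one])
    (fun _ _ => 1) (fun t D h => by
      simp only [hF]
      split_ifs with ht
      · rw [sum_exploreLaw_mul_pre hθ _ h fun s =>
          Real.exp (m t D h / 2 - min 1 (featQuad lam θ D h s))]
        have e1 : ∀ s : Fin h → O × A, θ.law (ora.pol t D) s *
            Real.exp (m t D h / 2 - min 1 (featQuad lam θ D h s)) ≤
            Real.exp (m t D h / 2) * (θ.law (ora.pol t D) s -
              θ.law (ora.pol t D) s * min 1 (featQuad lam θ D h s) / 2) := fun s => by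
          rw [sub_eq_add_neg, Real.exp_add]
          have e2 := exp_neg_le_one_sub_half
            (le_min zero_le_one (featQuad_nonneg hlam θ D h s)) (min_le_left _ _)
          have e3 := mul_le_mul_of_nonneg_left e2 (mul_nonneg (hθ.law_nonneg (ora.pol t D) h.2.le s)
            (Real.exp_pos (m t D h / 2)).le)
          linarith
        refine (sum_le_sum fun s _ => e1 s).trans ?_
        rw [← mul_sum, sum_sub_distrib, hθ.sum_law _ h.2.le, ← sum_div]
        change Real.exp (m t D h / 2) * (1 - m t D h / 2) ≤ 1
        have e2 := Real.add_one_le_exp (-(m t D h / 2))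
        calc _ ≤ Real.exp (m t D h / 2) * Real.exp (-(m t D h / 2)) := by
              refine mul_le_mul_of_nonneg_left (by linarith) (Real.exp_pos _).le
          _ = 1 := by rw [← Real.exp_add, add_neg_cancel, Real.exp_zero]
      · simp only [mul_one]
        exact (sum_exploreLaw hθ _ h).le) (K := K) (a := 1 / q) (b := q) (by positivity) (by
      simp [hq.ne'])
  refine le_trans (streamPr_mono hθ ora fun D _ hD => ?_) hmark
  by_contra! hc
  refine absurd hD (not_lt.mpr ?_)
  -- the product is the exponential of the difference of the two sums
  have hprod : ∏ t : Fin K, ∏ h, F t (pre D t t.2.le) h (D t h) =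
      ∏ t : Fin n, ∏ h : Fin H, Real.exp (m t (pre D t (t.2.le.trans hn)) h / 2 -
        min 1 (featQuad lam θ (pre D t (t.2.le.trans hn)) h
          (pre (D (Fin.castLE hn t) h) h h.2.le))) := by
    have e1 := prod_image (s := univ) (g := Fin.castLE hn)
      (f := fun t : Fin K => ∏ h, F t (pre D t t.2.le) h (D t h))
      ((Fin.castLE_injective hn).injOn)
    have e2 : ∏ t ∈ univ.image (Fin.castLE hn), ∏ h, F t (pre D t t.2.le) h (D t h) =
        ∏ t : Fin K, ∏ h, F t (pre D t t.2.le) h (D t h) := by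
      refine prod_subset (subset_univ _) fun t _ ht => prod_eq_one fun h _ => ?_
      have : ¬ (t : ℕ) < n := fun hlt => ht (mem_image.mpr ⟨⟨t, hlt⟩, mem_univ _, rfl⟩)
      simp [hF, this]
    rw [← e2, e1]
    refine prod_congr rfl fun t _ => prod_congr rfl fun h _ => ?_
    simp only [hF]
    exact if_pos t.2
  rw [hprod] at hc
  simp_rw [← Real.exp_sum] at hc
  have hlog := (Real.lt_log_iff_exp_lt (by positivity)).mpr hc
  simp_rw [sum_sub_distrib, ← sum_div] at hlog
  have hpot : ∑ t : Fin n, ∑ h : Fin H, min 1 (featQuad lam θ (pre D t (t.2.le.trans hn)) h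
      (pre (D (Fin.castLE hn t) h) h h.2.le)) ≤
      H * (2 * (r * Real.log (1 + n * (S.QA : ℝ) ^ 2 / lam))) := by
    rw [sum_comm]
    have e1 : ∀ h : Fin H, ∑ t : Fin n, min 1 (featQuad lam θ (pre D t (t.2.le.trans hn)) h
      (pre (D (Fin.castLE hn t) h) h h.2.le)) ≤
      2 * (r * Real.log (1 + n * (S.QA : ℝ) ^ 2 / lam)) := fun h => by
      have e2 := sum_min_quadInv_le hlam
        (fun t : Fin n => θ.ψbar (pre (D (Fin.castLE hn t) h) h h.2.le))
        (rank_ψbar_le θ hθ hr h.2.le _) (B := (S.QA : ℝ) ^ 2) fun t => by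
          have e3 := hθ.sum_abs_ψbar_le h.2.le (pre (D (Fin.castLE hn t) h) h h.2.le)
          have e4 := sum_sq_le_sq_sum_of_nonneg (s := univ)
            (f := fun l => |θ.ψbar (pre (D (Fin.castLE hn t) h) h h.2.le) l|)
            fun i _ => abs_nonneg _
          refine le_trans (le_trans (le_of_eq ?_) e4)
            (pow_le_pow_left₀ (sum_nonneg fun _ _ => abs_nonneg _) e3 2)
          exact sum_congr rfl fun l _ => by rw [sq_abs, sq]
      refine le_trans (le_of_eq (sum_congr rfl fun t _ => ?_)) e2
      rw [featQuad_fin]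
      rfl
    have := sum_le_card_nsmul univ _ _ fun h _ => e1 h
    simpa using this
  have hval : ∀ t : Fin n, expPotential lam θ (ora.pol t (pre D t (t.2.le.trans hn)))
      (pre D t (t.2.le.trans hn)) = ∑ h : Fin H, m t (pre D t (t.2.le.trans hn)) h := fun t => by
    rw [expPotential, PSR.value_sum]
    exact sum_congr rfl fun h _ => PSR.value_pre hθ _ h.2.le fun s =>
      min 1 (featQuad lam θ (pre D t (t.2.le.trans hn)) h s)
  simp_rw [hval]
  linarith

end Stream

end PSRUCB

end

noncomputable section

namespace PSRUCB

open Finset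

/-! ### Affinity and total variation -/

/-- Cauchy-Schwarz for p - q = (√p - √q)(√p + √q) gives (2 - 2a)(2 + 2a) with a the affinity, and a
≤ 1. -/
lemma sq_sum_abs_sub_le {X : Type*} [Fintype X] (μ p q : X → ℝ) (hμ : ∀ x, 0 ≤ μ x)
    (hp : ∀ x, 0 ≤ p x) (hq : ∀ x, 0 ≤ q x) (hp1 : ∑ x, μ x * p x = 1)
    (hq1 : ∑ x, μ x * q x = 1) :
    (∑ x, μ x * |p x - q x|) ^ 2 ≤ 8 * (1 - ∑ x, μ x * √(p x * q x)) := by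
  set a := ∑ x, μ x * √(p x * q x) with ha
  have h1 : ∑ x, μ x * (√(p x) - √(q x)) ^ 2 = 2 - 2 * a := by
    have : ∀ x, μ x * (√(p x) - √(q x)) ^ 2 =
        μ x * p x + μ x * q x - 2 * (μ x * √(p x * q x)) := fun x => by
      rw [Real.sqrt_mul (hp x), sub_sq, Real.sq_sqrt (hp x), Real.sq_sqrt (hq x)]; ring
    rw [sum_congr rfl fun x _ => this x, sum_sub_distrib, sum_add_distrib, hp1, hq1, ← mul_sum]
    ring
  have h2 : ∑ x, μ x * (√(p x) + √(q x)) ^ 2 = 2 + 2 * a := by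
    have : ∀ x, μ x * (√(p x) + √(q x)) ^ 2 =
        μ x * p x + μ x * q x + 2 * (μ x * √(p x * q x)) := fun x => by
      rw [Real.sqrt_mul (hp x), add_sq, Real.sq_sqrt (hp x), Real.sq_sqrt (hq x)]; ring
    rw [sum_congr rfl fun x _ => this x, sum_add_distrib, sum_add_distrib, hp1, hq1, ← mul_sum]
    ring
  have h3 := sum_mul_sq_le_sq_mul_sq univ (fun x => √(μ x) * |√(p x) - √(q x)|)
    fun x => √(μ x) * (√(p x) + √(q x))
  have e0 : ∀ x, √(μ x) * |√(p x) - √(q x)| * (√(μ x) * (√(p x) + √(q x))) =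
      μ x * |p x - q x| := fun x => by
    have : p x - q x = (√(p x) - √(q x)) * (√(p x) + √(q x)) := by
      nth_rewrite 1 [← Real.sq_sqrt (hp x), ← Real.sq_sqrt (hq x)]
      ring
    rw [this, abs_mul, abs_of_nonneg (by positivity : 0 ≤ √(p x) + √(q x))]
    nth_rewrite 3 [← Real.mul_self_sqrt (hμ x)]
    ring
  simp only [e0, mul_pow, sq_abs, Real.sq_sqrt (hμ _)] at h3
  rw [h1, h2] at h3
  have h4 : 0 ≤ 2 - 2 * a := h1 ▸ sum_nonneg fun x _ => mul_nonneg (hμ x) (sq_nonneg _)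
  nlinarith

/-! ### Affinities and likelihood products for exploratory continuations -/

section Likelihood

variable {O A : Type} {H : ℕ} {S : CoreTests O A H} [Fintype O] [Fintype A] [Nonempty A]
  [DecidableEq A]

/-- The uniform policy. -/
def Policy.uniform (O A : Type) [Fintype A] [Nonempty A] : Policy O A where
  act _ _ _ _ := (Fintype.card A : ℝ)⁻¹
  nonneg _ _ _ _ := inv_nonneg.mpr (Nat.cast_nonneg _)
  sum_one _ _ _ := by
    rw [sum_const, card_univ, nsmul_eq_mul, mul_inv_cancel₀]
    exact_mod_cast Fintype.card_ne_zero

lemma Policy.uniform_weight_pos {n : ℕ} (τ : Fin n → O × A) :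
    0 < (Policy.uniform O A).weight τ :=
  prod_pos fun _ _ => inv_pos.mpr (by exact_mod_cast Fintype.card_pos)

variable (S) in
/-- The probability that the exploration phase plays the actions of `τ` from level `h` on. -/
def exploreWeight (h : ℕ) (τ : Fin H → O × A) : ℝ :=
  if actsFrom h τ ∈ S.exploration h then ((S.exploration h).card : ℝ)⁻¹ else 0

lemma exploreWeight_nonneg (h : ℕ) (τ : Fin H → O × A) : 0 ≤ exploreWeight S h τ := by
  unfold exploreWeight
  split_ifs
  exacts [inv_nonneg.mpr (Nat.cast_nonneg _), le_rfl]

lemma exploreLaw_eq_mul (θ : PSR S) (π : Policy O A) (h : Fin H) (τ : Fin H → O × A) :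
    exploreLaw θ π h τ = θ.prob τ * (π.weight (pre τ h h.2.le) * exploreWeight S h τ) := rfl

lemma exploreWeight_eq (π : Policy O A) (h : Fin H) (τ : Fin H → O × A) :
    π.weight (pre τ h h.2.le) * exploreWeight S h τ = ((S.exploration h).card : ℝ)⁻¹ *
      ∑ l ∈ S.exploration h, (π.switch h l).weight τ := by
  have : ∀ l ∈ S.exploration h, (π.switch h l).weight τ =
      π.weight (pre τ h h.2.le) * ind (actsFrom h τ = l) := fun l hl =>
    π.switch_weight h.2.le l (S.length_of_mem_exploration h.2 hl) τ
  rw [sum_congr rfl this, ← mul_sum]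
  have h2 : ∑ l ∈ S.exploration h, ind (actsFrom h τ = l) =
      if actsFrom h τ ∈ S.exploration h then 1 else 0 := by
    split_ifs with hm
    · rw [sum_eq_single_of_mem _ hm fun l _ hl => ind_false fun h' => hl h'.symm, ind_true rfl]
    · exact sum_eq_zero fun l hl => ind_false fun h' => hm (h' ▸ hl)
  rw [h2, exploreWeight]
  split_ifs <;> ring

variable (S) in
/-- The mass that `f` gives to the exploratory continuations of `s`. -/
def exploreMass {h : ℕ} (hh : h ≤ H) (f : (Fin H → O × A) → ℝ) (s : Fin h → O × A) : ℝ :=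
  ∑ τ, ind (pre τ h hh = s) * exploreWeight S h τ * f τ

lemma exploreMass_mono {h : ℕ} (hh : h ≤ H) {f g : (Fin H → O × A) → ℝ} (hfg : ∀ τ, f τ ≤ g τ)
    (s : Fin h → O × A) : exploreMass S hh f s ≤ exploreMass S hh g s :=
  sum_le_sum fun τ _ => mul_le_mul_of_nonneg_left (hfg τ)
    (mul_nonneg (ind_nonneg _) (exploreWeight_nonneg _ _))

lemma exploreMass_nonneg {h : ℕ} (hh : h ≤ H) {f : (Fin H → O × A) → ℝ} (hf : ∀ τ, 0 ≤ f τ)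
    (s : Fin h → O × A) : 0 ≤ exploreMass S hh f s :=
  sum_nonneg fun τ _ => mul_nonneg (mul_nonneg (ind_nonneg _) (exploreWeight_nonneg _ _)) (hf τ)

lemma sum_pre_eq {h : ℕ} (hh : h ≤ H) (G : (Fin h → O × A) → ℝ) (g : (Fin H → O × A) → ℝ) :
    ∑ τ, G (pre τ h hh) * (exploreWeight S h τ * g τ) = ∑ s, G s * exploreMass S hh g s := by
  classical
  simp_rw [exploreMass, mul_sum]
  rw [sum_comm]
  refine sum_congr rfl fun τ _ => ?_
  rw [sum_eq_single (pre τ h hh)]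
  · rw [ind_true rfl]; ring
  · intro s _ hs; rw [ind_false hs.symm]; ring
  · simp

/-- Compare the collected marginals under the uniform policy, whose positive weights can be
cancelled. -/
lemma exploreMass_prob {θ : PSR S} (hθ : θ.IsPSR) (h : Fin H) (s : Fin h → O × A) :
    exploreMass S h.2.le θ.prob s = θ.prob s := by
  classical
  have h1 := sum_exploreLaw_mul_pre hθ (Policy.uniform O A) h fun s' => ind (s' = s)
  have h2 : ∀ τ, exploreLaw θ (Policy.uniform O A) h τ * ind (pre τ h h.2.le = s) =
      ((Policy.uniform O A).weight (pre τ h h.2.le) * ind (pre τ h h.2.le = s)) *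
        (exploreWeight S h τ * θ.prob τ) := fun τ => by
    rw [exploreLaw_eq_mul]; ring
  rw [sum_congr rfl fun τ _ => h2 τ,
    sum_pre_eq h.2.le (fun s' => (Policy.uniform O A).weight s' * ind (s' = s)) fun τ => θ.prob τ,
    sum_eq_single s, sum_eq_single s, ind_true rfl, PSR.law] at h1
  · have := (Policy.uniform_weight_pos (O := O) s).ne'
    have h3 : (Policy.uniform O A).weight s * exploreMass S h.2.le (fun τ => θ.prob τ) s =
      (Policy.uniform O A).weight s * θ.prob s := by linarith
    exact mul_left_cancel₀ this h3
  · intro s' _ hs; rw [ind_false hs, mul_zero]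
  · simp
  · intro s' _ hs; rw [ind_false hs]; ring
  · simp

/-- The exploration weight averages the weights of switched policies, and optimism bounds the excess
of f for each of them. -/
lemma sum_exploreMass_sub_le {θ : PSR S} (hθ : θ.IsPSR) {f : (Fin H → O × A) → ℝ} {ε : ℝ}
    (hf : ∀ π : Policy O A, IsOptimistic ε (fun τ : Fin H → O × A => θ.law π τ)
      (fun τ => f τ * π.weight τ)) (π : Policy O A) (h : Fin H) :
    ∑ s, π.weight s * (exploreMass S h.2.le f s - θ.prob s) ≤ ε := by
  have h0 : (0 : ℝ) < (S.exploration h).card := by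
    exact_mod_cast card_pos.mpr (hθ.exploration_nonempty h.2.le)
  have e : ∀ s : Fin h → O × A, exploreMass S h.2.le f s - θ.prob s =
      exploreMass S h.2.le (fun τ => f τ - θ.prob τ) s := fun s => by
    rw [← exploreMass_prob hθ, exploreMass, exploreMass, exploreMass, ← sum_sub_distrib]
    exact sum_congr rfl fun τ _ => by ring
  simp_rw [e]
  rw [← sum_pre_eq]
  have e2 : ∀ τ : Fin H → O × A, π.weight (pre τ h h.2.le) *
      (exploreWeight S h τ * (f τ - θ.prob τ)) = ((S.exploration h).card : ℝ)⁻¹ *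
      ∑ l ∈ S.exploration h, (f τ * (π.switch h l).weight τ - θ.law (π.switch h l) τ) :=
    fun τ => by
      rw [← mul_assoc, exploreWeight_eq, mul_assoc, sum_mul]
      congr 1
      exact sum_congr rfl fun l _ => by rw [PSR.law]; ring
  rw [sum_congr rfl fun τ _ => e2 τ, ← mul_sum, sum_comm, inv_mul_le_iff₀ h0, ← nsmul_eq_mul]
  refine sum_le_card_nsmul _ _ _ fun l _ => le_trans (sum_le_sum fun τ _ => ?_)
    (hf (π.switch h l)).2
  rw [abs_sub_comm]
  exact le_abs_self _

lemma le_of_isOptimistic {θ : PSR S} {f : (Fin H → O × A) → ℝ} {ε : ℝ}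
    (hf : ∀ π : Policy O A, IsOptimistic ε (fun τ : Fin H → O × A => θ.law π τ)
      (fun τ => f τ * π.weight τ)) (τ : Fin H → O × A) : θ.prob τ ≤ f τ :=
  le_of_mul_le_mul_right ((hf (Policy.uniform O A)).1 τ) (Policy.uniform_weight_pos τ)

variable (S) in
/-- The affinity of the laws that `f` and `g` give to the exploratory continuations of `s`. -/
def affinity {h : ℕ} (hh : h ≤ H) (f g : (Fin H → O × A) → ℝ) (s : Fin h → O × A) : ℝ :=
  exploreMass S hh (fun τ => √(f τ * g τ)) s / √(exploreMass S hh f s * exploreMass S hh g s)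

lemma exploreMass_sqrt_le {h : ℕ} (hh : h ≤ H) {f g : (Fin H → O × A) → ℝ} (hf : ∀ τ, 0 ≤ f τ)
    (hg : ∀ τ, 0 ≤ g τ) (s : Fin h → O × A) : exploreMass S hh (fun τ => √(f τ * g τ)) s ≤
      √(exploreMass S hh f s * exploreMass S hh g s) := by
  refine Real.le_sqrt_of_sq_le ?_
  have h0 : ∀ τ, 0 ≤ ind (pre τ h hh = s) * exploreWeight S h τ := fun τ =>
    mul_nonneg (ind_nonneg _) (exploreWeight_nonneg _ _)
  have h1 := sum_mul_sq_le_sq_mul_sq univ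
    (fun τ => √(ind (pre τ h hh = s) * exploreWeight S h τ * f τ))
    (fun τ => √(ind (pre τ h hh = s) * exploreWeight S h τ * g τ))
  simp only [Real.sq_sqrt (mul_nonneg (h0 _) (hf _)),
    Real.sq_sqrt (mul_nonneg (h0 _) (hg _))] at h1
  refine le_trans (le_of_eq ?_) h1
  congr 1
  refine sum_congr rfl fun τ _ => ?_
  beta_reduce
  have h2 := Real.mul_self_sqrt (h0 τ)
  rw [Real.sqrt_mul (h0 τ), Real.sqrt_mul (h0 τ), Real.sqrt_mul (hf τ)]
  linear_combination √(f τ) * √(g τ) * h2.symm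

lemma affinity_le_one {h : ℕ} (hh : h ≤ H) {f g : (Fin H → O × A) → ℝ} (hf : ∀ τ, 0 ≤ f τ)
    (hg : ∀ τ, 0 ≤ g τ) (s : Fin h → O × A) : affinity S hh f g s ≤ 1 :=
  div_le_one_of_le₀ (exploreMass_sqrt_le hh hf hg s) (Real.sqrt_nonneg _)

/-- From x exp(1 - x) ≤ 1 with x the affinity, followed by the inequality of means. The exponential
plays the role of the inverse affinity, without any trouble when the affinity is zero. -/
lemma exploreMass_sqrt_mul_exp_le {h : ℕ} (hh : h ≤ H) {f g : (Fin H → O × A) → ℝ}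
    (hf : ∀ τ, 0 ≤ f τ) (hg : ∀ τ, 0 ≤ g τ) (s : Fin h → O × A) :
    exploreMass S hh (fun τ => √(f τ * g τ)) s * Real.exp (1 - affinity S hh f g s) ≤
      (exploreMass S hh f s + exploreMass S hh g s) / 2 := by
  have hF := exploreMass_nonneg (S := S) hh hf s
  have hG := exploreMass_nonneg (S := S) hh hg s
  have h1 := exploreMass_sqrt_le (S := S) hh hf hg s
  have h2 : √(exploreMass S hh f s * exploreMass S hh g s) ≤
      (exploreMass S hh f s + exploreMass S hh g s) / 2 := by
    rw [Real.sqrt_le_left (by positivity)]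
    nlinarith [sq_nonneg (exploreMass S hh f s - exploreMass S hh g s)]
  refine le_trans ?_ h2
  unfold affinity
  set Z := exploreMass S hh (fun τ => √(f τ * g τ)) s with hZ
  set W := √(exploreMass S hh f s * exploreMass S hh g s) with hW
  have hZ0 : 0 ≤ Z := exploreMass_nonneg hh (fun τ => Real.sqrt_nonneg _) s
  rcases (Real.sqrt_nonneg _ : 0 ≤ W).eq_or_lt with h0 | h0
  · have : Z = 0 := le_antisymm (h0 ▸ h1) hZ0
    rw [this, zero_mul]; exact h0.le
  · have h3 := Real.add_one_le_exp (Z / W - 1)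
    have h4 : Z / W * Real.exp (1 - Z / W) ≤ 1 := by
      calc _ ≤ Real.exp (Z / W - 1) * Real.exp (1 - Z / W) :=
            mul_le_mul_of_nonneg_right (by linarith) (Real.exp_pos _).le
        _ = 1 := by rw [← Real.exp_add]; simp
    calc Z * Real.exp (1 - Z / W) = W * (Z / W * Real.exp (1 - Z / W)) := by
          rw [← mul_assoc, mul_div_cancel₀ _ (ne_of_gt (h0 : 0 < W))]
      _ ≤ W := mul_le_of_le_one_right h0.le h4

/-- The square root of the likelihood ratio of a trajectory, over the affinity of the laws of
its exploratory part. -/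
def likFactor (θ : PSR S) (f : (Fin H → O × A) → ℝ) (h : Fin H) (τ : Fin H → O × A) : ℝ :=
  √(f τ / θ.prob τ) * Real.exp (1 - affinity S h.2.le f θ.prob (pre τ h h.2.le))

lemma likFactor_nonneg (θ : PSR S) (f : (Fin H → O × A) → ℝ) (h : Fin H) (τ : Fin H → O × A) :
    0 ≤ likFactor θ f h τ := mul_nonneg (Real.sqrt_nonneg _) (Real.exp_pos _).le

/-- After conditioning on the history the factor averages to at most the mean of the masses of f and
θ; these sum to at most 1 + ε and to 1. -/
lemma sum_exploreLaw_likFactor_le {θ θ' : PSR S} (hθ : θ.IsPSR) (hθ' : θ'.IsPSR)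
    {f : (Fin H → O × A) → ℝ} {ε : ℝ}
    (hf : ∀ π : Policy O A, IsOptimistic ε (fun τ : Fin H → O × A => θ'.law π τ)
      (fun τ => f τ * π.weight τ)) (π : Policy O A) (h : Fin H) :
    ∑ τ, exploreLaw θ π h τ * likFactor θ f h τ ≤ 1 + ε / 2 := by
  have hP : ∀ τ : Fin H → O × A, 0 ≤ θ.prob τ := hθ.prob_nonneg le_rfl
  have hf0 : ∀ τ : Fin H → O × A, 0 ≤ f τ := fun τ =>
    (hθ'.prob_nonneg le_rfl τ).trans (le_of_isOptimistic hf τ)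
  have e : ∀ τ, exploreLaw θ π h τ * likFactor θ f h τ = (π.weight (pre τ h h.2.le) *
      Real.exp (1 - affinity S h.2.le f θ.prob (pre τ h h.2.le))) *
      (exploreWeight S h τ * √(f τ * θ.prob τ)) := fun τ => by
    have : θ.prob τ * √(f τ / θ.prob τ) = √(f τ * θ.prob τ) := by
      rcases (hP τ).eq_or_lt with h0 | h0
      · rw [← h0]; simp
      · nth_rewrite 1 [← Real.sqrt_sq h0.le]
        rw [← Real.sqrt_mul (sq_nonneg _)]
        congr 1; field_simp
    rw [exploreLaw_eq_mul, likFactor, ← this]; ring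
  rw [sum_congr rfl fun τ _ => e τ, sum_pre_eq h.2.le (fun s => π.weight s *
    Real.exp (1 - affinity S h.2.le f θ.prob s)) fun τ => √(f τ * θ.prob τ)]
  have h1 : ∀ s : Fin h → O × A, π.weight s * Real.exp (1 - affinity S h.2.le f θ.prob s) *
      exploreMass S h.2.le (fun τ => √(f τ * θ.prob τ)) s ≤
      (π.weight s * (exploreMass S h.2.le f s - θ'.prob s) + θ'.law π s + θ.law π s) / 2 :=
    fun s => by
      have h2 := mul_le_mul_of_nonneg_left (exploreMass_sqrt_mul_exp_le (S := S) h.2.le hf0 hP s)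
        (π.weight_nonneg s)
      rw [exploreMass_prob hθ] at h2
      simp only [PSR.law]
      linarith
  refine (sum_le_sum fun s _ => h1 s).trans ?_
  rw [← sum_div, sum_add_distrib, sum_add_distrib, hθ.sum_law _ h.2.le, hθ'.sum_law _ h.2.le]
  have := sum_exploreMass_sub_le hθ' hf π h
  linarith

lemma prod_if_lt_stream {K n : ℕ} (hn : n ≤ K) (G : StreamFun O A H) (D : Fin K → Batch O A H) :
    ∏ t : Fin K, ∏ h, (if (t : ℕ) < n then G t (pre D t t.2.le) h (D t h) else 1) =
      ∏ t : Fin n, ∏ h, G t (pre D t (t.2.le.trans hn)) h (D (Fin.castLE hn t) h) := by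
  classical
  have e1 := prod_image (s := univ) (g := Fin.castLE hn)
    (f := fun t : Fin K => ∏ h, (if (t : ℕ) < n then G t (pre D t t.2.le) h (D t h) else 1))
    ((Fin.castLE_injective hn).injOn)
  rw [← prod_subset (subset_univ (univ.image (Fin.castLE hn))) fun t _ ht =>
    prod_eq_one fun h _ => ?_, e1]
  · exact prod_congr rfl fun t _ => prod_congr rfl fun h _ => if_pos t.2
  · exact if_neg fun hlt => ht (mem_image.mpr ⟨⟨t, hlt⟩, mem_univ _, rfl⟩)

/-- Markov's inequality, with (1 + ε/2) to the power KH below exp(KHε/2). -/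
lemma streamPr_likFactor_le {θ θ' : PSR S} (hθ : θ.IsPSR) (hθ' : θ'.IsPSR)
    {f : (Fin H → O × A) → ℝ} {ε : ℝ} (hε : 0 ≤ ε)
    (hf : ∀ π : Policy O A, IsOptimistic ε (fun τ : Fin H → O × A => θ'.law π τ)
      (fun τ => f τ * π.weight τ)) (ora : Oracle S) {K n : ℕ} (hn : n ≤ K) {C : ℝ} (hC : 0 < C) :
    streamPr ora θ K (fun D => C ≤ ∏ t : Fin n, ∏ h : Fin H,
      likFactor θ f h (D (Fin.castLE hn t) h)) ≤ Real.exp (K * H * ε / 2) / C := by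
  have h1 := streamPr_le_of_prod hθ ora (fun t _ h τ => if t < n then likFactor θ f h τ else 1)
    (fun t D h τ => by split_ifs; exacts [likFactor_nonneg _ _ _ _, zero_le_one])
    (fun _ _ => 1 + ε / 2) (fun t D h => by
      split_ifs
      · exact sum_exploreLaw_likFactor_le hθ hθ' hf _ h
      · simp only [mul_one]
        rw [sum_exploreLaw hθ]; linarith) (K := K) (a := C)
      (b := Real.exp (K * H * ε / 2) / C) hC (by
        rw [mul_div_cancel₀ _ hC.ne']
        simp only [prod_const, card_univ, Fintype.card_fin]
        rw [← pow_mul]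
        calc _ ≤ Real.exp (ε / 2) ^ (H * K) := by
              refine pow_le_pow_left₀ (by positivity) ?_ _
              have := Real.add_one_le_exp (ε / 2)
              linarith
          _ = _ := by
              rw [← Real.exp_nat_mul]
              congr 1; push_cast; ring)
  refine le_trans (streamPr_mono hθ ora fun D _ hD => ?_) h1
  rwa [prod_if_lt_stream hn fun _ _ h τ => likFactor θ f h τ]

/-! ### Maximum likelihood -/

lemma logLik_eq {θ : PSR S} (hθ : θ.IsPSR) (ora : Oracle S) {n : ℕ} (D : Fin n → Batch O A H) :
    logLik ora D θ = ENNReal.log (ENNReal.ofReal (streamProb ora θ D)) := by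
  have hs : ∀ {ι : Type} (s : Finset ι) (g : ι → ENNReal),
      ∑ i ∈ s, ENNReal.log (g i) = ENNReal.log (∏ i ∈ s, g i) := fun s g => by
    classical
    induction s using Finset.induction_on with
    | empty => simp
    | insert i s hi ih => rw [sum_insert hi, prod_insert hi, ENNReal.log_mul_add, ih]
  rw [logLik, streamProb]
  simp_rw [hs]
  rw [ENNReal.ofReal_prod_of_nonneg fun t _ => prod_nonneg fun h _ => exploreLaw_nonneg hθ _ _ _]
  congr 1
  refine prod_congr rfl fun t _ => ?_
  rw [ENNReal.ofReal_prod_of_nonneg fun h _ => exploreLaw_nonneg hθ _ _ _]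

lemma logLik_le_add_iff {θ θ' : PSR S} (hθ : θ.IsPSR) (hθ' : θ'.IsPSR) (ora : Oracle S) {n : ℕ}
    (D : Fin n → Batch O A H) (hD : 0 < streamProb ora θ' D) (β : ℝ) :
    logLik ora D θ ≤ logLik ora D θ' + (β : EReal) ↔
      streamProb ora θ D ≤ streamProb ora θ' D * Real.exp β := by
  have h1 : (β : EReal) = ENNReal.log (ENNReal.ofReal (Real.exp β)) := by
    rw [ENNReal.log_ofReal_of_pos (Real.exp_pos β), Real.log_exp]
  rw [logLik_eq hθ, logLik_eq hθ', h1, ← ENNReal.log_mul_add, ENNReal.log_le_log_iff,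
    ← ENNReal.ofReal_mul hD.le, ENNReal.ofReal_le_ofReal_iff (by positivity)]

lemma exploreLaw_pos_of_streamProb {θ : PSR S} (hθ : θ.IsPSR) {ora : Oracle S} {n : ℕ}
    {D : Fin n → Batch O A H} (hD : 0 < streamProb ora θ D) (t : Fin n) (h : Fin H) :
    0 < exploreLaw θ (ora.polAt D t) h (D t h) := by
  refine (exploreLaw_nonneg hθ _ _ _).lt_of_ne fun h0 => hD.ne' ?_
  exact prod_eq_zero (mem_univ t) (prod_eq_zero (mem_univ h) h0.symm)

lemma streamProb_pre_pos {θ : PSR S} (hθ : θ.IsPSR) {ora : Oracle S} {K n : ℕ} (hn : n ≤ K)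
    {D : Fin K → Batch O A H} (hD : 0 < streamProb ora θ D) :
    0 < streamProb ora θ (pre D n hn) :=
  prod_pos fun t _ => prod_pos fun h _ => exploreLaw_pos_of_streamProb hθ hD (Fin.castLE hn t) h

lemma prob_pos_of_streamProb {θ : PSR S} (hθ : θ.IsPSR) {ora : Oracle S} {n : ℕ}
    {D : Fin n → Batch O A H} (hD : 0 < streamProb ora θ D) (t : Fin n) (h : Fin H) :
    0 < θ.prob (D t h) := by
  refine (hθ.prob_nonneg le_rfl _).lt_of_ne fun h0 => ?_
  have := exploreLaw_pos_of_streamProb hθ hD t h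
  rw [exploreLaw_eq_mul, ← h0, zero_mul] at this
  exact lt_irrefl _ this

/-- The probabilities of the actions cancel in the likelihood ratio, although the policies depend on
the data; passing from θ' to its envelope f only increases it. -/
lemma sqrt_mul_exp_le_prod_likFactor {θ θ' : PSR S} (hθ : θ.IsPSR) (hθ' : θ'.IsPSR)
    {f : (Fin H → O × A) → ℝ} (hf : ∀ τ : Fin H → O × A, θ'.prob τ ≤ f τ) (ora : Oracle S) {n : ℕ}
    {D : Fin n → Batch O A H} (hD : 0 < streamProb ora θ D) :
    √(streamProb ora θ' D / streamProb ora θ D) * Real.exp (∑ t, ∑ h : Fin H,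
      (1 - affinity S h.2.le f θ.prob (pre (D t h) h h.2.le))) ≤
      ∏ t, ∏ h, likFactor θ f h (D t h) := by
  have e1 : streamProb ora θ' D / streamProb ora θ D =
      ∏ t, ∏ h : Fin H, θ'.prob (D t h) / θ.prob (D t h) := by
    simp only [streamProb, ← prod_div_distrib]
    refine prod_congr rfl fun t _ => prod_congr rfl fun h _ => ?_
    have h1 := exploreLaw_pos_of_streamProb hθ hD t h
    rw [exploreLaw_eq_mul] at h1 ⊢
    rw [exploreLaw_eq_mul, mul_div_mul_right _ _ (right_ne_zero_of_mul h1.ne')]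
  have h0 : ∀ t h, 0 ≤ θ'.prob (D t h) / θ.prob (D t h) := fun t h =>
    div_nonneg (hθ'.prob_nonneg le_rfl _) (hθ.prob_nonneg le_rfl _)
  rw [e1, Real.sqrt_prod _ fun t _ => prod_nonneg fun h _ => h0 t h, Real.exp_sum,
    ← prod_mul_distrib]
  refine prod_le_prod (fun t _ => by positivity) fun t _ => ?_
  rw [Real.sqrt_prod _ fun h _ => h0 t h, Real.exp_sum, ← prod_mul_distrib]
  refine prod_le_prod (fun t _ => by positivity) fun h _ => ?_
  refine mul_le_mul_of_nonneg_right (Real.sqrt_le_sqrt ?_) (Real.exp_pos _).le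
  exact div_le_div_of_nonneg_right (hf _) (hθ.prob_nonneg le_rfl _)

/-- Insert the normalised envelope f/F. Its distance to the true conditional law is bounded by the
affinity, and that to θ' by 2ε/q: the history has probability at least q under θ', so an excess mass
of ε becomes at most ε/q after conditioning. -/
lemma condTV_sq_le {θ θ' : PSR S} (hθ : θ.IsPSR) (hθ' : θ'.IsPSR) {f : (Fin H → O × A) → ℝ}
    {ε q : ℝ} (hf : ∀ π : Policy O A, IsOptimistic ε (fun τ : Fin H → O × A => θ'.law π τ)
      (fun τ => f τ * π.weight τ)) (hq : 0 < q) (h : Fin H) {s : Fin h → O × A}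
    (hs : 0 < θ.prob s) (π : Policy O A) (hs' : q ≤ θ'.law π s) :
    condTV θ' θ h.2.le s ^ 2 ≤
      16 * (1 - affinity S h.2.le f θ.prob s) + 8 * (ε / q) ^ 2 := by
  have hfP := le_of_isOptimistic hf
  have hP : ∀ τ : Fin H → O × A, 0 ≤ θ.prob τ := hθ.prob_nonneg le_rfl
  have hP' : ∀ τ : Fin H → O × A, 0 ≤ θ'.prob τ := hθ'.prob_nonneg le_rfl
  have hf0 : ∀ τ : Fin H → O × A, 0 ≤ f τ := fun τ => (hP' τ).trans (hfP τ)
  have hw : 0 < π.weight s := by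
    refine (π.weight_nonneg s).lt_of_ne fun h0 => ?_
    rw [PSR.law, ← h0, mul_zero] at hs'
    exact absurd hq (not_lt.mpr hs')
  have hs'0 : 0 < θ'.prob s :=
    pos_of_mul_pos_left (hq.trans_le hs') hw.le
  set F := exploreMass S h.2.le f s with hF
  have hF' : θ'.prob s ≤ F := by
    rw [← exploreMass_prob hθ']; exact exploreMass_mono h.2.le hfP s
  have hF0 : 0 < F := hs'0.trans_le hF'
  set μ : (Fin H → O × A) → ℝ := fun τ => ind (pre τ h h.2.le = s) * exploreWeight S h τ with hμ
  have hμ0 : ∀ τ, 0 ≤ μ τ := fun τ => mul_nonneg (ind_nonneg _) (exploreWeight_nonneg _ _)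
  have hμf : ∑ τ, μ τ * f τ = F := rfl
  have hμP : ∑ τ, μ τ * θ.prob τ = θ.prob s := exploreMass_prob hθ h s
  have hμP' : ∑ τ, μ τ * θ'.prob τ = θ'.prob s := exploreMass_prob hθ' h s
  have e1 : condTV θ' θ h.2.le s =
      ∑ τ, μ τ * |θ'.prob τ / θ'.prob s - θ.prob τ / θ.prob s| := by
    rw [condTV, condDist, sum_div]
    refine sum_congr rfl fun τ _ => ?_
    simp only [hμ, exploreWeight, ind_and]
    by_cases h1 : actsFrom h τ ∈ S.exploration h
    · rw [if_pos h1, ind_true h1]; ring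
    · rw [if_neg h1, ind_false h1]; ring
  have h1 := sq_sum_abs_sub_le μ (fun τ => f τ / F) (fun τ => θ.prob τ / θ.prob s) hμ0
    (fun τ => div_nonneg (hf0 τ) hF0.le) (fun τ => div_nonneg (hP τ) hs.le)
    (by simp_rw [← mul_div_assoc]; rw [← sum_div, hμf, div_self hF0.ne'])
    (by simp_rw [← mul_div_assoc]; rw [← sum_div, hμP, div_self hs.ne'])
  have e2 : ∑ τ, μ τ * √(f τ / F * (θ.prob τ / θ.prob s)) = affinity S h.2.le f θ.prob s := by
    rw [affinity, exploreMass_prob hθ, exploreMass, sum_div]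
    refine sum_congr rfl fun τ _ => ?_
    rw [div_mul_div_comm, Real.sqrt_div (mul_nonneg (hf0 τ) (hP τ)), mul_div_assoc]
  rw [e2] at h1
  have h2 : ∑ τ, μ τ * |θ'.prob τ / θ'.prob s - f τ / F| ≤ 2 * (ε / q) := by
    have e3 : ∀ τ, μ τ * |θ'.prob τ / θ'.prob s - f τ / F| ≤
        (μ τ * f τ - μ τ * θ'.prob τ) / θ'.prob s +
          μ τ * f τ * ((F - θ'.prob s) / (F * θ'.prob s)) := fun τ => by
      have e4 : θ'.prob τ / θ'.prob s - f τ / F = -((f τ - θ'.prob τ) / θ'.prob s) +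
          f τ * ((F - θ'.prob s) / (F * θ'.prob s)) := by field_simp; ring
      rw [e4]
      refine (mul_le_mul_of_nonneg_left (abs_add_le _ _) (hμ0 τ)).trans (le_of_eq ?_)
      rw [abs_neg, abs_of_nonneg (div_nonneg (sub_nonneg.mpr (hfP τ)) hs'0.le),
        abs_of_nonneg (mul_nonneg (hf0 τ) (div_nonneg (sub_nonneg.mpr hF') (by positivity)))]
      ring
    refine (sum_le_sum fun τ _ => e3 τ).trans ?_
    rw [sum_add_distrib, ← sum_div, ← sum_mul, sum_sub_distrib, hμf, hμP']
    have e5 : π.weight s * (F - θ'.prob s) ≤ ε := by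
      refine le_trans ?_ (sum_exploreMass_sub_le hθ' hf π h)
      refine single_le_sum (f := fun s => π.weight s * (exploreMass S h.2.le f s - θ'.prob s))
        (fun s' _ => mul_nonneg (π.weight_nonneg _) (sub_nonneg.mpr ?_)) (mem_univ s)
      rw [← exploreMass_prob hθ']; exact exploreMass_mono h.2.le hfP s'
    have e6 : (F - θ'.prob s) / θ'.prob s ≤ ε / q := by
      rw [div_le_div_iff₀ hs'0 hq]
      have e7 : (F - θ'.prob s) * q ≤ (F - θ'.prob s) * θ'.law π s :=
        mul_le_mul_of_nonneg_left hs' (sub_nonneg.mpr hF')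
      have e8 := mul_le_mul_of_nonneg_right e5 hs'0.le
      rw [PSR.law] at e7
      linarith
    have e9 : F * ((F - θ'.prob s) / (F * θ'.prob s)) = (F - θ'.prob s) / θ'.prob s := by
      field_simp
    rw [e9]; linarith
  have h3 : condTV θ' θ h.2.le s ≤ ∑ τ, μ τ * |f τ / F - θ.prob τ / θ.prob s| +
      ∑ τ, μ τ * |θ'.prob τ / θ'.prob s - f τ / F| := by
    rw [e1, ← sum_add_distrib]
    refine sum_le_sum fun τ _ => ?_
    rw [← mul_add, add_comm]
    exact mul_le_mul_of_nonneg_left (abs_sub_le _ _ _) (hμ0 τ)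
  have h4 := condTV_nonneg θ' θ h.2.le s
  have h5 : 0 ≤ ∑ τ, μ τ * |θ'.prob τ / θ'.prob s - f τ / F| :=
    sum_nonneg fun τ _ => mul_nonneg (hμ0 τ) (abs_nonneg _)
  set x := ∑ τ, μ τ * |f τ / F - θ.prob τ / θ.prob s| with hx
  set y := ∑ τ, μ τ * |θ'.prob τ / θ'.prob s - f τ / F| with hy
  have h6 : condTV θ' θ h.2.le s ^ 2 ≤ (x + y) ^ 2 := pow_le_pow_left₀ h4 h3 2
  have h7 : y ^ 2 ≤ (2 * (ε / q)) ^ 2 := pow_le_pow_left₀ h5 h2 2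
  nlinarith [sq_nonneg (x - y)]

/-- The models of `Θ` have optimistic envelopes for which the likelihood products are small. -/
def LikGood (Θ : Set (PSR S)) (ε C : ℝ) (θ : PSR S) {n : ℕ} (D : Fin n → Batch O A H) : Prop :=
  ∀ θ' ∈ Θ, ∃ f : (Fin H → O × A) → ℝ,
    (∀ π : Policy O A, IsOptimistic ε (fun τ : Fin H → O × A => θ'.law π τ)
      (fun τ => f τ * π.weight τ)) ∧ ∏ t, ∏ h, likFactor θ f h (D t h) < C

/-- A union bound over the elements of the net and the K possible run lengths. -/
lemma streamPr_not_likGood_le {Θ : Set (PSR S)} (hΘ : ∀ θ ∈ Θ, θ.IsPSR) {θ : PSR S} (hθ : θ ∈ Θ)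
    {ε C : ℝ} (hε : 0 ≤ ε) (hC : 0 < C) {N : Finset ((Fin H → O × A) → ℝ)}
    (hN : IsOptimisticNet Θ ε N) (ora : Oracle S) (K : ℕ) :
    streamPr ora θ K (fun D => ∃ (n : ℕ) (hn : n ≤ K), 1 ≤ n ∧ ¬ LikGood Θ ε C θ (pre D n hn)) ≤
      K * N.card * (Real.exp (K * H * ε / 2) / C) := by
  classical
  have key : ∀ i ∈ (univ : Finset (Fin K)) ×ˢ N, streamPr ora θ K (fun D =>
      (∃ θ' ∈ Θ, ∀ π : Policy O A, IsOptimistic ε (fun τ : Fin H → O × A => θ'.law π τ)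
        (fun τ => i.2 τ * π.weight τ)) ∧ C ≤ ∏ t : Fin (i.1 + 1), ∏ h : Fin H,
          likFactor θ i.2 h (D (Fin.castLE i.1.2 t) h)) ≤
      Real.exp (K * H * ε / 2) / C := fun i _ => by
    by_cases h : ∃ θ' ∈ Θ, ∀ π : Policy O A, IsOptimistic ε
        (fun τ : Fin H → O × A => θ'.law π τ) (fun τ => i.2 τ * π.weight τ)
    · obtain ⟨θ', h1, h2⟩ := h
      exact (streamPr_mono (hΘ θ hθ) ora fun D _ hD => hD.2).trans
        (streamPr_likFactor_le (hΘ θ hθ) (hΘ θ' h1) hε h2 ora i.1.2 hC)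
    -- An element of the net that envelops no model gives an empty event.
    · rw [streamPr_eq, sum_eq_zero fun D _ => by rw [ind_false fun hD => h hD.1, mul_zero]]
      positivity
  refine (streamPr_mono (hΘ θ hθ) ora fun D _ hD => ?_).trans
    ((streamPr_exists_le (hΘ θ hθ) ora _ _).trans ((sum_le_card_nsmul _ _ _ key).trans
      (le_of_eq ?_)))
  · obtain ⟨n, hn, h1, h2⟩ := hD
    simp only [LikGood, not_forall, not_exists, not_and, not_lt] at h2
    obtain ⟨θ', h3, h4⟩ := h2
    obtain ⟨f, h5, h6⟩ := hN θ' h3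
    obtain ⟨n, rfl⟩ : ∃ n', n = n' + 1 := ⟨n - 1, by omega⟩
    exact ⟨(⟨n, hn⟩, f), mem_product.mpr ⟨mem_univ _, h5⟩, ⟨θ', h3, h6⟩, h4 f h6⟩
  · rw [nsmul_eq_mul, card_product, card_univ, Fintype.card_fin]
    push_cast; ring

section Confidence

variable {Θ : Set (PSR S)} (hΘ : ∀ θ ∈ Θ, θ.IsPSR) {θ : PSR S} (hθ : θ ∈ Θ) {ε C : ℝ}
  {p : Inputs} (hC : C ^ 2 ≤ Real.exp p.β) (hC0 : 0 < C) {ora : Oracle S} {n : ℕ}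
  {D : Fin n → Batch O A H} (hD : 0 < streamProb ora θ D) (hlik : LikGood Θ ε C θ D)
  (hmin : ∀ (t : Fin n) (h : Fin H), p.pmin ≤ θ.law (ora.polAt D t) (pre (D t h) h h.2.le))
include hΘ hθ hC hC0 hD hlik hmin

/-- The true model is in the confidence set. -/
lemma mem_confSet : θ ∈ confSet Θ p ora D := by
  refine ⟨⟨hθ, hmin⟩, ?_⟩
  refine EReal.sub_le_of_le_add (iSup₂_le fun θ' hθ' => ?_)
  rw [logLik_le_add_iff (hΘ θ' hθ'.1) (hΘ θ hθ) ora D hD]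
  obtain ⟨f, hf, hlt⟩ := hlik θ' hθ'.1
  have h1 := (sqrt_mul_exp_le_prod_likFactor (hΘ θ hθ) (hΘ θ' hθ'.1) (le_of_isOptimistic hf) ora
    hD).trans hlt.le
  have h2 : 0 ≤ ∑ t, ∑ h : Fin H, (1 - affinity S h.2.le f θ.prob (pre (D t h) h h.2.le)) :=
    sum_nonneg fun t _ => sum_nonneg fun h _ => sub_nonneg.mpr (affinity_le_one h.2.le
      (fun τ => ((hΘ θ' hθ'.1).prob_nonneg le_rfl τ).trans (le_of_isOptimistic hf τ))
      ((hΘ θ hθ).prob_nonneg le_rfl) _)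
  -- Affinities are at most 1, so the exponential factor is at least 1 and may be dropped.
  have h3 : √(streamProb ora θ' D / streamProb ora θ D) ≤ C :=
    (le_mul_of_one_le_right (Real.sqrt_nonneg _) (Real.one_le_exp h2)).trans h1
  rw [Real.sqrt_le_left hC0.le, div_le_iff₀ hD] at h3
  calc _ ≤ C ^ 2 * streamProb ora θ D := h3
    _ ≤ Real.exp p.β * streamProb ora θ D := mul_le_mul_of_nonneg_right hC hD.le
    _ = _ := mul_comm _ _

/-- Membership bounds the root of the likelihood ratio below by exp(-β/2), while the likelihood
product stays below exp(β/2). The sum of the affinity deficits is thus at most β, and `condTV_sq_le`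
converts it. -/
lemma dataDist_le_of_mem_confSet (hp : 0 < p.pmin) {θ' : PSR S}
    (hθ' : θ' ∈ confSet Θ p ora D) :
    dataDist θ' θ D ≤ 16 * p.β + n * H * (8 * (ε / p.pmin) ^ 2) := by
  have hP := hΘ θ hθ
  have hP' := hΘ θ' hθ'.1.1
  obtain ⟨f, hf, hlt⟩ := hlik θ' hθ'.1.1
  have h1 := (sqrt_mul_exp_le_prod_likFactor hP hP' (le_of_isOptimistic hf) ora hD).trans hlt.le
  have hsup : logLik ora D θ ≤ logLik ora D θ' + (p.β : EReal) := by
    have h3 : logLik ora D θ ≤ ⨆ θ' ∈ thetaMin Θ p ora D, logLik ora D θ' :=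
      le_iSup₂ (f := fun θ' (_ : θ' ∈ thetaMin Θ p ora D) => logLik ora D θ') θ ⟨hθ, hmin⟩
    have h4 := hθ'.2
    refine h3.trans ?_
    rwa [EReal.sub_le_iff_le_add (Or.inl (EReal.coe_ne_bot _)) (Or.inl (EReal.coe_ne_top _))] at h4
  -- A vanishing likelihood would have logarithm -∞, which is not within β of the finite value at
  -- the truth.
  have hD' : 0 < streamProb ora θ' D := by
    refine (streamProb_nonneg hP' ora D).lt_of_ne fun h0 => ?_
    rw [logLik_eq hP, logLik_eq hP', ← h0] at hsup
    simp only [ENNReal.ofReal_zero, ENNReal.log_zero, EReal.bot_add, le_bot_iff,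
      ENNReal.log_eq_bot_iff, ENNReal.ofReal_eq_zero] at hsup
    exact absurd hD (not_lt.mpr hsup)
  rw [logLik_le_add_iff hP hP' ora D hD'] at hsup
  set X := ∑ t, ∑ h : Fin H, (1 - affinity S h.2.le f θ.prob (pre (D t h) h h.2.le)) with hX
  have h5 : Real.exp (-(p.β / 2)) ≤ √(streamProb ora θ' D / streamProb ora θ D) := by
    refine Real.le_sqrt_of_sq_le ?_
    rw [← Real.exp_nat_mul, le_div_iff₀ hD]
    have : ((2 : ℕ) : ℝ) * -(p.β / 2) = -p.β := by push_cast; ring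
    rw [this, Real.exp_neg, inv_mul_le_iff₀ (Real.exp_pos _), mul_comm]
    exact hsup
  have h6 : Real.exp (-(p.β / 2) + X) ≤ Real.exp (p.β / 2) := by
    rw [Real.exp_add]
    refine (mul_le_mul_of_nonneg_right h5 (Real.exp_pos _).le).trans (h1.trans ?_)
    refine le_of_sq_le_sq ?_ (Real.exp_pos _).le
    rw [← Real.exp_nat_mul]
    have : ((2 : ℕ) : ℝ) * (p.β / 2) = p.β := by push_cast; ring
    rwa [this]
  have h7 : X ≤ p.β := by
    have := Real.exp_le_exp.mp h6
    linarith
  have h8 : ∀ (t : Fin n) (h : Fin H), condTV θ' θ h.2.le (pre (D t h) h h.2.le) ^ 2 ≤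
      16 * (1 - affinity S h.2.le f θ.prob (pre (D t h) h h.2.le)) + 8 * (ε / p.pmin) ^ 2 :=
    fun t h => condTV_sq_le hP hP' hf hp h
      ((prob_pos_of_streamProb hP hD t h).trans_le (hP.prob_le_pre h.2.le le_rfl _))
      (ora.polAt D t) (hθ'.1.2 t h)
  rw [dataDist, sum_comm]
  refine (sum_le_sum fun t _ => sum_le_sum fun h _ => h8 t h).trans ?_
  simp only [sum_add_distrib, ← mul_sum, sum_const, card_univ, Fintype.card_fin, nsmul_eq_mul]
  rw [← hX]
  nlinarith

end Confidence

end Likelihood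

end PSRUCB

end

noncomputable section

namespace PSRUCB

open Finset

/-! ### Optimistic nets -/

section Nets

variable {O A : Type} {H : ℕ} {S : CoreTests O A H} [Fintype O] [Fintype A] [Nonempty A]

lemma Policy.weight_le_one (π : Policy O A) {n : ℕ} (τ : Fin n → O × A) : π.weight τ ≤ 1 := by
  refine prod_le_one (fun t _ => π.nonneg _ _ _ _) fun t _ => ?_
  rw [← π.sum_one t (pre τ t t.2.le) (τ t).1]
  exact single_le_sum (f := fun a => π.act t (pre τ t t.2.le) (τ t).1 a)
    (fun a _ => π.nonneg _ _ _ _) (mem_univ _)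

/-- Round all trajectory probabilities up to multiples of 1/M, with M chosen so that T trajectories
lose at most ε altogether. Existence makes the infimum in `netCard` attained; the size bounds the
growth of β. -/
lemma exists_isOptimisticNet {Θ : Set (PSR S)} (hΘ : ∀ θ ∈ Θ, θ.IsPSR) {ε : ℝ} (hε : 0 < ε) :
    ∃ N : Finset ((Fin H → O × A) → ℝ), IsOptimisticNet Θ ε N ∧
      N.card ≤ (⌈(Fintype.card (Fin H → O × A) : ℝ) / ε⌉₊ + 2) ^
        Fintype.card (Fin H → O × A) := by
  classical
  set T := Fintype.card (Fin H → O × A) with hT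
  set M : ℕ := ⌈(T : ℝ) / ε⌉₊ + 1 with hM
  have hM0 : (0 : ℝ) < M := by positivity
  refine ⟨univ.image fun (g : (Fin H → O × A) → Fin (M + 1)) τ => ((g τ : ℕ) : ℝ) / M, ?_, ?_⟩
  · intro θ hθ
    have hP := hΘ θ hθ
    have hP1 : ∀ τ : Fin H → O × A, θ.prob τ ≤ 1 := fun τ =>
      (hP.prob_le_pre (Nat.zero_le H) le_rfl τ).trans (le_of_eq (hP.prob_zero _))
    have hc : ∀ τ : Fin H → O × A, ⌈θ.prob τ * M⌉₊ < M + 1 := fun τ => by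
      rw [Nat.lt_succ_iff, Nat.ceil_le]
      exact mul_le_of_le_one_left hM0.le (hP1 τ)
    refine ⟨_, mem_image_of_mem _ (mem_univ fun τ : Fin H → O × A =>
      (⟨⌈θ.prob τ * M⌉₊, hc τ⟩ : Fin (M + 1))), fun π => ?_⟩
    have h1 : ∀ τ : Fin H → O × A, θ.prob τ ≤ (⌈θ.prob τ * M⌉₊ : ℝ) / M := fun τ => by
      rw [le_div_iff₀ hM0]; exact Nat.le_ceil _
    have h2 : ∀ τ : Fin H → O × A, (⌈θ.prob τ * M⌉₊ : ℝ) / M - θ.prob τ ≤ 1 / M := fun τ => by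
      rw [sub_le_iff_le_add, div_le_iff₀ hM0, add_mul, one_div, inv_mul_cancel₀ hM0.ne', add_comm]
      exact (Nat.ceil_lt_add_one (mul_nonneg (hP.prob_nonneg le_rfl τ) hM0.le)).le
    refine ⟨fun τ => mul_le_mul_of_nonneg_right (h1 τ) (π.weight_nonneg τ), ?_⟩
    have h3 : ∀ τ : Fin H → O × A,
        |θ.law π τ - (⌈θ.prob τ * M⌉₊ : ℝ) / M * π.weight τ| ≤ 1 / M := fun τ => by
      rw [PSR.law, ← sub_mul, abs_mul, abs_sub_comm, abs_of_nonneg (sub_nonneg.mpr (h1 τ)),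
        abs_of_nonneg (π.weight_nonneg τ)]
      exact (mul_le_of_le_one_right (sub_nonneg.mpr (h1 τ)) (π.weight_le_one τ)).trans (h2 τ)
    refine (sum_le_card_nsmul _ _ _ fun τ _ => h3 τ).trans ?_
    rw [card_univ, ← hT, nsmul_eq_mul, mul_one_div, div_le_iff₀ hM0, mul_comm, ← div_le_iff₀ hε, hM]
    push_cast
    exact (Nat.le_ceil _).trans (by linarith)
  · refine card_image_le.trans (le_of_eq ?_)
    rw [card_univ, Fintype.card_fun, Fintype.card_fin]

lemma exists_card_eq_netCard {Θ : Set (PSR S)} (hΘ : ∀ θ ∈ Θ, θ.IsPSR) {ε : ℝ} (hε : 0 < ε) :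
    ∃ N : Finset ((Fin H → O × A) → ℝ), N.card = netCard Θ ε ∧ IsOptimisticNet Θ ε N := by
  obtain ⟨N, hN, _⟩ := exists_isOptimisticNet hΘ hε
  exact Nat.sInf_mem (s := {n | ∃ N : Finset ((Fin H → O × A) → ℝ), N.card = n ∧
    IsOptimisticNet Θ ε N}) ⟨_, N, rfl, hN⟩

lemma netCard_pos {Θ : Set (PSR S)} (hΘ : ∀ θ ∈ Θ, θ.IsPSR) (hne : Θ.Nonempty) {ε : ℝ}
    (hε : 0 < ε) : 1 ≤ netCard Θ ε := by
  obtain ⟨N, hN, hN'⟩ := exists_card_eq_netCard hΘ hε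
  obtain ⟨θ, hθ⟩ := hne
  obtain ⟨f, hf, _⟩ := hN' θ hθ
  rw [← hN]
  exact card_pos.mpr ⟨f, hf⟩

lemma netCard_le {Θ : Set (PSR S)} (hΘ : ∀ θ ∈ Θ, θ.IsPSR) {ε : ℝ} (hε : 0 < ε) :
    netCard Θ ε ≤ (⌈(Fintype.card (Fin H → O × A) : ℝ) / ε⌉₊ + 2) ^
      Fintype.card (Fin H → O × A) := by
  obtain ⟨N, hN, hN'⟩ := exists_isOptimisticNet hΘ hε
  exact (Nat.sInf_le (s := {n | ∃ N : Finset ((Fin H → O × A) → ℝ), N.card = n ∧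
    IsOptimisticNet Θ ε N}) ⟨N, rfl, hN⟩).trans hN'

end Nets

/-! ### The sample bound grows only polylogarithmically in K -/

section Growth

lemma eventually_mul_log_pow_le (X b y : ℝ) (hb : 0 < b) (hy : 0 < y) (n : ℕ) :
    ∀ᶠ K : ℕ in Filter.atTop, X * Real.log (b * K) ^ n ≤ y * K := by
  have h1 : (fun x : ℝ => X * Real.log x ^ n) =o[Filter.atTop] (id : ℝ → ℝ) :=
    (Real.isLittleO_pow_log_id_atTop).const_mul_left X
  have h2 : Filter.Tendsto (fun K : ℕ => b * (K : ℝ)) Filter.atTop Filter.atTop :=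
    (tendsto_natCast_atTop_atTop).const_mul_atTop hb
  have h3 := (h1.comp_tendsto h2).bound (c := y / b) (by positivity)
  filter_upwards [h3, Filter.eventually_ge_atTop 1] with K hK hK1
  have hK0 : (0 : ℝ) ≤ b * K := by positivity
  simp only [Function.comp, id, Real.norm_eq_abs, abs_of_nonneg hK0] at hK
  refine (le_abs_self _).trans (hK.trans (le_of_eq ?_))
  field_simp

variable {O A : Type} {H : ℕ} {S : CoreTests O A H} [Fintype O] [Fintype A] [Nonempty A]
  [DecidableEq A]

lemma pminOf_pos [Nonempty O] (c : Consts) (hH : 1 ≤ H) {δ : ℝ} (hδ : 0 < δ) {K : ℕ}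
    (hK : 1 ≤ K) : 0 < pminOf c O A H δ K := by
  have h1 : (0 : ℝ) < Fintype.card O := by exact_mod_cast Fintype.card_pos
  have h2 : (0 : ℝ) < Fintype.card A := by exact_mod_cast Fintype.card_pos
  have h3 : (0 : ℝ) < K := by exact_mod_cast hK
  have h4 : (0 : ℝ) < H := by exact_mod_cast hH
  have := c.cp_pos
  unfold pminOf
  positivity

/-- The accuracy of the net is a constant over K², so the crude net has at most polynomially many
elements in K, with exponent depending on the number of trajectories. -/
lemma exists_betaOf_le (c : Consts) {Θ : Set (PSR S)} (hΘ : ∀ θ ∈ Θ, θ.IsPSR)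
    (hne : Θ.Nonempty) (hH : 1 ≤ H) {δ : ℝ} (hδ : 0 < δ) :
    ∃ b X : ℝ, 1 ≤ b ∧ 0 ≤ X ∧ ∀ K : ℕ, 1 ≤ K → betaOf c Θ δ K ≤ X * Real.log (b * K) := by
  obtain ⟨θ, hθ⟩ := hne
  have hO := (hΘ θ hθ).nonempty_obs
  set T := Fintype.card (Fin H → O × A) with hT
  set ε : ℕ → ℝ := fun K => c.cε * pminOf c O A H δ K / (K * H) with hε
  have h1 : (0 : ℝ) < Fintype.card O := by exact_mod_cast Fintype.card_pos
  have h2 : (0 : ℝ) < Fintype.card A := by exact_mod_cast Fintype.card_pos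
  have h4 : (0 : ℝ) < H := by exact_mod_cast hH
  have hc1 := c.cp_pos
  have hc2 := c.cε_pos
  set a : ℝ := ε 1 with ha
  have ha0 : 0 < a := by
    have := pminOf_pos (O := O) (A := A) c hH hδ (le_refl 1)
    simp only [ha, hε, Nat.cast_one]; positivity
  have hεK : ∀ K : ℕ, 1 ≤ K → ε K = a / (K : ℝ) ^ 2 := fun K hK => by
    have h3 : (0 : ℝ) < K := by exact_mod_cast hK
    simp only [ha, hε, pminOf, Nat.cast_one]
    field_simp
  set b : ℝ := (T / a + 3) + 1 / δ with hb
  have hTa : 0 ≤ (T : ℝ) / a := by positivity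
  have hδ' : 0 ≤ 1 / δ := by positivity
  refine ⟨b, c.cβ * (2 * T + 2), by linarith, mul_nonneg c.cβ_pos.le (by positivity),
    fun K hK => ?_⟩
  have hK1 : (1 : ℝ) ≤ K := by exact_mod_cast hK
  have hε0 : 0 < ε K := by rw [hεK K hK]; positivity
  have hn := netCard_le hΘ hε0
  have hn1 := netCard_pos hΘ ⟨θ, hθ⟩ hε0
  rw [betaOf, mul_assoc]
  refine mul_le_mul_of_nonneg_left ?_ c.cβ_pos.le
  change Real.log (K * (netCard Θ (ε K) : ℕ) / δ) ≤ _
  have hbK : 1 ≤ b * K := by nlinarith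
  have e1 : (netCard Θ (ε K) : ℝ) ≤ (b * K) ^ (2 * T) := by
    have e2 : (netCard Θ (ε K) : ℝ) ≤ ((⌈(T : ℝ) / ε K⌉₊ + 2 : ℕ) : ℝ) ^ T := by exact_mod_cast hn
    refine e2.trans ?_
    rw [pow_mul]
    refine pow_le_pow_left₀ (by positivity) ?_ _
    push_cast
    have e3 : (⌈(T : ℝ) / ε K⌉₊ : ℝ) ≤ T / a * (K : ℝ) ^ 2 + 1 := by
      refine (Nat.ceil_lt_add_one (by positivity)).le.trans (le_of_eq ?_)
      rw [hεK K hK]; field_simp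
    have e4 : (1 : ℝ) ≤ (K : ℝ) ^ 2 := one_le_pow₀ hK1
    have e5 : (T / a + 3) * (K : ℝ) ^ 2 ≤ (b * K) ^ 2 := by
      rw [mul_pow]
      refine mul_le_mul_of_nonneg_right ?_ (by positivity)
      nlinarith
    nlinarith
  have e2 : (K : ℝ) * (netCard Θ (ε K) : ℕ) / δ ≤ (b * K) ^ (2 * T + 2) := by
    have e3 : (K : ℝ) / δ ≤ b * K := by
      rw [div_eq_mul_one_div, mul_comm]
      exact mul_le_mul_of_nonneg_right (by linarith) (by linarith)
    calc (K : ℝ) * (netCard Θ (ε K) : ℕ) / δ = K / δ * netCard Θ (ε K) := by ring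
      _ ≤ b * K * (b * K) ^ (2 * T) := by gcongr
      _ = (b * K) ^ (2 * T + 1) := by ring
      _ ≤ _ := pow_le_pow_right₀ hbK (by omega)
  have hn2 : (1 : ℝ) ≤ netCard Θ (ε K) := by exact_mod_cast hn1
  refine (Real.log_le_log (by positivity) e2).trans (le_of_eq ?_)
  rw [Real.log_pow]; push_cast; ring

lemma eventually_sampleBound_le (c : Consts) {Θ : Set (PSR S)} (hΘ : ∀ θ ∈ Θ, θ.IsPSR)
    (hne : Θ.Nonempty) (hH : 1 ≤ H) (r : ℕ) {γ ε δ : ℝ} (hγ : 0 < γ) (hε : 0 < ε) (hδ : 0 < δ) :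
    ∀ᶠ K : ℕ in Filter.atTop, sampleBound c Θ r γ ε δ K ≤ K * H := by
  obtain ⟨b, X, hb, hX, hβ⟩ := exists_betaOf_le c hΘ hne hH hδ
  set Z : ℝ := r * S.dim * H * Fintype.card A * S.QA / (γ * ε * δ) with hZ
  have hZ0 : 0 ≤ Z := by positivity
  set W : ℝ := c.C * ((r + (S.QA : ℝ) ^ 2 * H / γ ^ 2) *
    (r * S.dim * (H : ℝ) ^ 3 * (Fintype.card A : ℝ) ^ 2 * (S.QA : ℝ) ^ 4 / (γ ^ 4 * ε ^ 2)))
    with hW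
  have hW0 : 0 ≤ W := by have := c.C_pos; positivity
  have hb' : 0 < b + (3 + Z) := by linarith
  have hH0 : (0 : ℝ) < H := by exact_mod_cast hH
  filter_upwards [eventually_mul_log_pow_le (W * X) (b + (3 + Z)) H hb' hH0 (c.deg + 1),
    Filter.eventually_ge_atTop 1] with K hK hK1
  have hK1' : (1 : ℝ) ≤ K := by exact_mod_cast hK1
  rw [mul_comm (K : ℝ)]
  refine le_trans ?_ hK
  have e1 : Real.log (b * K) ≤ Real.log ((b + (3 + Z)) * K) :=
    Real.log_le_log (by positivity) (by gcongr; linarith)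
  have e2 : (K * r * S.dim * H * Fintype.card A * S.QA / (γ * ε * δ) : ℝ) = Z * K := by
    rw [hZ]; ring
  have e3 : Real.log (3 + Z * K) ≤ Real.log ((b + (3 + Z)) * K) :=
    Real.log_le_log (by positivity) (by nlinarith)
  have e4 : 0 ≤ Real.log (3 + Z * K) := Real.log_nonneg (by nlinarith)
  have e5 : sampleBound c Θ r γ ε δ K = W * betaOf c Θ δ K * Real.log (3 + Z * K) ^ c.deg := by
    rw [sampleBound, e2, hW]; ring
  set L := Real.log ((b + (3 + Z)) * K) with hL
  have hL0 : 0 ≤ L := e4.trans e3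
  rw [e5, pow_succ]
  calc W * betaOf c Θ δ K * Real.log (3 + Z * K) ^ c.deg ≤ W * (X * L) * L ^ c.deg := by
        refine mul_le_mul (mul_le_mul_of_nonneg_left ((hβ K hK1).trans ?_) hW0)
          (pow_le_pow_left₀ e4 e3 _) (pow_nonneg e4 _) (by positivity)
        exact mul_le_mul_of_nonneg_left e1 hX
    _ = _ := by ring

end Growth

/-! ### Truncated norms and the potential -/

section Jensen

variable {O A : Type} {H : ℕ} {S : CoreTests O A H} [Fintype O] [Fintype A] [Nonempty A]
  [DecidableEq A]

/-- By Jensen it suffices to compare integrands: if some level has norm at least 1 the right side is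
at least c ≥ 1; otherwise no level is truncated. -/
lemma sq_value_min_le {θ : PSR S} (hθ : θ.IsPSR) (π : Policy O A) {lam : ℝ} (hlam : 0 < lam)
    {n : ℕ} (D : Fin n → Batch O A H) {Z c : ℝ} (hZ : 0 ≤ Z) (h1 : 1 ≤ c) (h2 : Z ^ 2 ≤ c) :
    θ.value (fun τ => min (Z * √(∑ h : Fin H, featQuad lam θ D h (pre τ h h.2.le))) 1) π ^ 2 ≤
      c * expPotential lam θ π D := by
  have e1 := sum_sq_le_sum_mul_sum_of_sq_le_mul univ (f := fun τ : Fin H → O × A => θ.law π τ)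
    (g := fun τ => θ.law π τ *
      min (Z * √(∑ h : Fin H, featQuad lam θ D h (pre τ h h.2.le))) 1 ^ 2)
    (r := fun τ => θ.law π τ *
      min (Z * √(∑ h : Fin H, featQuad lam θ D h (pre τ h h.2.le))) 1)
    (fun τ _ => hθ.law_nonneg π le_rfl τ)
    (fun τ _ => mul_nonneg (hθ.law_nonneg π le_rfl τ) (sq_nonneg _)) fun τ _ => le_of_eq (by ring)
  rw [hθ.sum_law π le_rfl, one_mul] at e1
  refine e1.trans ?_
  rw [expPotential, ← PSR.value_const_mul]
  refine PSR.value_mono hθ π fun τ => ?_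
  have hg : ∀ h : Fin H, 0 ≤ featQuad lam θ D h (pre τ h h.2.le) :=
    fun h => featQuad_nonneg hlam θ D h _
  set g : Fin H → ℝ := fun h => featQuad lam θ D h (pre τ h h.2.le) with hgdef
  have hm : 0 ≤ min (Z * √(∑ h, g h)) 1 :=
    le_min (mul_nonneg hZ (Real.sqrt_nonneg _)) zero_le_one
  have hmin : ∀ h, 0 ≤ min 1 (g h) := fun h => le_min zero_le_one (hg h)
  change min (Z * √(∑ h, g h)) 1 ^ 2 ≤ c * ∑ h, min 1 (g h)
  by_cases hx : ∃ h, 1 ≤ g h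
  · obtain ⟨h, hh⟩ := hx
    have e2 : 1 ≤ ∑ h, min 1 (g h) := by
      refine le_trans (le_of_eq (min_eq_left hh).symm) ?_
      exact single_le_sum (f := fun h => min 1 (g h)) (fun h _ => hmin h) (mem_univ h)
    have e3 : min (Z * √(∑ h, g h)) 1 ^ 2 ≤ 1 := pow_le_one₀ hm (min_le_right _ _)
    nlinarith
  · push Not at hx
    have e2 : ∑ h, min 1 (g h) = ∑ h, g h :=
      sum_congr rfl fun h _ => min_eq_right (hx h).le
    rw [e2]
    refine (pow_le_pow_left₀ hm (min_le_left _ _) 2).trans ?_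
    rw [mul_pow, Real.sq_sqrt (sum_nonneg fun h _ => hg h)]
    exact mul_le_mul_of_nonneg_right h2 (sum_nonneg fun h _ => hg h)

/-- The truncated norms along a run of length `n`, in terms of the elliptical potential. -/
lemma sum_value_min_le {θ : PSR S} (hθ : θ.IsPSR) {lam : ℝ} (hlam : 0 < lam) {n : ℕ}
    (π : Fin n → Policy O A) (D : (t : Fin n) → Fin t → Batch O A H) {Z c Φ : ℝ} (hZ : 0 ≤ Z)
    (h1 : 1 ≤ c) (h2 : Z ^ 2 ≤ c) (hΦ : ∑ t, expPotential lam θ (π t) (D t) ≤ Φ) :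
    ∑ t, θ.value (fun τ => min (Z * √(∑ h : Fin H, featQuad lam θ (D t) h (pre τ h h.2.le))) 1)
      (π t) ≤ √(n * (c * Φ)) := by
  refine Real.le_sqrt_of_sq_le ?_
  refine (sq_sum_le_card_mul_sum_sq (s := univ)).trans ?_
  rw [card_univ, Fintype.card_fin]
  refine mul_le_mul_of_nonneg_left ?_ (Nat.cast_nonneg n)
  refine le_trans ?_ (mul_le_mul_of_nonneg_left hΦ (zero_le_one.trans h1))
  rw [mul_sum]
  exact sum_le_sum fun t _ => sq_value_min_le hθ (π t) hlam (D t) hZ h1 h2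

end Jensen

end PSRUCB

end

noncomputable section

namespace PSRUCB

/-! ### Estimates for the inputs of the algorithm -/

section Numerics

variable {Q d a H r γ β : ℝ} (hQ : 1 ≤ Q) (hd : 1 ≤ d) (ha : 1 ≤ a) (hH : 1 ≤ H) (hr : 1 ≤ r)
  (hγ : 0 < γ) (hγQ : γ ≤ Q) (hβ : 1 ≤ β)

/-- The regularisation of the algorithm. -/
def regParam (Q d a H r γ β : ℝ) : ℝ :=
  γ * a ^ 2 * Q * β * max √r (Q * √H / γ) / √(d * H)

/-- The size of the bonus, up to a constant. -/
def bonusScale (Q d a H r γ β : ℝ) : ℝ :=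
  Q * √(H * d) / γ ^ 2 * √(regParam Q d a H r γ β) + a * Q * √β / γ

/-- The sample complexity, up to a constant, a logarithm and the factor `H / ε²`. -/
def sampleScale (Q d a H r γ β : ℝ) : ℝ :=
  (r + Q ^ 2 * H / γ ^ 2) * (r * d * H ^ 2 * a ^ 2 * Q ^ 4 * β / γ ^ 4)

include hQ hd ha hH hr hγ hγQ hβ

lemma regParam_pos : 0 < regParam Q d a H r γ β := by
  unfold regParam
  have : 0 < √r := Real.sqrt_pos.mpr (by linarith)
  have : 0 < max √r (Q * √H / γ) := lt_max_of_lt_left this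
  positivity

lemma le_regParam_mul : a ^ 2 * Q ^ 2 * β ≤ regParam Q d a H r γ β * √d := by
  have h1 : 0 < √d := Real.sqrt_pos.mpr (by linarith)
  have h2 : 0 < √H := Real.sqrt_pos.mpr (by linarith)
  have h3 : Q * √H / γ ≤ max √r (Q * √H / γ) := le_max_right _ _
  rw [regParam, Real.sqrt_mul (by linarith : 0 ≤ d)]
  calc a ^ 2 * Q ^ 2 * β = γ * a ^ 2 * Q * β * (Q * √H / γ) / (√d * √H) * √d := by
        field_simp
    _ ≤ _ := by gcongr

lemma regParam_le : regParam Q d a H r γ β ≤ 2 * (a ^ 2 * Q ^ 2 * β) * r := by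
  have h1 : 1 ≤ √d := Real.one_le_sqrt.mpr hd
  have h2 : 1 ≤ √H := Real.one_le_sqrt.mpr hH
  have h0 : 1 ≤ √r := Real.one_le_sqrt.mpr hr
  have h4 : √r ≤ r := by nlinarith [Real.mul_self_sqrt (by linarith : 0 ≤ r)]
  have h3 : max √r (Q * √H / γ) ≤ r * Q * √H / γ := by
    refine max_le ?_ ?_
    · rw [le_div_iff₀ hγ]
      calc √r * γ ≤ r * Q := by gcongr
        _ ≤ r * Q * √H := le_mul_of_one_le_right (by positivity) h2
    · gcongr
      nlinarith
  rw [regParam, Real.sqrt_mul (by linarith : 0 ≤ d)]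
  calc γ * a ^ 2 * Q * β * max √r (Q * √H / γ) / (√d * √H) ≤
        γ * a ^ 2 * Q * β * (r * Q * √H / γ) / (1 * √H) := by gcongr
    _ = a ^ 2 * Q ^ 2 * β * r := by field_simp
    _ ≤ _ := by
        have : 0 ≤ a ^ 2 * Q ^ 2 * β * r := by positivity
        linarith

lemma bonusScale_pos : 0 < bonusScale Q d a H r γ β := by
  have := regParam_pos hQ hd ha hH hr hγ hγQ hβ
  unfold bonusScale
  positivity

/-- `le_regParam_mul`, that is the second entry of the maximum in λ, makes the first summand of the
bonus scale dominate the second. -/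
lemma sq_bonusScale_le : bonusScale Q d a H r γ β ^ 2 ≤
    4 * (Q ^ 2 * H * d / γ ^ 4) * regParam Q d a H r γ β := by
  have hl := regParam_pos hQ hd ha hH hr hγ hγQ hβ
  have h1 := le_regParam_mul hQ hd ha hH hr hγ hγQ hβ
  set l := regParam Q d a H r γ β with hldef
  have e1 : (Q * √(H * d) / γ ^ 2 * √l) ^ 2 = Q ^ 2 * H * d / γ ^ 4 * l := by
    rw [mul_pow, div_pow, mul_pow, Real.sq_sqrt (by positivity), Real.sq_sqrt hl.le]; ring
  have e2 : (a * Q * √β / γ) ^ 2 ≤ Q ^ 2 * H * d / γ ^ 4 * l := by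
    have h3 : √d ≤ d := by
      nlinarith [Real.mul_self_sqrt (by linarith : 0 ≤ d), Real.one_le_sqrt.mpr hd]
    have h4 : γ ^ 2 ≤ Q ^ 2 := pow_le_pow_left₀ hγ.le hγQ 2
    rw [div_pow, mul_pow, mul_pow, Real.sq_sqrt (by linarith)]
    calc a ^ 2 * Q ^ 2 * β / γ ^ 2 ≤ l * √d / γ ^ 2 := by gcongr
      _ ≤ l * (d * H) / γ ^ 2 := by
          gcongr
          nlinarith
      _ = γ ^ 2 * H * d / γ ^ 4 * l := by field_simp
      _ ≤ _ := by gcongr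
  have h5 : bonusScale Q d a H r γ β = Q * √(H * d) / γ ^ 2 * √l + a * Q * √β / γ := rfl
  rw [h5]
  nlinarith [sq_nonneg (Q * √(H * d) / γ ^ 2 * √l - a * Q * √β / γ)]

/-- The two parts are 4 and 16 · 18 = 288 times the squared summands of the bonus scale, and 17² =
289. This is the 17 in the choice of cα. -/
lemma err_sum_le_bonusScale : H * (regParam Q d a H r γ β * d * (2 * Q / γ ^ 2) ^ 2) +
    (4 * a * Q / γ) ^ 2 * (18 * β) ≤ (17 * bonusScale Q d a H r γ β) ^ 2 := by
  have hl := regParam_pos hQ hd ha hH hr hγ hγQ hβ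
  set l := regParam Q d a H r γ β with hldef
  have h5 : bonusScale Q d a H r γ β = Q * √(H * d) / γ ^ 2 * √l + a * Q * √β / γ := rfl
  have e1 : (Q * √(H * d) / γ ^ 2 * √l) ^ 2 = Q ^ 2 * H * d / γ ^ 4 * l := by
    rw [mul_pow, div_pow, mul_pow, Real.sq_sqrt (by positivity), Real.sq_sqrt hl.le]; ring
  have e2 : (a * Q * √β / γ) ^ 2 = a ^ 2 * Q ^ 2 * β / γ ^ 2 := by
    rw [div_pow, mul_pow, mul_pow, Real.sq_sqrt (by linarith)]
  have e3 : H * (l * d * (2 * Q / γ ^ 2) ^ 2) = 4 * (Q * √(H * d) / γ ^ 2 * √l) ^ 2 := by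
    rw [e1]; field_simp; ring
  have e4 : (4 * a * Q / γ) ^ 2 * (18 * β) = 288 * (a * Q * √β / γ) ^ 2 := by
    rw [e2]; field_simp; ring
  rw [e3, e4, h5]
  have h6 : 0 ≤ Q * √(H * d) / γ ^ 2 * √l := by positivity
  have h7 : 0 ≤ a * Q * √β / γ := by positivity
  nlinarith [mul_nonneg h6 h7, sq_nonneg (Q * √(H * d) / γ ^ 2 * √l), sq_nonneg (a * Q * √β / γ)]

/-- The regularisation here is not that of the algorithm but the analysis parameter γ²a²β/(dH),
which brings both parts to the same order: 64 + 3528 ≤ 60². -/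
lemma gap_sum_le : H * (γ ^ 2 * a ^ 2 * β / (d * H) * d * (8 * (Q / γ) ^ 2) ^ 2) +
    (14 * (Q / γ * (a * Q))) ^ 2 * (18 * β) ≤ (60 * (a * Q ^ 2 * √β / γ)) ^ 2 := by
  have e1 : H * (γ ^ 2 * a ^ 2 * β / (d * H) * d * (8 * (Q / γ) ^ 2) ^ 2) =
      64 * (a ^ 2 * Q ^ 4 * β / γ ^ 2) := by field_simp; ring
  have e2 : (14 * (Q / γ * (a * Q))) ^ 2 * (18 * β) = 3528 * (a ^ 2 * Q ^ 4 * β / γ ^ 2) := by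
    field_simp; ring
  have e3 : (60 * (a * Q ^ 2 * √β / γ)) ^ 2 = 3600 * (a ^ 2 * Q ^ 4 * β / γ ^ 2) := by
    rw [mul_pow, div_pow, mul_pow, Real.sq_sqrt (by linarith)]; ring
  have : 0 ≤ a ^ 2 * Q ^ 4 * β / γ ^ 2 := by positivity
  linarith

lemma err_sum_le : H * (γ ^ 2 * a ^ 2 * β / (d * H) * d * (2 * Q / γ ^ 2) ^ 2) +
    (4 * a * Q / γ) ^ 2 * (18 * β) ≤ (18 * (a * Q * √β / γ)) ^ 2 := by
  have e1 : H * (γ ^ 2 * a ^ 2 * β / (d * H) * d * (2 * Q / γ ^ 2) ^ 2) =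
      4 * (a ^ 2 * Q ^ 2 * β / γ ^ 2) := by field_simp; ring
  have e2 : (4 * a * Q / γ) ^ 2 * (18 * β) = 288 * (a ^ 2 * Q ^ 2 * β / γ ^ 2) := by
    field_simp; ring
  have e3 : (18 * (a * Q * √β / γ)) ^ 2 = 324 * (a ^ 2 * Q ^ 2 * β / γ ^ 2) := by
    rw [mul_pow, div_pow, mul_pow, Real.sq_sqrt (by linarith)]; ring
  have : 0 ≤ a ^ 2 * Q ^ 2 * β / γ ^ 2 := by positivity
  linarith

/-- This lets the change of measure be charged to the term with the distance of the features. -/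
lemma err_le_gap {c : ℝ} (hc : 1 ≤ c) : 18 * (a * Q * √β / γ) ≤
    c * bonusScale Q d a H r γ β * √(2 / regParam Q d a H r γ β) * √H *
      (60 * (a * Q ^ 2 * √β / γ)) := by
  have hl := regParam_pos hQ hd ha hH hr hγ hγQ hβ
  set l := regParam Q d a H r γ β with hldef
  have h5 : bonusScale Q d a H r γ β = Q * √(H * d) / γ ^ 2 * √l + a * Q * √β / γ := rfl
  have h7 : 0 ≤ a * Q * √β / γ := by positivity
  have h6 : Q / γ ^ 2 * √l ≤ c * bonusScale Q d a H r γ β := by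
    have h8 : Q / γ ^ 2 * √l ≤ bonusScale Q d a H r γ β := by
      rw [h5]
      have : 1 ≤ √(H * d) := Real.one_le_sqrt.mpr (by nlinarith)
      have : Q / γ ^ 2 * √l ≤ Q * √(H * d) / γ ^ 2 * √l := by
        gcongr
        nlinarith
      linarith
    have h9 : 0 ≤ Q / γ ^ 2 * √l := by positivity
    nlinarith
  have h10 : √l * √(2 / l) = √2 := by
    rw [← Real.sqrt_mul hl.le]; congr 1; field_simp
  have h11 : 1 ≤ √2 := Real.one_le_sqrt.mpr (by norm_num)
  have h12 : 1 ≤ √H := Real.one_le_sqrt.mpr hH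
  have h13 : Q / γ ^ 2 ≤ c * bonusScale Q d a H r γ β * √(2 / l) * √H := by
    calc Q / γ ^ 2 = Q / γ ^ 2 * 1 * 1 := by ring
      _ ≤ Q / γ ^ 2 * √2 * √H := by gcongr
      _ = Q / γ ^ 2 * √l * √(2 / l) * √H := by rw [← h10]; ring
      _ ≤ _ := by gcongr
  have h14 : γ ^ 2 ≤ Q ^ 2 := pow_le_pow_left₀ hγ.le hγQ 2
  calc 18 * (a * Q * √β / γ) ≤ 60 * (a * Q * √β / γ) := by linarith
    _ = γ ^ 2 / γ ^ 2 * (60 * (a * Q * √β / γ)) := by field_simp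
    _ ≤ Q ^ 2 / γ ^ 2 * (60 * (a * Q * √β / γ)) := by gcongr
    _ = Q / γ ^ 2 * (60 * (a * Q ^ 2 * √β / γ)) := by ring
    _ ≤ _ := by gcongr

lemma mul_le_sampleScale : H * r ≤ sampleScale Q d a H r γ β := by
  have h1 : γ ^ 4 ≤ Q ^ 4 := pow_le_pow_left₀ hγ.le hγQ 4
  have h2 : 1 ≤ d * H * a ^ 2 * (Q ^ 4 / γ ^ 4) * β := by
    have : 1 ≤ Q ^ 4 / γ ^ 4 := (one_le_div (by positivity)).mpr h1
    have h3 : 1 ≤ a ^ 2 := one_le_pow₀ ha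
    exact one_le_mul_of_one_le_of_one_le (one_le_mul_of_one_le_of_one_le
      (one_le_mul_of_one_le_of_one_le (one_le_mul_of_one_le_of_one_le hd hH) h3) this) hβ
  have h3 : 1 ≤ r + Q ^ 2 * H / γ ^ 2 := by
    have : 0 ≤ Q ^ 2 * H / γ ^ 2 := by positivity
    linarith
  calc H * r ≤ 1 * (H * r * (d * H * a ^ 2 * (Q ^ 4 / γ ^ 4) * β)) := by
        rw [one_mul]; exact le_mul_of_one_le_right (by positivity) h2
    _ ≤ (r + Q ^ 2 * H / γ ^ 2) * (H * r * (d * H * a ^ 2 * (Q ^ 4 / γ ^ 4) * β)) := by gcongr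
    _ = _ := by rw [sampleScale]; ring

lemma one_le_sampleScale : 1 ≤ sampleScale Q d a H r γ β :=
  (one_le_mul_of_one_le_of_one_le hH hr).trans (mul_le_sampleScale hQ hd ha hH hr hγ hγQ hβ)

/-- λ cancels between the squared bonus scale and 2/λ. The result is the summand Q²H/γ² of the
sample complexity. -/
lemma sq_gap_coeff_le {c : ℝ} (hc : 1 ≤ c) : (c * bonusScale Q d a H r γ β *
    √(2 / regParam Q d a H r γ β) * √H * (60 * (a * Q ^ 2 * √β / γ))) ^ 2 * (H * r) ≤
    28800 * c ^ 2 * sampleScale Q d a H r γ β := by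
  have hl := regParam_pos hQ hd ha hH hr hγ hγQ hβ
  have h1 := sq_bonusScale_le hQ hd ha hH hr hγ hγQ hβ
  set l := regParam Q d a H r γ β with hldef
  set s := bonusScale Q d a H r γ β with hs
  have e1 : (c * s * √(2 / l) * √H * (60 * (a * Q ^ 2 * √β / γ))) ^ 2 * (H * r) =
      s ^ 2 * (7200 * c ^ 2 * H ^ 2 * a ^ 2 * Q ^ 4 * β * r / (γ ^ 2 * l)) := by
    simp only [mul_pow, div_pow]
    rw [Real.sq_sqrt (by positivity), Real.sq_sqrt (by linarith), Real.sq_sqrt (by linarith)]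
    field_simp; ring
  rw [e1]
  calc _ ≤ 4 * (Q ^ 2 * H * d / γ ^ 4) * l *
        (7200 * c ^ 2 * H ^ 2 * a ^ 2 * Q ^ 4 * β * r / (γ ^ 2 * l)) := by gcongr
    _ = 28800 * c ^ 2 * ((0 + Q ^ 2 * H / γ ^ 2) *
        (r * d * H ^ 2 * a ^ 2 * Q ^ 4 * β / γ ^ 4)) := by field_simp; ring
    _ ≤ _ := by
        rw [sampleScale]
        gcongr
        linarith

/-- Here the inflation of the Gram matrix times λ is of order a²Q²βr by `regParam_le`; the result is
the summand r of the sample complexity. -/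
lemma sq_bonus_coeff_le {c : ℝ} (hc : 1 ≤ c) : (c * bonusScale Q d a H r γ β *
    √(2 * (2 + 2 * (2 * a * Q) ^ 2 * (18 * β) / regParam Q d a H r γ β))) ^ 2 * (H * r) ≤
    28800 * c ^ 2 * sampleScale Q d a H r γ β := by
  have hl := regParam_pos hQ hd ha hH hr hγ hγQ hβ
  have h1 := sq_bonusScale_le hQ hd ha hH hr hγ hγQ hβ
  have h2 := regParam_le hQ hd ha hH hr hγ hγQ hβ
  set l := regParam Q d a H r γ β with hldef
  set s := bonusScale Q d a H r γ β with hs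
  have e1 : (c * s * √(2 * (2 + 2 * (2 * a * Q) ^ 2 * (18 * β) / l))) ^ 2 * (H * r) =
      s ^ 2 * (c ^ 2 * (4 * l + 288 * (a ^ 2 * Q ^ 2 * β)) / l * (H * r)) := by
    rw [mul_pow, mul_pow, Real.sq_sqrt (by positivity)]
    field_simp; ring
  have h3 : 4 * l + 288 * (a ^ 2 * Q ^ 2 * β) ≤ 296 * (a ^ 2 * Q ^ 2 * β) * r := by
    have : 0 ≤ a ^ 2 * Q ^ 2 * β := by positivity
    nlinarith
  rw [e1]
  calc _ ≤ 4 * (Q ^ 2 * H * d / γ ^ 4) * l *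
        (c ^ 2 * (296 * (a ^ 2 * Q ^ 2 * β) * r) / l * (H * r)) := by gcongr
    _ = 1184 * c ^ 2 * ((r + 0) * (r * d * H ^ 2 * a ^ 2 * Q ^ 4 * β / γ ^ 4)) := by
        field_simp; ring
    _ ≤ 28800 * c ^ 2 * ((r + Q ^ 2 * H / γ ^ 2) *
        (r * d * H ^ 2 * a ^ 2 * Q ^ 4 * β / γ ^ 4)) := by
        gcongr
        · norm_num
        · positivity
    _ = _ := rfl

lemma max_mul_le_sampleScale {c z : ℝ} (hc : 1 ≤ c)
    (hz : z ^ 2 * (H * r) ≤ 28800 * c ^ 2 * sampleScale Q d a H r γ β) :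
    max 1 (z ^ 2) * (H * r) ≤ 28800 * c ^ 2 * sampleScale Q d a H r γ β := by
  rw [max_mul_of_nonneg _ _ (by positivity), one_mul]
  refine max_le ((mul_le_sampleScale hQ hd ha hH hr hγ hγQ hβ).trans ?_) hz
  have h1 : 1 ≤ c ^ 2 := one_le_pow₀ hc
  have h2 := one_le_sampleScale hQ hd ha hH hr hγ hγQ hβ
  nlinarith

section Logs

variable {K ε δ : ℝ} (hK : 1 ≤ K) (hε : 0 < ε) (hε2 : ε ≤ 2) (hδ : 0 < δ) (hδ1 : δ < 1)
include hK hε hε2 hδ hδ1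

lemma half_mul_le_logArg : K * (d * H * (Q / γ)) / 2 ≤ K * r * d * H * a * Q / (γ * ε * δ) := by
  rw [div_le_div_iff₀ (by norm_num) (by positivity)]
  have h1 : ε * δ ≤ 2 := by nlinarith
  have h2 : 1 ≤ r * a := one_le_mul_of_one_le_of_one_le hr ha
  calc K * (d * H * (Q / γ)) * (γ * ε * δ) = K * d * H * Q * (ε * δ) := by field_simp
    _ ≤ K * d * H * Q * 2 := by gcongr
    _ ≤ K * d * H * Q * 2 * (r * a) := le_mul_of_one_le_right (by positivity) h2
    _ = _ := by ring

lemma inv_le_logArg (hK2 : 2 ≤ K) : 1 / δ ≤ K * r * d * H * a * Q / (γ * ε * δ) := by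
  rw [div_le_div_iff₀ hδ (by positivity)]
  have h2 : 1 ≤ r * d * H * a :=
    one_le_mul_of_one_le_of_one_le (one_le_mul_of_one_le_of_one_le
      (one_le_mul_of_one_le_of_one_le hr hd) hH) ha
  calc 1 * (γ * ε * δ) ≤ Q * 2 * δ := by rw [one_mul]; gcongr
    _ ≤ Q * K * δ := by gcongr
    _ ≤ Q * K * δ * (r * d * H * a) := le_mul_of_one_le_right (by positivity) h2
    _ = _ := by ring

lemma log_potential_aux_le {n : ℝ} (hn0 : 0 ≤ n) (hn : n ≤ K) :
    Real.log (1 + n * Q ^ 2 / (γ ^ 2 * a ^ 2 * β / (d * H))) ≤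
      4 * Real.log (3 + K * r * d * H * a * Q / (γ * ε * δ)) := by
  have h1 := half_mul_le_logArg hQ hd ha hH hr hγ hγQ hβ hK hε hε2 hδ hδ1
  set T := K * r * d * H * a * Q / (γ * ε * δ) with hT
  have hx : 0 ≤ K * (d * H * (Q / γ)) := by positivity
  have h2 : n * Q ^ 2 / (γ ^ 2 * a ^ 2 * β / (d * H)) ≤ (K * (d * H * (Q / γ))) ^ 2 := by
    have h3 : 1 ≤ a ^ 2 * β := one_le_mul_of_one_le_of_one_le (one_le_pow₀ ha) hβ
    have h4 : 1 ≤ K * d * H :=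
      one_le_mul_of_one_le_of_one_le (one_le_mul_of_one_le_of_one_le hK hd) hH
    calc n * Q ^ 2 / (γ ^ 2 * a ^ 2 * β / (d * H)) = n * (d * H * Q ^ 2 / γ ^ 2) / (a ^ 2 * β) := by
          field_simp
      _ ≤ K * (d * H * Q ^ 2 / γ ^ 2) / 1 := by gcongr
      _ ≤ K * (d * H * Q ^ 2 / γ ^ 2) / 1 * (K * d * H) :=
          le_mul_of_one_le_right (by positivity) h4
      _ = _ := by ring
  have h5 : n * Q ^ 2 / (γ ^ 2 * a ^ 2 * β / (d * H)) ≤ (2 * T) ^ 2 :=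
    h2.trans (pow_le_pow_left₀ hx (by linarith) 2)
  have hT0 : 0 ≤ T := by linarith
  have h6 : 0 ≤ n * Q ^ 2 / (γ ^ 2 * a ^ 2 * β / (d * H)) := by positivity
  have h7 : Real.log ((3 + T) ^ 4) = 4 * Real.log (3 + T) := by rw [Real.log_pow]; norm_num
  rw [← h7]
  refine Real.log_le_log (by linarith) ?_
  have e1 : (3 + T) ^ 2 ≥ 9 + T ^ 2 := by nlinarith
  have e2 : (3 + T) ^ 4 = (3 + T) ^ 2 * (3 + T) ^ 2 := by ring
  rw [e2]
  nlinarith [sq_nonneg T]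

lemma log_potential_le {n : ℝ} (hn0 : 0 ≤ n) (hn : n ≤ K) :
    Real.log (1 + n * Q ^ 2 / regParam Q d a H r γ β) ≤
      4 * Real.log (3 + K * r * d * H * a * Q / (γ * ε * δ)) := by
  have h1 := half_mul_le_logArg hQ hd ha hH hr hγ hγQ hβ hK hε hε2 hδ hδ1
  have hl := regParam_pos hQ hd ha hH hr hγ hγQ hβ
  have hl2 := le_regParam_mul hQ hd ha hH hr hγ hγQ hβ
  set l := regParam Q d a H r γ β with hldef
  set T := K * r * d * H * a * Q / (γ * ε * δ) with hT
  have h2 : n * Q ^ 2 / l ≤ K * (d * H * (Q / γ)) := by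
    have h3 : 1 ≤ a ^ 2 * β := one_le_mul_of_one_le_of_one_le (one_le_pow₀ ha) hβ
    have h4 : √d ≤ d := by
      nlinarith [Real.mul_self_sqrt (by linarith : 0 ≤ d), Real.one_le_sqrt.mpr hd]
    have h5 : Q ^ 2 ≤ l * d := by
      calc Q ^ 2 ≤ Q ^ 2 * (a ^ 2 * β) := le_mul_of_one_le_right (by positivity) h3
        _ = a ^ 2 * Q ^ 2 * β := by ring
        _ ≤ l * √d := hl2
        _ ≤ _ := by gcongr
    have h6 : 1 ≤ H * (Q / γ) := one_le_mul_of_one_le_of_one_le hH ((one_le_div hγ).mpr hγQ)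
    rw [div_le_iff₀ hl]
    calc n * Q ^ 2 ≤ K * (l * d) := by gcongr
      _ ≤ K * (l * d) * (H * (Q / γ)) := le_mul_of_one_le_right (by positivity) h6
      _ = _ := by ring
  have h6 : 0 ≤ n * Q ^ 2 / l := by positivity
  have hT0 : 0 ≤ T := by linarith
  have h7 : Real.log ((3 + T) ^ 4) = 4 * Real.log (3 + T) := by rw [Real.log_pow]; norm_num
  rw [← h7]
  refine Real.log_le_log (by linarith) ?_
  have e1 : (3 + T) ^ 2 ≥ 9 + T ^ 2 := by nlinarith
  have e2 : (3 + T) ^ 4 = (3 + T) ^ 2 * (3 + T) ^ 2 := by ring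
  rw [e2]
  nlinarith [sq_nonneg (T - 1), sq_nonneg T]

lemma log_inv_le (hK2 : 2 ≤ K) : Real.log (1 / (δ / 8)) ≤
    3 * Real.log (3 + K * r * d * H * a * Q / (γ * ε * δ)) := by
  have h1 := inv_le_logArg hQ hd ha hH hr hγ hγQ hβ hK hε hε2 hδ hδ1 hK2
  set T := K * r * d * H * a * Q / (γ * ε * δ) with hT
  have h7 : Real.log ((3 + T) ^ 3) = 3 * Real.log (3 + T) := by rw [Real.log_pow]; norm_num
  rw [← h7]
  refine Real.log_le_log (by positivity) ?_
  have hT0 : 0 ≤ T := by positivity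
  have e1 : 1 / (δ / 8) = 8 * (1 / δ) := by field_simp
  have e2 : (3 + T) ^ 3 ≥ 27 * T := by nlinarith [pow_nonneg hT0 3, pow_nonneg hT0 2]
  rw [e1]; linarith

lemma log_le_two_mul_log : Real.log K ≤
    2 * Real.log (3 + K * r * d * H * a * Q / (γ * ε * δ)) := by
  have h1 := half_mul_le_logArg hQ hd ha hH hr hγ hγQ hβ hK hε hε2 hδ hδ1
  set T := K * r * d * H * a * Q / (γ * ε * δ) with hT
  have h7 : Real.log ((3 + T) ^ 2) = 2 * Real.log (3 + T) := by rw [Real.log_pow]; norm_num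
  rw [← h7]
  refine Real.log_le_log (by positivity) ?_
  have h2 : K ≤ K * (d * H * (Q / γ)) := le_mul_of_one_le_right (by linarith)
    (one_le_mul_of_one_le_of_one_le (one_le_mul_of_one_le_of_one_le hd hH)
      ((one_le_div hγ).mpr hγQ))
  nlinarith [sq_nonneg T]

lemma one_le_log : 1 ≤ Real.log (3 + K * r * d * H * a * Q / (γ * ε * δ)) := by
  have h0 : 0 ≤ K * r * d * H * a * Q / (γ * ε * δ) := by positivity
  rw [Real.le_log_iff_exp_le (by linarith)]
  linarith [Real.exp_one_lt_d9]

end Logs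

end Numerics

/-- The number of dyadic layers: log 2 > 1/2, so ⌈2 log K⌉ layers suffice. -/
lemma exists_pow_two_ge {K L : ℝ} (hK : 1 ≤ K) (hL : 1 ≤ L) (h : Real.log K ≤ 2 * L) :
    ∃ N : ℕ, K ≤ 2 ^ N ∧ (N : ℝ) ≤ 5 * L := by
  refine ⟨⌈2 * Real.log K⌉₊, ?_, ?_⟩
  · have h1 : Real.log K ≤ Real.log ((2 : ℝ) ^ ⌈2 * Real.log K⌉₊) := by
      rw [Real.log_pow]
      have h2 := Nat.le_ceil (2 * Real.log K)
      have h3 := Real.log_two_gt_d9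
      have h4 := Real.log_nonneg hK
      nlinarith
    exact (Real.log_le_log_iff (by linarith) (by positivity)).mp h1
  · have := (Nat.ceil_lt_add_one (by linarith [Real.log_nonneg hK] : 0 ≤ 2 * Real.log K)).le
    linarith

/-- The factor of the sample complexity, for a bonus with factor `c`. -/
def sampleConst (η c : ℝ) : ℝ :=
  2 * 529 * 64 * 22 * 28800 * (1 + η) ^ 2 * c ^ 2 + 32 * (1 + η) + 16

/-- A run that has not stopped in time contradicts the bound on the sum of the bonuses. -/
lemma sum_bonus_lt {η c s L ε K : ℝ} {m N : ℕ} (hη : 0 < η) (hc : 1 ≤ c) (hs : 1 ≤ s)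
    (hL : 1 ≤ L) (hε : 0 < ε) (hε2 : ε ≤ 2) (hK : K ≤ 2 ^ N) (hN : (N : ℝ) ≤ 5 * L)
    (hmK : (m : ℝ) ≤ K) (hm : sampleConst η c * s * L ^ 3 / ε ^ 2 < m + 1) :
    m * (1 / 2) ^ N + (4 * N + 2) * √(m * (28800 * c ^ 2 * s * (22 * L))) +
      √(m * (28800 * c ^ 2 * s * (22 * L))) < (m - 1) * (ε / (1 + η) / 2) := by
  set G := 28800 * c ^ 2 * s * (22 * L) with hG
  have hG0 : 0 < G := by positivity
  set C := sampleConst η c with hC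
  have hC' : C = 2 * 529 * 64 * 22 * 28800 * (1 + η) ^ 2 * c ^ 2 + 32 * (1 + η) + 16 := rfl
  have hC0 : 0 ≤ 2 * 529 * 64 * 22 * 28800 * (1 + η) ^ 2 * c ^ 2 := by positivity
  have hL3 : 1 ≤ L ^ 3 := one_le_pow₀ hL
  have hsL : 1 ≤ s * L ^ 3 := one_le_mul_of_one_le_of_one_le hs hL3
  have hε4 : ε ^ 2 ≤ 4 := by nlinarith
  -- the size of `m`
  have h1 : C * (s * L ^ 3) < (m + 1) * ε ^ 2 := by
    rw [div_lt_iff₀ (by positivity)] at hm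
    linarith
  have h2 : (3 : ℝ) < m := by
    have : 16 ≤ C * (s * L ^ 3) := by nlinarith
    nlinarith
  -- The factor 2 in front of the leading constant is spent on replacing m + 1 by m.
  have h3 : C / 2 * (s * L ^ 3) < m * ε ^ 2 := by nlinarith [sq_nonneg ε]
  -- the first term
  have h4 : m * (1 / 2 : ℝ) ^ N ≤ 1 := by
    rw [one_div, inv_pow, ← div_eq_mul_inv]
    exact div_le_one_of_le₀ (hmK.trans hK) (by positivity)
  have h5 : 1 ≤ m * ε / (8 * (1 + η)) := by
    rw [one_le_div (by positivity), ← mul_le_mul_iff_left₀ hε]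
    have : 16 * (1 + η) ≤ C / 2 * (s * L ^ 3) := by
      have : 16 * (1 + η) ≤ C / 2 := by linarith
      nlinarith
    nlinarith
  -- the other terms
  have h6 : 23 * L * √(m * G) < m * ε / (8 * (1 + η)) := by
    refine lt_of_pow_lt_pow_left₀ 2 (by positivity) ?_
    rw [mul_pow, Real.sq_sqrt (by positivity), div_pow, lt_div_iff₀ (by positivity)]
    have e1 : (23 * L) ^ 2 * (m * G) * (8 * (1 + η)) ^ 2 =
        m * (529 * 64 * 22 * 28800 * (1 + η) ^ 2 * c ^ 2 * (s * L ^ 3)) := by rw [hG]; ring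
    have e2 : (m * ε) ^ 2 = m * (m * ε ^ 2) := by ring
    rw [e1, e2]
    refine mul_lt_mul_of_pos_left (lt_of_le_of_lt ?_ h3) (by linarith)
    refine mul_le_mul_of_nonneg_right ?_ (by linarith)
    linarith
  have h7 : (4 * N + 2) * √(m * G) + √(m * G) ≤ 23 * L * √(m * G) := by
    have := Real.sqrt_nonneg (m * G)
    nlinarith
  have h8 : m * ε / (8 * (1 + η)) + m * ε / (8 * (1 + η)) ≤ (m - 1) * (ε / (1 + η) / 2) := by
    have e1 : (m - 1) * (ε / (1 + η) / 2) = (4 * (m - 1)) * ε / (8 * (1 + η)) := by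
      field_simp; ring
    rw [e1, ← add_div]
    gcongr
    nlinarith
  linarith

end PSRUCB

end

noncomputable section

namespace PSRUCB

open Finset

/-! ### Deterministic analysis of a run on good data -/

section Run

variable {O A : Type} {H : ℕ} {S : CoreTests O A H} [Fintype O] [Fintype A] [Nonempty A]
  [DecidableEq A]

lemma PSR.IsPSR.rank_pos {θ : PSR S} (hθ : θ.IsPSR) {r : ℕ} (hr : θ.RankLE r) : 1 ≤ r := by
  obtain ⟨τ, hτ⟩ := hθ.exists_prob_pos le_rfl
  by_contra h0
  have h1 : (θ.dynMatrix H 0).rank = 0 := by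
    have := hr H 0 rfl
    omega
  rw [Matrix.rank, Submodule.finrank_eq_zero, LinearMap.range_eq_bot] at h1
  have h2 := congrFun (LinearMap.congr_fun h1 fun _ => 1) τ
  rw [Matrix.mulVecLin_apply, Matrix.mulVec, dotProduct, Fintype.sum_unique] at h2
  simp only [PSR.dynMatrix, Matrix.of_apply, mul_one, LinearMap.zero_apply, Pi.zero_apply] at h2
  have h3 : Fin.append τ (default : Fin 0 → O × A) = τ := by
    rw [Subsingleton.elim default Fin.elim0, Fin.append_elim0]; rfl
  rw [h3] at h2
  exact hτ.ne' h2

/-- What the data are required to satisfy: the collected histories have probability at least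
`p_min`, and the likelihood products are under control. -/
structure GoodData (Θ : Set (PSR S)) (p : Inputs) (ε C : ℝ) (ora : Oracle S) (θ : PSR S) {K : ℕ}
    (D : Fin K → Batch O A H) : Prop where
  pos : 0 < streamProb ora θ D
  pmin_le : ∀ (t : Fin K) (h : Fin H), p.pmin ≤ θ.law (ora.polAt D t) (pre (D t h) h h.2.le)
  lik : ∀ (n : ℕ) (hn : n ≤ K), 1 ≤ n → LikGood Θ ε C θ (pre D n hn)

variable {Θ : Set (PSR S)} {p : Inputs} {ε C : ℝ} {ora : Oracle S} {θ : PSR S} {K : ℕ}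
  {D : Fin K → Batch O A H}

lemma GoodData.mem_confSet (hD : GoodData Θ p ε C ora θ D) (hΘ : ∀ θ ∈ Θ, θ.IsPSR) (hθ : θ ∈ Θ)
    (hC : C ^ 2 ≤ Real.exp p.β) (hC0 : 0 < C) {n : ℕ} (hn : n ≤ K) (h1 : 1 ≤ n) :
    θ ∈ confSet Θ p ora (pre D n hn) :=
  PSRUCB.mem_confSet hΘ hθ hC hC0 (streamProb_pre_pos (hΘ θ hθ) hn hD.pos) (hD.lik n hn h1)
    fun t h => hD.pmin_le (Fin.castLE hn t) h

/-- With ε/p_min = 1/(KH) the error of the envelopes adds at most 8 over all data, which is at most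
2β. -/
lemma GoodData.dataDist_le (hD : GoodData Θ p ε C ora θ D) (hΘ : ∀ θ ∈ Θ, θ.IsPSR) (hθ : θ ∈ Θ)
    (hC : C ^ 2 ≤ Real.exp p.β) (hC0 : 0 < C) (hp : 0 < p.pmin) (hβ : 4 ≤ p.β) (hH : 1 ≤ H)
    (hε : ε = p.pmin / (K * H)) {n : ℕ} (hn : n ≤ K) (h1 : 1 ≤ n) {θ' : PSR S}
    (hθ' : θ' ∈ confSet Θ p ora (pre D n hn)) : dataDist θ' θ (pre D n hn) ≤ 18 * p.β := by
  have h2 := dataDist_le_of_mem_confSet hΘ hθ hC hC0 (streamProb_pre_pos (hΘ θ hθ) hn hD.pos)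
    (hD.lik n hn h1) (fun t h => hD.pmin_le (Fin.castLE hn t) h) hp hθ'
  have hK : (1 : ℝ) ≤ K := by exact_mod_cast h1.trans hn
  have hH' : (1 : ℝ) ≤ H := by exact_mod_cast hH
  have hnK : (n : ℝ) ≤ K := by exact_mod_cast hn
  have h3 : ε / p.pmin = 1 / (K * H) := by rw [hε]; field_simp
  have h4 : (n : ℝ) * H * (8 * (ε / p.pmin) ^ 2) ≤ 8 := by
    rw [h3]
    calc (n : ℝ) * H * (8 * (1 / (K * H)) ^ 2) ≤ (K : ℝ) * H * (8 * (1 / (K * H)) ^ 2) := by gcongr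
      _ = 8 / ((K : ℝ) * H) := by field_simp
      _ ≤ 8 := div_le_self (by norm_num) (one_le_mul_of_one_le_of_one_le hK hH')
  linarith

/-- A stopped run returns an accurate model and a nearly optimal policy. -/
lemma accurate_of_stopTest {η γ cα β : ℝ} (hη : 0 < η) (hγ : 0 < γ) (hH : 1 ≤ H)
    {θ₁ : PSR S} (h₁ : θ₁.IsPSR) (h₂ : θ.IsPSR) (hw₁ : θ₁.WellConditioned γ)
    (hw₂ : θ.WellConditioned γ) {r : ℕ} (hr : 1 ≤ r) (hβ : 1 ≤ β) (hcα : 17 / η ≤ cα)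
    (hlam : p.lam = regParam S.QA S.dim (Fintype.card A) H r γ β)
    (hα : p.α = cα * bonusScale S.QA S.dim (Fintype.card A) H r γ β) {n : ℕ}
    {D : Fin n → Batch O A H} (hb : dataDist θ₁ θ D ≤ 18 * β) {R : (Fin H → O × A) → ℝ}
    (hR : ∀ τ, R τ ∈ Set.Icc (0 : ℝ) 1) {ε : ℝ} {π₀ out : Policy O A}
    (hgreedy : ∀ π, θ₁.value (bonus p θ₁ D) π ≤ θ₁.value (bonus p θ₁ D) π₀)
    (hout : ∀ π, θ₁.value R π ≤ θ₁.value R out)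
    (hterm : θ₁.value (bonus p θ₁ D) π₀ ≤ ε / (1 + η) / 2) :
    (∀ π : Policy O A, θ.value R π - θ.value R out ≤ ε) ∧
      ∀ π : Policy O A, tv (fun τ : Fin H → O × A => θ₁.law π τ) (fun τ => θ.law π τ) ≤ ε := by
  have hQ : (1 : ℝ) ≤ S.QA := by exact_mod_cast h₂.QA_pos
  have hd : (1 : ℝ) ≤ S.dim := by
    exact_mod_cast (h₂.d_pos H.zero_le).trans_le (S.d_le_dim H.zero_le)
  have ha : (1 : ℝ) ≤ Fintype.card A := by exact_mod_cast Fintype.card_pos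
  have hH' : (1 : ℝ) ≤ H := by exact_mod_cast hH
  have hr' : (1 : ℝ) ≤ r := by exact_mod_cast hr
  have hγQ := h₂.gamma_le hγ hH hw₂
  have hl := regParam_pos hQ hd ha hH' hr' hγ hγQ hβ
  have hs := bonusScale_pos hQ hd ha hH' hr' hγ hγQ hβ
  have herr := err_sum_le_bonusScale hQ hd ha hH' hr' hγ hγQ hβ
  have hc0 : 0 < cα := lt_of_lt_of_le (by positivity) hcα
  set s := bonusScale S.QA S.dim (Fintype.card A) H r γ β with hsdef
  rw [← hlam] at hl herr
  have hα0 : 0 < p.α := by rw [hα]; positivity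
  have htv : ∀ π : Policy O A,
      tv (fun τ : Fin H → O × A => θ₁.law π τ) (fun τ => θ.law π τ) ≤ ε := fun π => by
    have h := tv_le_bonus hγ hH h₁ h₂ hw₁ hw₂ D p hl hα0 hb (Y := 17 * s) (by positivity) herr π
    -- The ratio Y/α is at most η, so the comparison factor 2(1 + η) meets exactly the accuracy ε/(1
    -- + η) of the termination test.
    have h3 : 17 * s / p.α ≤ η := by
      rw [hα, mul_div_mul_right _ _ hs.ne', div_le_iff₀ hc0, mul_comm]
      exact (div_le_iff₀ hη).mp hcα
    have h4 : 0 ≤ θ₁.value (bonus p θ₁ D) π :=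
      PSR.value_nonneg h₁ π fun τ => (bonus_mem p hα0.le θ₁ D τ).1
    calc _ ≤ _ := h
      _ ≤ 2 * (1 + η) * (ε / (1 + η) / 2) := by
          have := (hgreedy π).trans hterm
          gcongr
      _ = ε := by field_simp
  refine ⟨fun π => ?_, htv⟩
  -- Two changes of model, for the competitor and for the returned policy, cost ε/2 each.
  have e1 := PSR.value_sub_le h₂ h₁ π hR
  have e2 := PSR.value_sub_le h₁ h₂ out hR
  rw [tv_comm] at e1
  have e3 := htv π
  have e4 := htv out
  have e5 := hout π
  linarith

set_option maxHeartbeats 1000000 in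
/-- Some iteration up to `m` satisfies the termination test, when `m` is large enough. -/
lemma exists_stopTest {η γ cα β δ ε : ℝ} (hη : 0 < η) (hγ : 0 < γ) (hH : 1 ≤ H)
    (h₂ : θ.IsPSR) (hw₂ : θ.WellConditioned γ) {r : ℕ} (hr : 1 ≤ r) (hβ : 1 ≤ β) (hcα : 1 ≤ cα)
    (hlam : p.lam = regParam S.QA S.dim (Fintype.card A) H r γ β)
    (hα : p.α = cα * bonusScale S.QA S.dim (Fintype.card A) H r γ β)
    (hε : 0 < ε) (hε2 : ε ≤ 2) (hδ : 0 < δ) (hδ1 : δ < 1) (hK : 2 ≤ K) {m : ℕ} (hmK : m ≤ K)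
    (hest : ∀ n, 1 ≤ n → ∀ hn : n ≤ K, (ora.est n (pre D n hn)).IsPSR ∧
      (ora.est n (pre D n hn)).WellConditioned γ ∧
      dataDist (ora.est n (pre D n hn)) θ (pre D n hn) ≤ 18 * β ∧
      ∀ t (h : Fin H), 0 < (ora.est n (pre D n hn)).prob (pre (pre D n hn t h) h h.2.le))
    (hpos : ∀ (t : Fin K) (h : Fin H), 0 < θ.prob (pre (D t h) h h.2.le))
    (hpot : ∀ lam : ℝ, lam = regParam S.QA S.dim (Fintype.card A) H r γ β ∨
      lam = γ ^ 2 * (Fintype.card A : ℝ) ^ 2 * β / (S.dim * H) →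
      ∑ t : Fin m, expPotential lam θ (ora.pol t (pre D t (t.2.le.trans hmK)))
        (pre D t (t.2.le.trans hmK)) ≤
      4 * H * (r * Real.log (1 + m * (S.QA : ℝ) ^ 2 / lam)) + 2 * Real.log (1 / (δ / 8)))
    (hm : sampleConst η cα * sampleScale S.QA S.dim (Fintype.card A) H r γ β *
      Real.log (3 + K * r * S.dim * H * Fintype.card A * S.QA / (γ * ε * δ)) ^ 3 / ε ^ 2 < m + 1) :
    ∃ k, 1 ≤ k ∧ k ≤ m ∧ ∃ hk : k ≤ K, StopTest ora p (ε / (1 + η)) (pre D k hk) := by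
  have hQ : (1 : ℝ) ≤ S.QA := by exact_mod_cast h₂.QA_pos
  have hd : (1 : ℝ) ≤ S.dim := by
    exact_mod_cast (h₂.d_pos H.zero_le).trans_le (S.d_le_dim H.zero_le)
  have ha : (1 : ℝ) ≤ Fintype.card A := by exact_mod_cast Fintype.card_pos
  have hH' : (1 : ℝ) ≤ H := by exact_mod_cast hH
  have hr' : (1 : ℝ) ≤ r := by exact_mod_cast hr
  have hγQ := h₂.gamma_le hγ hH hw₂
  have hK2 : (2 : ℝ) ≤ K := by exact_mod_cast hK
  have hK1 : (1 : ℝ) ≤ K := by linarith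
  have hmK' : (m : ℝ) ≤ K := by exact_mod_cast hmK
  by_contra! hno
  -- parameters
  have hl := regParam_pos hQ hd ha hH' hr' hγ hγQ hβ
  have hs := bonusScale_pos hQ hd ha hH' hr' hγ hγQ hβ
  have hscale := one_le_sampleScale hQ hd ha hH' hr' hγ hγQ hβ
  have hgap := gap_sum_le hQ hd ha hH' hr' hγ hγQ hβ
  have herr := err_sum_le hQ hd ha hH' hr' hγ hγQ hβ
  have heg := err_le_gap hQ hd ha hH' hr' hγ hγQ hβ hcα
  have hZ := max_mul_le_sampleScale hQ hd ha hH' hr' hγ hγQ hβ hcα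
    (sq_gap_coeff_le hQ hd ha hH' hr' hγ hγQ hβ hcα)
  have hW := max_mul_le_sampleScale hQ hd ha hH' hr' hγ hγQ hβ hcα
    (sq_bonus_coeff_le hQ hd ha hH' hr' hγ hγQ hβ hcα)
  have hlog1 := log_potential_le hQ hd ha hH' hr' hγ hγQ hβ hK1 hε hε2 hδ hδ1 m.cast_nonneg hmK'
  have hlog2 := log_potential_aux_le hQ hd ha hH' hr' hγ hγQ hβ hK1 hε hε2 hδ hδ1 m.cast_nonneg
    hmK'
  have hlog3 := log_inv_le hQ hd ha hH' hr' hγ hγQ hβ hK1 hε hε2 hδ hδ1 hK2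
  have hL1 := one_le_log hQ hd ha hH' hr' hγ hγQ hβ hK1 hε hε2 hδ hδ1
  obtain ⟨N, hN, hN5⟩ := exists_pow_two_ge hK1 hL1
    (log_le_two_mul_log hQ hd ha hH' hr' hγ hγQ hβ hK1 hε hε2 hδ hδ1)
  set L := Real.log (3 + K * r * S.dim * H * Fintype.card A * S.QA / (γ * ε * δ)) with hL
  set sc := sampleScale S.QA S.dim (Fintype.card A) H r γ β with hsc
  set s := bonusScale S.QA S.dim (Fintype.card A) H r γ β with hsdef
  set lam' : ℝ := γ ^ 2 * (Fintype.card A : ℝ) ^ 2 * β / (S.dim * H) with hlam'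
  have hlam'0 : 0 < lam' := by positivity
  rw [← hlam] at hl heg hZ hW hlog1
  rw [← hα] at heg hZ hW
  have hα0 : 0 < p.α := by rw [hα]; positivity
  set Y : ℝ := 60 * (Fintype.card A * (S.QA : ℝ) ^ 2 * √β / γ) with hY
  set Z : ℝ := p.α * √(2 / p.lam) * √H * Y with hZdef
  set W : ℝ := p.α *
    √(2 * (2 + 2 * (2 * Fintype.card A * S.QA) ^ 2 * (18 * β) / p.lam)) with hWdef
  have hY0 : 0 ≤ Y := by positivity
  have hZ0 : 0 ≤ Z := by positivity
  have hW0 : 0 ≤ W := by positivity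
  -- the potentials
  have hΦ : ∀ lam : ℝ, lam = p.lam ∨ lam = lam' →
      ∑ t : Fin m, expPotential lam θ (ora.pol t (pre D t (t.2.le.trans hmK)))
        (pre D t (t.2.le.trans hmK)) ≤ H * r * (22 * L) := fun lam h => by
    have h3 : Real.log (1 + m * (S.QA : ℝ) ^ 2 / lam) ≤ 4 * L := by
      rcases h with rfl | rfl
      exacts [hlog1, hlog2]
    refine (hpot lam (hlam ▸ h)).trans ?_
    have h4 : (1 : ℝ) ≤ H * r := one_le_mul_of_one_le_of_one_le hH' hr'
    have h5 : 4 * (H : ℝ) * (r * Real.log (1 + m * (S.QA : ℝ) ^ 2 / lam)) ≤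
        4 * H * (r * (4 * L)) := by gcongr
    nlinarith
  set A₁ : Fin m → ℝ := fun t => θ.value (fun τ => min (Z * √(∑ h : Fin H,
    featQuad lam' θ (pre D t (t.2.le.trans hmK)) h (pre τ h h.2.le))) 1)
      (ora.pol t (pre D t (t.2.le.trans hmK))) with hA₁
  set A₂ : Fin m → ℝ := fun t => θ.value (fun τ => min (W * √(∑ h : Fin H,
    featQuad p.lam θ (pre D t (t.2.le.trans hmK)) h (pre τ h h.2.le))) 1)
      (ora.pol t (pre D t (t.2.le.trans hmK))) with hA₂
  have hG : ∀ z : ℝ, max 1 (z ^ 2) * (H * r) ≤ 28800 * cα ^ 2 * sc →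
      √(m * (max 1 (z ^ 2) * (H * r * (22 * L)))) ≤ √(m * (28800 * cα ^ 2 * sc * (22 * L))) :=
    fun z hz => by
      refine Real.sqrt_le_sqrt (mul_le_mul_of_nonneg_left ?_ m.cast_nonneg)
      rw [← mul_assoc]
      exact mul_le_mul_of_nonneg_right hz (by linarith)
  have hA₁s : ∑ t, A₁ t ≤ √(m * (28800 * cα ^ 2 * sc * (22 * L))) :=
    (sum_value_min_le h₂ hlam'0 _ _ hZ0 (le_max_left _ _) (le_max_right _ _)
      (hΦ lam' (Or.inr rfl))).trans (hG Z hZ)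
  have hA₂s : ∑ t, A₂ t ≤ √(m * (28800 * cα ^ 2 * sc * (22 * L))) :=
    (sum_value_min_le h₂ hl _ _ hW0 (le_max_left _ _) (le_max_right _ _)
      (hΦ p.lam (Or.inl rfl))).trans (hG W hW)
  have hA₁0 : ∀ t, 0 ≤ A₁ t := fun t => PSR.value_nonneg h₂ _ fun τ => le_min (by positivity)
    zero_le_one
  have hA₂0 : ∀ t, 0 ≤ A₂ t := fun t => PSR.value_nonneg h₂ _ fun τ => le_min (by positivity)
    zero_le_one
  -- each iteration
  have hstep : ∀ t : Fin m, (if (t : ℕ) = 0 then 0 else ε / (1 + η) / 2) ≤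
      (1 / 2) ^ N + (4 * N + 2) * A₁ t + A₂ t := fun t => by
    split_ifs with ht
    · have := hA₁0 t
      have := hA₂0 t
      positivity
    · have hn : (t : ℕ) ≤ K := t.2.le.trans hmK
      have ht1 : 1 ≤ (t : ℕ) := Nat.one_le_iff_ne_zero.mpr ht
      obtain ⟨h₁, hw₁, hb, hp₁⟩ := hest t ht1 hn
      have hV := not_le.mp (hno t ht1 t.2.le hn)
      refine hV.le.trans ?_
      exact value_bonus_le hγ hH h₁ h₂ hw₁ hw₂ (pre D t hn) p hl hα0 hlam'0 hp₁
        (fun t' h => hpos (Fin.castLE hn t') h) hb hY0 hgap (by positivity) herr heg N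
        (ora.pol t (pre D t hn))
  have hsum := sum_le_sum fun t (_ : t ∈ (univ : Finset (Fin m))) => hstep t
  rw [sum_add_distrib, sum_add_distrib, ← mul_sum, sum_const, card_univ, Fintype.card_fin,
    nsmul_eq_mul] at hsum
  have hfin := sum_bonus_lt hη hcα hscale hL1 hε hε2 hN hN5 hmK' hm
  have hleft : ((m : ℝ) - 1) * (ε / (1 + η) / 2) ≤
      ∑ t : Fin m, (if (t : ℕ) = 0 then 0 else ε / (1 + η) / 2) := by
    have hx : 0 ≤ ε / (1 + η) / 2 := by positivity
    rcases m with _ | m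
    · simp only [CharP.cast_eq_zero, zero_sub, univ_eq_empty, sum_empty]
      linarith
    · rw [Fin.sum_univ_succ]
      simp
  have h3 : (4 * (N : ℝ) + 2) * ∑ t, A₁ t ≤
      (4 * N + 2) * √(m * (28800 * cα ^ 2 * sc * (22 * L))) := by gcongr
  linarith

end Run

end PSRUCB

end

noncomputable section

namespace PSRUCB

open Finset

/-! ### The good event, the choice of the constants, and the theorem -/

section Main

variable {O A : Type} {H : ℕ} {S : CoreTests O A H} [Fintype O] [Fintype A] [Nonempty A]
  [DecidableEq A]

/-- With high probability the data are good and the elliptical potentials are small. -/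
lemma one_sub_le_streamPr_good {Θ : Set (PSR S)} (hΘ : ∀ θ ∈ Θ, θ.IsPSR) {θ : PSR S} (hθ : θ ∈ Θ)
    {r : ℕ} (hr : θ.RankLE r) (hH : 1 ≤ H) {K m : ℕ} (hK : 2 ≤ K) (hmK : m ≤ K) {δ : ℝ}
    (hδ : 0 < δ) (hδ1 : δ < 1) {p : Inputs} {ε : ℝ} (hp0 : 0 < p.pmin)
    (hp : K * H * ((Fintype.card O : ℝ) ^ H * (Fintype.card A : ℝ) ^ H * p.pmin) ≤ δ / 4)
    (hε : ε = p.pmin / (K * H)) {l₁ l₂ : ℝ} (hl₁ : 0 < l₁) (hl₂ : 0 < l₂) (ora : Oracle S) :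
    1 - δ ≤ streamPr ora θ K (fun D => GoodData Θ p ε (8 * (K * netCard Θ ε / δ)) ora θ D ∧
      ∀ lam, lam = l₁ ∨ lam = l₂ →
        ∑ t : Fin m, expPotential lam θ (ora.pol t (pre D t (t.2.le.trans hmK)))
          (pre D t (t.2.le.trans hmK)) ≤
        4 * H * (r * Real.log (1 + m * (S.QA : ℝ) ^ 2 / lam)) + 2 * Real.log (1 / (δ / 8))) := by
  have hP := hΘ θ hθ
  have hO := hP.nonempty_obs
  have hK2 : (2 : ℝ) ≤ K := by exact_mod_cast hK
  have hH' : (1 : ℝ) ≤ H := by exact_mod_cast hH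
  have hε0 : 0 < ε := by rw [hε]; positivity
  obtain ⟨N, hN, hN'⟩ := exists_card_eq_netCard hΘ hε0
  have hn1 : (1 : ℝ) ≤ netCard Θ ε := by exact_mod_cast netCard_pos hΘ ⟨θ, hθ⟩ hε0
  set C : ℝ := 8 * (K * netCard Θ ε / δ) with hC
  have hC0 : 0 < C := by positivity
  -- The failure probability is split as δ/4 for small histories, δ/4 for the likelihoods, and δ/8
  -- for each of the two potentials.
  have f1 := streamPr_exists_law_lt hP ora (K := K) hp0.le
  have f2 := streamPr_not_likGood_le hΘ hθ hε0.le hC0 hN' ora K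
  have f3 := streamPr_expPotential_le hP hr ora hl₁ hmK (q := δ / 8) (by positivity)
  have f4 := streamPr_expPotential_le hP hr ora hl₂ hmK (q := δ / 8) (by positivity)
  have hpm1 : p.pmin ≤ 1 / 4 := by
    have h1 : (1 : ℝ) ≤ Fintype.card O := by exact_mod_cast Fintype.card_pos
    have h2 : (1 : ℝ) ≤ Fintype.card A := by exact_mod_cast Fintype.card_pos
    have h3 : 1 ≤ K * H * ((Fintype.card O : ℝ) ^ H * (Fintype.card A : ℝ) ^ H) :=
      one_le_mul_of_one_le_of_one_le (one_le_mul_of_one_le_of_one_le (by linarith) hH')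
        (one_le_mul_of_one_le_of_one_le (one_le_pow₀ h1) (one_le_pow₀ h2))
    have h4 := le_mul_of_one_le_left hp0.le h3
    linarith
  have f2' : (K : ℝ) * N.card * (Real.exp (K * H * ε / 2) / C) ≤ δ / 4 := by
    have e1 : (K : ℝ) * H * ε / 2 = p.pmin / 2 := by rw [hε]; field_simp
    have e2 : Real.exp (p.pmin / 2) ≤ 2 := by
      have h1 : Real.exp (p.pmin / 2) ≤ Real.exp (Real.log 2) :=
        Real.exp_le_exp.mpr (by linarith [Real.log_two_gt_d9])
      rwa [Real.exp_log (by norm_num)] at h1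
    rw [e1, hN, hC]
    calc (K : ℝ) * netCard Θ ε * (Real.exp (p.pmin / 2) / (8 * (K * netCard Θ ε / δ))) =
          δ / 8 * Real.exp (p.pmin / 2) := by field_simp
      _ ≤ δ / 8 * 2 := by gcongr
      _ = _ := by ring
  rw [← one_sub_streamPr_not hP]
  refine sub_le_sub_left ?_ 1
  refine (streamPr_mono hP ora fun D hD hbad => ?_).trans (((streamPr_or_le hP ora _ _).trans
    (add_le_add ((streamPr_or_le hP ora _ _).trans (add_le_add f1 f2))
      ((streamPr_or_le hP ora _ _).trans (add_le_add f3 f4)))).trans (by linarith))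
  by_contra hc
  simp only [not_or, not_exists, not_and, not_not, not_lt] at hc
  refine hbad ⟨⟨hD, hc.1.1, hc.1.2⟩, ?_⟩
  rintro lam (rfl | rfl)
  exacts [hc.2.1, hc.2.2]

/-- The constants of the algorithm. -/
def runConsts (η : ℝ) (hη : 0 < η) : Consts where
  cp := 1 / 4
  cε := 1
  cβ := 8
  cα := 1 + 17 / η
  C := sampleConst η (1 + 17 / η)
  deg := 3
  cp_pos := by norm_num
  cε_pos := one_pos
  cβ_pos := by norm_num
  cα_pos := by positivity
  C_pos := by unfold sampleConst; positivity

variable {Θ : Set (PSR S)} (hΘ : ∀ θ ∈ Θ, θ.IsPSR) {θ : PSR S} (hθ : θ ∈ Θ) {η δ : ℝ} (hη : 0 < η)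
  {K : ℕ} (hK : 2 ≤ K) (hH : 1 ≤ H) (hδ : 0 < δ) (hδ1 : δ < 1)
include hΘ hθ hK hH hδ hδ1

/-- For x = K|Θ̄_ε|/δ ≥ 2 the constant 8 gives exp β = x⁸ ≥ 64x², the square of the threshold for
the likelihood products, and 8 log 2 ≥ 4. -/
lemma le_betaOf : 4 ≤ betaOf (runConsts η hη) Θ δ K ∧
    (8 * (K * netCard Θ ((runConsts η hη).cε * pminOf (runConsts η hη) O A H δ K / (K * H)) / δ)) ^ 2
      ≤ Real.exp (betaOf (runConsts η hη) Θ δ K) := by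
  have hO := (hΘ θ hθ).nonempty_obs
  have hp0 : 0 < pminOf (runConsts η hη) O A H δ K := pminOf_pos _ hH hδ (by omega)
  have hK2 : (2 : ℝ) ≤ K := by exact_mod_cast hK
  have hH' : (1 : ℝ) ≤ H := by exact_mod_cast hH
  set ε := (runConsts η hη).cε * pminOf (runConsts η hη) O A H δ K / (K * H) with hε
  have hε0 : 0 < ε := div_pos (mul_pos (runConsts η hη).cε_pos hp0) (by positivity)
  have hn1 : (1 : ℝ) ≤ netCard Θ ε := by exact_mod_cast netCard_pos hΘ ⟨θ, hθ⟩ hε0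
  have hx : (2 : ℝ) ≤ K * netCard Θ ε / δ := by
    rw [le_div_iff₀ hδ]
    nlinarith
  have hβ : betaOf (runConsts η hη) Θ δ K = 8 * Real.log (K * netCard Θ ε / δ) := rfl
  set x := K * netCard Θ ε / δ with hxdef
  rw [hβ]
  constructor
  · have h1 := Real.log_le_log two_pos hx
    linarith [Real.log_two_gt_d9]
  · have h1 : Real.exp (8 * Real.log x) = x ^ 8 := by
      have := Real.exp_nat_mul (Real.log x) 8
      rw [Real.exp_log (by linarith)] at this
      exact_mod_cast this
    rw [h1]
    have h2 : (2 : ℝ) ^ 6 ≤ x ^ 6 := pow_le_pow_left₀ two_pos.le hx 6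
    calc (8 * x) ^ 2 = 2 ^ 6 * x ^ 2 := by ring
      _ ≤ x ^ 6 * x ^ 2 := by gcongr
      _ = x ^ 8 := by ring

omit hΘ hθ hK hH hδ hδ1 in
lemma sampleBound_runConsts (hH : 1 ≤ H) {r : ℕ} {γ ε δ : ℝ} (hγ : 0 < γ) (hε : 0 < ε) :
    sampleBound (runConsts η hη) Θ r γ ε δ K / H =
      sampleConst η (1 + 17 / η) * sampleScale S.QA S.dim (Fintype.card A) H r γ
        (betaOf (runConsts η hη) Θ δ K) *
      Real.log (3 + K * r * S.dim * H * Fintype.card A * S.QA / (γ * ε * δ)) ^ 3 / ε ^ 2 := by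
  have hH' : (1 : ℝ) ≤ H := by exact_mod_cast hH
  have h0 : (H : ℝ) ≠ 0 := by positivity
  rw [sampleBound, sampleScale]
  change sampleConst η (1 + 17 / η) * _ * _ ^ 3 / _ = _
  field_simp

end Main

end PSRUCB

end

open PSRUCB
theorem theorem1 (η : ℝ) (hη : 0 < η) :
    ∃ c : Consts,
      ∀ (O A : Type) [Fintype O] [Fintype A] [DecidableEq A] [Nonempty A]
        (H : ℕ) (_ : 1 ≤ H) (S : CoreTests O A H) (r : ℕ) (γ : ℝ) (_ : 0 < γ)
        (Θ : Set (PSR S))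
        (_ : ∀ θ ∈ Θ, θ.IsPSR ∧ θ.RankLE r ∧ θ.WellConditioned γ)
        (θstar : PSR S) (_ : θstar ∈ Θ)
        (R : (Fin H → O × A) → ℝ) (_ : ∀ τ, R τ ∈ Set.Icc (0 : ℝ) 1)
        (ε δ : ℝ) (_ : 0 < ε) (_ : ε ≤ 2) (_ : 0 < δ) (_ : δ < 1),
        (∀ᶠ K : ℕ in Filter.atTop, sampleBound c Θ r γ ε δ K ≤ K * H) ∧
        ∀ K : ℕ, 2 ≤ K → sampleBound c Θ r γ ε δ K ≤ K * H →
          ∀ ora : Oracle S, ora.Valid Θ (inputsOf c Θ r γ δ K) R →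
            1 - δ ≤ streamPr ora θstar K (fun D =>
              ∃ (k : ℕ) (hk : k ≤ K),
                StopsAt ora Θ (inputsOf c Θ r γ δ K) (ε / (1 + η)) D k hk ∧
                (∀ π : Policy O A,
                  θstar.value R π - θstar.value R (ora.out k (pre D k hk)) ≤ ε) ∧
                (∀ π : Policy O A,
                  tv (fun τ : Fin H → O × A => (ora.est k (pre D k hk)).law π τ)
                    (fun τ => θstar.law π τ) ≤ ε) ∧
                (k : ℝ) * H ≤ sampleBound c Θ r γ ε δ K) := by
  refine ⟨runConsts η hη, ?_⟩
  intro O A _ _ _ _ H hH S r γ hγ Θ hΘ' θ hθ R hR ε δ hε hε2 hδ hδ1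
  have hΘ : ∀ θ ∈ Θ, θ.IsPSR := fun θ h => (hΘ' θ h).1
  obtain ⟨hP, hrank, hw⟩ := hΘ' θ hθ
  have hO := hP.nonempty_obs
  refine ⟨eventually_sampleBound_le _ hΘ ⟨θ, hθ⟩ hH r hγ hε hδ, ?_⟩
  intro K hK hB ora hora
  obtain ⟨hβ4, hCβ⟩ := le_betaOf hΘ hθ hη hK hH hδ hδ1
  set c := runConsts η hη with hc
  set p := inputsOf c Θ r γ δ K with hp
  set β := betaOf c Θ δ K with hβ
  have hr : 1 ≤ r := hP.rank_pos hrank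
  have hβ1 : 1 ≤ β := by linarith
  have hQ : (1 : ℝ) ≤ S.QA := by exact_mod_cast hP.QA_pos
  have hd : (1 : ℝ) ≤ S.dim := by
    exact_mod_cast (hP.d_pos H.zero_le).trans_le (S.d_le_dim H.zero_le)
  have ha : (1 : ℝ) ≤ Fintype.card A := by exact_mod_cast Fintype.card_pos
  have hO1 : (1 : ℝ) ≤ Fintype.card O := by exact_mod_cast Fintype.card_pos
  have hH' : (1 : ℝ) ≤ H := by exact_mod_cast hH
  have hr' : (1 : ℝ) ≤ r := by exact_mod_cast hr
  have hK2 : (2 : ℝ) ≤ K := by exact_mod_cast hK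
  have hγQ := hP.gamma_le hγ hH hw
  have hlam : p.lam = regParam S.QA S.dim (Fintype.card A) H r γ β := rfl
  have hα : p.α = (1 + 17 / η) * bonusScale S.QA S.dim (Fintype.card A) H r γ β := rfl
  have hpβ : p.β = β := rfl
  have hp0 : 0 < p.pmin := pminOf_pos c hH hδ (by omega)
  have hcα : 1 ≤ 1 + 17 / η := by
    have : 0 < 17 / η := by positivity
    linarith
  have hpm : (K : ℝ) * H * ((Fintype.card O : ℝ) ^ H * (Fintype.card A : ℝ) ^ H * p.pmin) ≤
      δ / 4 := by
    refine le_of_eq ?_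
    change (K : ℝ) * H * ((Fintype.card O : ℝ) ^ H * (Fintype.card A : ℝ) ^ H *
      (1 / 4 * δ / (K * H * (Fintype.card O : ℝ) ^ H * (Fintype.card A : ℝ) ^ H))) = δ / 4
    field_simp
  set ε' := c.cε * pminOf c O A H δ K / (K * H) with hε'
  have hεp : ε' = p.pmin / (K * H) := by
    rw [hε']
    change 1 * p.pmin / (K * H) = _
    rw [one_mul]
  have hε'0 : 0 < ε' := by rw [hεp]; positivity
  have hn1 : (1 : ℝ) ≤ netCard Θ ε' := by exact_mod_cast netCard_pos hΘ ⟨θ, hθ⟩ hε'0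
  have hC0 : 0 < 8 * (K * netCard Θ ε' / δ) := by positivity
  set B := sampleBound c Θ r γ ε δ K with hBdef
  have hBH : B / H = _ := sampleBound_runConsts hη hH hγ hε
  -- The number of iterations that the bound on the trajectories allows, at H each. It is fixed
  -- before the data are seen, so the potentials need to be controlled at this one length only.
  set m := ⌊B / H⌋₊ with hm
  have hB0 : 0 ≤ B / H := by
    rw [hBH]
    have h1 := one_le_sampleScale hQ hd ha hH' hr' hγ hγQ hβ1
    have h2 := one_le_log hQ hd ha hH' hr' hγ hγQ hβ1 (by linarith : (1 : ℝ) ≤ K) hε hε2 hδ hδ1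
    have h3 : 0 < sampleConst η (1 + 17 / η) := (runConsts η hη).C_pos
    positivity
  have hmB : (m : ℝ) * H ≤ B := by
    rw [← le_div_iff₀ (by linarith)]
    exact Nat.floor_le hB0
  have hmK : m ≤ K := by
    have : (m : ℝ) ≤ K := by
      refine (Nat.floor_le hB0).trans ?_
      rwa [div_le_iff₀ (by linarith)]
    exact_mod_cast this
  have hm1 : B / H < m + 1 := Nat.lt_floor_add_one _
  rw [hBH] at hm1
  refine (one_sub_le_streamPr_good hΘ hθ hrank hH hK hmK hδ hδ1 hp0 hpm hεp
    (regParam_pos hQ hd ha hH' hr' hγ hγQ hβ1)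
    (l₂ := γ ^ 2 * (Fintype.card A : ℝ) ^ 2 * β / (S.dim * H)) (by positivity) ora).trans
    (streamPr_mono hP ora fun D _ hD => ?_)
  obtain ⟨hgood, hpot⟩ := hD
  have hest : ∀ n, 1 ≤ n → ∀ hn : n ≤ K,
      ora.est n (pre D n hn) ∈ confSet Θ p ora (pre D n hn) := fun n h1 hn =>
    hora.est_mem n h1 _ ⟨θ, hgood.mem_confSet hΘ hθ hCβ hC0 hn h1⟩
  have hdist : ∀ n (h1 : 1 ≤ n) (hn : n ≤ K),
      dataDist (ora.est n (pre D n hn)) θ (pre D n hn) ≤ 18 * β := fun n h1 hn =>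
    hgood.dataDist_le hΘ hθ hCβ hC0 hp0 hβ4 hH hεp hn h1 (hest n h1 hn)
  have hpos : ∀ {θ' : PSR S} {h : ℕ} {π : Policy O A} {s : Fin h → O × A},
      p.pmin ≤ θ'.law π s → 0 < θ'.prob s := fun {θ' h π s} hs =>
    pos_of_mul_pos_left (hp0.trans_le hs) (π.weight_nonneg s)
  have hex := exists_stopTest hη hγ hH hP hw hr hβ1 hcα hlam hα hε hε2 hδ hδ1 hK hmK
    (fun n h1 hn => ⟨hΘ _ (hest n h1 hn).1.1, (hΘ' _ (hest n h1 hn).1.1).2.2, hdist n h1 hn,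
      fun t h => hpos ((hest n h1 hn).1.2 t h)⟩)
    (fun t h => hpos (hgood.pmin_le t h)) hpot hm1
  classical
  -- The algorithm halts at the first successful test, hence the least such index.
  obtain ⟨hk1, hkm, hkK, hterm⟩ := Nat.find_spec hex
  set k := Nat.find hex with hk
  refine ⟨k, hkK, ⟨hk1, hterm, fun j hj1 hjk => ⟨hest j hj1 _, fun hlt hs => ?_⟩⟩, ?_⟩
  · exact Nat.find_min hex hlt ⟨hj1, hjk.trans hkm, hjk.trans hkK, hs⟩
  · obtain ⟨h1, h2⟩ := accurate_of_stopTest (r := r) hη hγ hH (hΘ _ (hest k hk1 hkK).1.1) hP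
      (hΘ' _ (hest k hk1 hkK).1.1).2.2 hw hr hβ1 (by linarith) hlam hα (hdist k hk1 hkK) hR
      (hora.pol_greedy k hk1 _) (hora.out_greedy k hk1 _) hterm
    refine ⟨h1, h2, le_trans ?_ hmB⟩
    have : (k : ℝ) ≤ m := by exact_mod_cast hkm
    gcongr
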